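/- Let $G=(V,E)$ be a connected directed graph (parallel edges and loops allowed; connectedness refers to the underlying undirected graph) with $n$ nodes and $m$ edges, distinct nodes $s,t\in V$ and capacities $u_e\in\mathbb{N}=\{0,1,2,\dots\}$. Let $k\ge 0$, and let $b^{(j)}_e\in\mathbb{N}$ and $B_j\in\mathbb{N}$ for $j=1,\dots,k$, $e\in E$. The maximum flow problem with $k$ budget constraints asks for $x\in\mathbb{R}^E$ with $0\le x_e\le u_e$ for all $e\in E$, with flow conservation at every node other than $s$ and $t$, and with $\sum_{e}b^{(j)}_e x_e\le B_j$ for $j=1,\dots,k$, that maximizes the flow value $\operatorname{val}(x)=\sum_{e\in\delta^-(t)}x_e-\sum_{e\in\delta^+(t)}x_e$. (The budget-constrained maximum flow problem is the case $k=1$.) For a simple directed $s$-$t$-path $p$ let $\chi_p\in\{0,1\}^E$ be its incidence vector, i.e. the flow on $p$ with unit flow value. The machine model is a random access machine that works, at unit cost, with index registers (natural numbers; operations $+$, truncated $-$, $\cdot$, floor division, comparison, indirect addressing) and number registers (rational numbers; operations $+,-,\cdot,/$, comparison, assignment of an index). An algorithm is one fixed program, and its running time is its number of steps. Then the following hold.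 1. Every feasible flow $x$ with $\operatorname{val}(x)\ge 0$ (in particular, every maximum one) can be written as $x=\sum_{l=1}^{r}\alpha_l\chi_{p_l}+z$ with $r\le m$, $s$-$t$-paths $p_l$, $\alpha_l\ge 0$, $\sum_l\alpha_l=\operatorname{val}(x)$, and a non-negative circulation $z$ (conserved at all nodes). 2. There is a minimizing oracle for the set of unit flows $\chi_p$ on $s$-$t$-paths: an algorithm that, given such a network and $d\in\mathbb{Q}_{\ge0}^E$, halts after $O(m+n\log n)$ steps and, if an $s$-$t$-path exists, returns the vector $\chi_p$ of an $s$-$t$-path $p$ that minimizes $d^T\chi_p$ among all $s$-$t$-paths. During the computation all indices are bounded by a polynomial in $n+m$ and the encoding lengths of all numbers by a polynomial in the encoding length of the input. 3. For every constant $k$, the maximum flow problem with $k$ budget constraints has a strongly polynomial FPTAS with running time $O(\varepsilon^{-2}\cdot m\log m\cdot(m+n\log n))$. That is, there are an algorithm, a constant $C$ and polynomials $w,\ell$, all depending only on $k$, such that for every instance and every rational $\varepsilon$ with $0<\varepsilon<1$ the algorithm computes a feasible flow $x$ with $\operatorname{val}(x)\ge(1-\varepsilon)\operatorname{val}(y)$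 for every feasible $y$, in at most $C\,\varepsilon^{-2}\cdot m\log(m+1)\cdot(m+n\log n)$ steps; during the computation all indices are at most $w(n+m+\lceil1/\varepsilon\rceil)$, and all numbers have encoding length at most $\ell(L+\lceil1/\varepsilon\rceil)$, where $L$ is the encoding length of the instance together with $\varepsilon$. (Writing $\log(m+1)$ instead of $\log m$ matters only for $m=1$, where $\log m=0$.) -/

import Mathlib

open scoped BigOperators

namespace BCMF

/-! ## Networks, flows and paths -/

/-- A connected directed `s`-`t`-network with `n` nodes and `m` edges (parallel edges and loops are
allowed); connectedness refers to the underlying undirected graph. -/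
structure Network (n m : ℕ) where
  src : Fin m → Fin n
  dst : Fin m → Fin n
  s : Fin n
  t : Fin n
  s_ne_t : s ≠ t
  connected : ∀ u v : Fin n, Relation.EqvGen (fun a b => ∃ e, src e = a ∧ dst e = b) u v

/-- An instance of the maximum flow problem with `k` budget constraints
`∑ e, cost j e * x e ≤ budget j`. All data are non-negative integers. -/
structure Problem (n m k : ℕ) extends Network n m where
  cap : Fin m → ℕ
  cost : Fin k → Fin m → ℕ
  budget : Fin k → ℕ

namespace Network

variable {n m : ℕ} (N : Network n m)

def inflow (x : Fin m → ℝ) (v : Fin n) : ℝ := ∑ e with N.dst e = v, x e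

def outflow (x : Fin m → ℝ) (v : Fin n) : ℝ := ∑ e with N.src e = v, x e

/-- Non-negative, and conserved at every node other than `s` and `t`. -/
def IsFlow (x : Fin m → ℝ) : Prop :=
  (∀ e, 0 ≤ x e) ∧ ∀ v, v ≠ N.s → v ≠ N.t → N.inflow x v = N.outflow x v

/-- The value of a flow: the net amount arriving at `t`. -/
def value (x : Fin m → ℝ) : ℝ := N.inflow x N.t - N.outflow x N.t

/-- `p` is the list of edges of a directed walk from `u` to `v`. -/
def IsWalk : Fin n → List (Fin m) → Fin n → Prop
  | u, [], v => u = v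
  | u, e :: p, v => N.src e = u ∧ IsWalk (N.dst e) p v

/-- `p` is the list of edges of a (simple, directed) `s`-`t`-path: no node is repeated. -/
def IsPath (p : List (Fin m)) : Prop :=
  N.IsWalk N.s p N.t ∧ (N.s :: p.map N.dst).Nodup

end Network

/-- The flow with unit flow value on a path: the incidence vector of its edges. -/
def unitFlow {R : Type*} [Zero R] [One R] {m : ℕ} (p : List (Fin m)) (e : Fin m) : R :=
  if e ∈ p then 1 else 0

/-- Feasible solutions of the budget-constrained maximum flow problem. -/
def Problem.Feasible {n m k : ℕ} (P : Problem n m k) (x : Fin m → ℝ) : Prop :=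
  P.IsFlow x ∧ (∀ e, x e ≤ P.cap e) ∧ ∀ j, ∑ e, (P.cost j e : ℝ) * x e ≤ P.budget j

/-- `x` is a `(1 - ε)`-approximate solution. -/
def Problem.IsApprox {n m k : ℕ} (P : Problem n m k) (ε : ℝ) (x : Fin m → ℝ) : Prop :=
  P.Feasible x ∧ ∀ y, P.Feasible y → (1 - ε) * P.value y ≤ P.value x

/-! ## Encoding lengths -/

/-- Binary encoding length of a rational number in lowest terms. -/
def bits (q : ℚ) : ℕ := 1 + Nat.size q.num.natAbs + Nat.size q.den

/-- Encoding length (up to a polynomial) of a network with rational edge lengths. -/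
def lengthsSize (n : ℕ) {m : ℕ} (d : Fin m → ℚ) : ℕ := n + m + ∑ e, bits (d e)

/-- Encoding length (up to a polynomial) of a problem instance. -/
def Problem.size {n m k : ℕ} (P : Problem n m k) : ℕ :=
  n + m + ∑ e, bits (P.cap e) + ∑ j, (bits (P.budget j) + ∑ e, bits (P.cost j e))

/-! ## The machine model

A random access machine whose memory consists of arrays of indices (natural numbers) and arrays of
rational numbers. Rational numbers are accessible only through the field operations and
comparisons. Programs are written in a structured imperative language. The names of the arrays are
fixed in the program, cells are addressed indirectly. -/

/-- `idx a i` and `num a i` are the `i`-th cells of the index array, resp. number array, called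
`a`. -/
structure State where
  idx : ℕ → ℕ → ℕ
  num : ℕ → ℕ → ℚ

/-- Write `v` to cell `i` of array `a`. -/
def write {α : Type*} (mem : ℕ → ℕ → α) (a i : ℕ) (v : α) : ℕ → ℕ → α :=
  Function.update mem a (Function.update (mem a) i v)

inductive IdxExpr where
  | lit (c : ℕ)
  | read (a : ℕ) (i : IdxExpr)
  | add (x y : IdxExpr)
  | sub (x y : IdxExpr)
  | mul (x y : IdxExpr)
  | div (x y : IdxExpr)

def IdxExpr.eval (σ : State) : IdxExpr → ℕ
  | lit c => c
  | read a i => σ.idx a (i.eval σ)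
  | add x y => x.eval σ + y.eval σ
  | sub x y => x.eval σ - y.eval σ
  | mul x y => x.eval σ * y.eval σ
  | div x y => x.eval σ / y.eval σ

inductive NumExpr where
  | lit (c : ℚ)
  | read (a : ℕ) (i : IdxExpr)
  | ofIdx (x : IdxExpr)
  | add (x y : NumExpr)
  | sub (x y : NumExpr)
  | mul (x y : NumExpr)
  | div (x y : NumExpr)

def NumExpr.eval (σ : State) : NumExpr → ℚ
  | lit c => c
  | read a i => σ.num a (i.eval σ)
  | ofIdx x => (x.eval σ : ℚ)
  | add x y => x.eval σ + y.eval σ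
  | sub x y => x.eval σ - y.eval σ
  | mul x y => x.eval σ * y.eval σ
  | div x y => x.eval σ / y.eval σ

inductive Test where
  | idxEq (x y : IdxExpr)
  | idxLt (x y : IdxExpr)
  | numEq (x y : NumExpr)
  | numLt (x y : NumExpr)
  | not (b : Test)
  | and (b c : Test)

def Test.Holds (σ : State) : Test → Prop
  | idxEq x y => x.eval σ = y.eval σ
  | idxLt x y => x.eval σ < y.eval σ
  | numEq x y => x.eval σ = y.eval σ
  | numLt x y => x.eval σ < y.eval σ
  | not b => ¬ b.Holds σ
  | and b c => b.Holds σ ∧ c.Holds σ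

inductive Program where
  | skip
  | setIdx (a : ℕ) (i : IdxExpr) (v : IdxExpr)
  | setNum (a : ℕ) (i : IdxExpr) (v : NumExpr)
  | seq (p q : Program)
  | branch (b : Test) (p q : Program)
  | loop (b : Test) (p : Program)

/-- `Exec Inv p σ τ T`: started in the state `σ`, the program `p` halts in the state `τ` after `T`
steps, and every state after the initial one satisfies `Inv`. Every assignment and every evaluated
test is one step; as a program contains finitely many expressions, each of fixed size, this
is its number of elementary operations up to a constant factor depending on the program. -/
inductive Exec (Inv : State → Prop) : Program → State → State → ℕ → Prop
  | skip (σ : State) : Exec Inv .skip σ σ 1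
  | setIdx (σ : State) (a : ℕ) (i v : IdxExpr)
      (h : Inv ⟨write σ.idx a (i.eval σ) (v.eval σ), σ.num⟩) :
      Exec Inv (.setIdx a i v) σ ⟨write σ.idx a (i.eval σ) (v.eval σ), σ.num⟩ 1
  | setNum (σ : State) (a : ℕ) (i : IdxExpr) (v : NumExpr)
      (h : Inv ⟨σ.idx, write σ.num a (i.eval σ) (v.eval σ)⟩) :
      Exec Inv (.setNum a i v) σ ⟨σ.idx, write σ.num a (i.eval σ) (v.eval σ)⟩ 1
  | seq {p q : Program} {σ ρ τ : State} {T U : ℕ}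
      (hp : Exec Inv p σ ρ T) (hq : Exec Inv q ρ τ U) : Exec Inv (.seq p q) σ τ (T + U)
  | branchTrue {b : Test} {p q : Program} {σ τ : State} {T : ℕ}
      (hb : b.Holds σ) (hp : Exec Inv p σ τ T) : Exec Inv (.branch b p q) σ τ (T + 1)
  | branchFalse {b : Test} {p q : Program} {σ τ : State} {T : ℕ}
      (hb : ¬ b.Holds σ) (hq : Exec Inv q σ τ T) : Exec Inv (.branch b p q) σ τ (T + 1)
  | loopTrue {b : Test} {p : Program} {σ ρ τ : State} {T U : ℕ}
      (hb : b.Holds σ) (hp : Exec Inv p σ ρ T) (hl : Exec Inv (.loop b p) ρ τ U) :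
      Exec Inv (.loop b p) σ τ (T + U + 1)
  | loopFalse {b : Test} {p : Program} {σ : State}
      (hb : ¬ b.Holds σ) : Exec Inv (.loop b p) σ σ 1

/-- Every index is at most `w` and every rational number has encoding length at most `ℓ`. -/
def State.Within (w ℓ : ℕ) (σ : State) : Prop :=
  (∀ a i, σ.idx a i ≤ w) ∧ ∀ a i, bits (σ.num a i) ≤ ℓ

/-! ## Input and output conventions -/

/-- The array with the entries of `f`, followed by zeros. -/
def cells {α : Type*} [Zero α] {m : ℕ} (f : Fin m → α) (i : ℕ) : α :=
  if h : i < m then f ⟨i, h⟩ else 0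

/-- Index array `0` holds `n, m, s, t`, arrays `1` and `2` hold the end nodes of the edges. -/
def Network.indexInput {n m : ℕ} (N : Network n m) : ℕ → ℕ → ℕ
  | 0 => fun i => [n, m, (N.s : ℕ), (N.t : ℕ)].getD i 0
  | 1 => cells fun e => (N.src e : ℕ)
  | 2 => cells fun e => (N.dst e : ℕ)
  | _ => fun _ => 0

/-- Input of the shortest path problem: number array `1` holds the edge lengths. -/
def Network.start {n m : ℕ} (N : Network n m) (d : Fin m → ℚ) : State where
  idx := N.indexInput
  num
    | 1 => cells d
    | _ => fun _ => 0

/-- Input of the budget-constrained maximum flow problem: number array `0` holds `ε`, array `1` the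
capacities, array `2` the budgets, array `4 + j` the coefficients of the `j`-th constraint. -/
def Problem.start {n m k : ℕ} (P : Problem n m k) (ε : ℚ) : State where
  idx := P.indexInput
  num
    | 0 => fun i => if i = 0 then ε else 0
    | 1 => cells fun e => (P.cap e : ℚ)
    | 2 => cells fun j => (P.budget j : ℚ)
    | 3 => fun _ => 0
    | a + 4 => if h : a < k then cells fun e => (P.cost ⟨a, h⟩ e : ℚ) else fun _ => 0

/-- The result of a computation is read from number array `3`, one entry for each edge. -/
def State.output (σ : State) (m : ℕ) (e : Fin m) : ℚ := σ.num 3 e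

/-! ## The three claims -/

/-- Every feasible flow of non-negative value (in particular, every maximum one) is the sum of at
most `m` flows on `s`-`t`-paths and of a non-negative circulation. -/
def FlowsDecompose : Prop :=
  ∀ (n m k : ℕ) (P : Problem n m k) (x : Fin m → ℝ), P.Feasible x → 0 ≤ P.value x →
    ∃ (r : ℕ) (path : Fin r → List (Fin m)) (α : Fin r → ℝ) (z : Fin m → ℝ),
      r ≤ m ∧ (∀ l, P.IsPath (path l)) ∧ (∀ l, 0 ≤ α l) ∧
      (∀ e, 0 ≤ z e) ∧ (∀ v, P.inflow z v = P.outflow z v) ∧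
      (∀ e, x e = (∑ l, α l * unitFlow (path l) e) + z e) ∧
      P.value x = ∑ l, α l

/-- There is a strongly polynomial minimizing oracle for the set of unit flows on `s`-`t`-paths, for
non-negative cost vectors, that runs in time `O(m + n log n)`. -/
def HasMinimizingOracle : Prop :=
  ∃ (prog : Program) (C : ℝ) (w ℓ : Polynomial ℕ),
    ∀ (n m : ℕ) (N : Network n m) (d : Fin m → ℚ), (∀ e, 0 ≤ d e) →
      ∃ (τ : State) (T : ℕ),
        Exec (State.Within (w.eval (n + m)) (ℓ.eval (lengthsSize n d))) prog (N.start d) τ T ∧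
        (T : ℝ) ≤ C * (m + n * Real.log n) ∧
        ((∃ q, N.IsPath q) → ∃ p, N.IsPath p ∧ (∀ e, τ.output m e = unitFlow p e) ∧
          ∀ q, N.IsPath q → ∑ e, d e * unitFlow p e ≤ ∑ e, d e * unitFlow q e)

/-- The maximum flow problem with `k` budget constraints has a strongly polynomial FPTAS that runs
in time `O(ε⁻² · m log m · (m + n log n))`: the number of arithmetic operations obeys this bound,
indices remain polynomial in `n`, `m` and `1/ε`, and the encoding lengths of all numbers
that occur remain polynomial in the encoding length of the input and `1/ε`. The logarithm is taken
of `m + 1` since `log m` vanishes for `m = 1`. -/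
def HasStronglyPolynomialFPTAS (k : ℕ) : Prop :=
  ∃ (prog : Program) (C : ℝ) (w ℓ : Polynomial ℕ),
    ∀ (n m : ℕ) (P : Problem n m k) (ε : ℚ), 0 < ε → ε < 1 →
      ∃ (τ : State) (T : ℕ),
        Exec (State.Within (w.eval (n + m + ⌈1 / ε⌉₊)) (ℓ.eval (P.size + bits ε + ⌈1 / ε⌉₊)))
          prog (P.start ε) τ T ∧
        (T : ℝ) ≤ C * (1 / (ε : ℝ) ^ 2 * (m * Real.log (m + 1)) * (m + n * Real.log n)) ∧
        P.IsApprox ε fun e => (τ.output m e : ℝ)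

end BCMF

namespace BCMF

set_option linter.unusedSimpArgs false

/-! ## A verification calculus with time credits -/

/-! Flow decomposition. If a flow has positive value, `t` can be reached from `s` through edges that
carry flow: otherwise no flow would enter the set of unreachable nodes, although its net inflow is
the value. Subtract from the flow as much of such a path as the flow on its edges and the value
allow. Either the value becomes zero and a circulation remains, or an edge leaves the support; hence
`m` paths suffice (`Network.IsFlow.exists_decomposition`).

Minimizing oracle. This is Dijkstra's algorithm with a Fibonacci heap. Since the machine has no
infinite number, unreached nodes carry the key `lengthBound d`, which exceeds the length of every
path. Settled nodes never change, so every finite key is witnessed by a simple path of predecessor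
edges through settled nodes (`Network.TracePath`). All numbers that occur are therefore sums of
distinct edge lengths, up to the summand 1, and stay short. In the heap, the textbook statement
about the `i`-th child is replaced by one that needs no order of the children: at most `j + 1`
children have degree plus mark at most `j`. It survives links and cuts, and it implies that the
number of nodes of degree at least `j + 3` is at most half the number of those of degree at least
`j`; so degrees are logarithmic (`Heap.deg_lt`). Running times are amortized by `State.potential`.
Connectedness gives `n ≤ m + 1`, which absorbs the linear initialization.

Approximation scheme. Regard capacities and budgets as `m + k` packing rows `a i · x ≤ b i`, with
weights `y i`, initially 1, and congestions `c i`, initially 0. In every iteration an edge gets the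
length `∑ i, y i * a i e / b i`, the oracle returns a shortest path, and as much flow is sent along
it as fits into an otherwise empty network. A row whose congestion grows by `δ ≤ 1` has its weight
multiplied by `1 + ε * δ ≥ (1 + ε) ^ δ`, so `y i ≥ (1 + ε) ^ c i`. For a feasible flow `f` of
positive value, weak duality and the decomposition of `f` show that the shortest length is at most
`(∑ i, y i) / val f`. Hence sending the amount `a` multiplies `∑ i, y i` by at most `exp (ε * a /
val f)`, and after a total amount `X` one has `(1 + ε) ^ c i ≤ (m + k) * exp (ε * X / val f)` for
all rows. Let `l` be the maximum congestion. Dividing the collected flow by `l` makes it feasible,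
and taking logarithms yields `X / l ≥ (1 - ε) * val f` as soon as `l ≥ 2 * log (m + k) / ε ^ 2`.
Each iteration saturates a row, so `l` is at least the number of iterations divided by `m + k`, and
`O(ε⁻² m log m)` iterations suffice. The core is in `Problem.Feasible.shortest`,
`Problem.Progress.step` and `Problem.Progress.isApprox`. No rounding is needed: each iteration adds
only a polynomial number of bits to weights and congestions.

All programs are verified in a weakest-precondition calculus whose assertions speak of a state and
of the remaining time credits, so correctness, running time and register sizes are proved together.
-/

@[simp] theorem write_same {α : Type*} (mem : ℕ → ℕ → α) (a i : ℕ) (v : α) :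
    write mem a i v a = Function.update (mem a) i v := by
  simp [write]

theorem write_ne {α : Type*} (mem : ℕ → ℕ → α) {a b : ℕ} (i : ℕ) (v : α) (h : b ≠ a) :
    write mem a i v b = mem b := by
  simp [write, h]

/-- The scalar variable stored in cell `0` of the index array `a`. -/
def var (a : ℕ) : IdxExpr := .read a (.lit 0)

@[simp] theorem var_eval (σ : State) (a : ℕ) : (var a).eval σ = σ.idx a 0 := rfl

/-- Sequential composition of a list of programs. -/
def block : List Program → Program
  | [] => .skip
  | p :: l => .seq p (block l)

/-- `wp w ℓ p Q σ c`: with `c` time credits in the state `σ`, the program `p` halts, keeps all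
states within the bounds `w` and `ℓ`, and reaches a state and a number of remaining credits
that satisfy `Q`. -/
def wp (w ℓ : ℕ) : Program → (State → ℕ → Prop) → State → ℕ → Prop
  | .skip, Q => fun σ c => 1 ≤ c ∧ Q σ (c - 1)
  | .setIdx a i v, Q => fun σ c => 1 ≤ c ∧ v.eval σ ≤ w ∧
      Q ⟨write σ.idx a (i.eval σ) (v.eval σ), σ.num⟩ (c - 1)
  | .setNum a i v, Q => fun σ c => 1 ≤ c ∧ bits (v.eval σ) ≤ ℓ ∧
      Q ⟨σ.idx, write σ.num a (i.eval σ) (v.eval σ)⟩ (c - 1)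
  | .seq p q, Q => wp w ℓ p (wp w ℓ q Q)
  | .branch b p q, Q => fun σ c => 1 ≤ c ∧ (b.Holds σ → wp w ℓ p Q σ (c - 1)) ∧
      (¬ b.Holds σ → wp w ℓ q Q σ (c - 1))
  | .loop b p, Q => fun σ c => State.Within w ℓ σ → ∃ τ T,
      Exec (State.Within w ℓ) (.loop b p) σ τ T ∧ T ≤ c ∧ State.Within w ℓ τ ∧ Q τ (c - T)

section Rules

variable {w ℓ : ℕ} {Q : State → ℕ → Prop} {σ : State} {c : ℕ}

theorem wp_skip : wp w ℓ .skip Q σ c = (1 ≤ c ∧ Q σ (c - 1)) := rfl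

theorem wp_setIdx {a : ℕ} {i v : IdxExpr} : wp w ℓ (.setIdx a i v) Q σ c =
    (1 ≤ c ∧ v.eval σ ≤ w ∧ Q ⟨write σ.idx a (i.eval σ) (v.eval σ), σ.num⟩ (c - 1)) := rfl

theorem wp_setNum {a : ℕ} {i : IdxExpr} {v : NumExpr} : wp w ℓ (.setNum a i v) Q σ c =
    (1 ≤ c ∧ bits (v.eval σ) ≤ ℓ ∧
      Q ⟨σ.idx, write σ.num a (i.eval σ) (v.eval σ)⟩ (c - 1)) := rfl

theorem wp_branch {b : Test} {p q : Program} : wp w ℓ (.branch b p q) Q σ c =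
    (1 ≤ c ∧ (b.Holds σ → wp w ℓ p Q σ (c - 1)) ∧ (¬ b.Holds σ → wp w ℓ q Q σ (c - 1))) := rfl

theorem wp_nil : wp w ℓ (block []) Q σ c = (1 ≤ c ∧ Q σ (c - 1)) := rfl

theorem wp_cons {p : Program} {l : List Program} :
    wp w ℓ (block (p :: l)) Q σ c = wp w ℓ p (wp w ℓ (block l) Q) σ c := rfl

end Rules

theorem State.Within.setIdx {w ℓ : ℕ} {σ : State} (h : State.Within w ℓ σ) (a i : ℕ) {v : ℕ}
    (hv : v ≤ w) : State.Within w ℓ ⟨write σ.idx a i v, σ.num⟩ := by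
  refine ⟨fun b j => ?_, h.2⟩
  by_cases hb : b = a
  · subst hb
    by_cases hj : j = i
    · subst hj; simpa using hv
    · simpa [Function.update_of_ne hj] using h.1 b j
  · simpa [write_ne _ _ _ hb] using h.1 b j

theorem State.Within.setNum {w ℓ : ℕ} {σ : State} (h : State.Within w ℓ σ) (a i : ℕ) {v : ℚ}
    (hv : bits v ≤ ℓ) : State.Within w ℓ ⟨σ.idx, write σ.num a i v⟩ := by
  refine ⟨h.1, fun b j => ?_⟩
  by_cases hb : b = a
  · subst hb
    by_cases hj : j = i
    · subst hj; simpa using hv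
    · simpa [Function.update_of_ne hj] using h.2 b j
  · simpa [write_ne _ _ _ hb] using h.2 b j

/-- Soundness of the calculus. A loop has no precondition by recursion on the program, so there the
definition of `wp` is this very statement, and only the other constructs need an argument. -/
theorem wp.exec {w ℓ : ℕ} {p : Program} : ∀ {Q : State → ℕ → Prop} {σ : State} {c : ℕ},
    wp w ℓ p Q σ c → State.Within w ℓ σ → ∃ τ T,
      Exec (State.Within w ℓ) p σ τ T ∧ T ≤ c ∧ State.Within w ℓ τ ∧ Q τ (c - T) := by
  induction p with
  | skip => exact fun h hσ => ⟨_, _, .skip _, h.1, hσ, h.2⟩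
  | setIdx a i v =>
    exact fun h hσ => ⟨_, _, .setIdx _ _ _ _ (hσ.setIdx _ _ h.2.1), h.1, hσ.setIdx _ _ h.2.1, h.2.2⟩
  | setNum a i v =>
    exact fun h hσ => ⟨_, _, .setNum _ _ _ _ (hσ.setNum _ _ h.2.1), h.1, hσ.setNum _ _ h.2.1, h.2.2⟩
  | seq p q hp hq =>
    intro Q σ c h hσ
    obtain ⟨ρ, T, h1, h2, h3, h4⟩ := hp h hσ
    obtain ⟨τ, U, h5, h6, h7, h8⟩ := hq h4 h3
    exact ⟨τ, T + U, .seq h1 h5, by omega, h7, by rwa [Nat.sub_sub] at h8⟩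
  | branch b p q hp hq =>
    intro Q σ c h hσ
    by_cases hb : b.Holds σ
    · obtain ⟨ρ, T, h1, h2, h3, h4⟩ := hp (h.2.1 hb) hσ
      have := h.1
      exact ⟨ρ, T + 1, .branchTrue hb h1, by omega, h3, by rwa [Nat.sub_sub, add_comm 1] at h4⟩
    · obtain ⟨ρ, T, h1, h2, h3, h4⟩ := hq (h.2.2 hb) hσ
      have := h.1
      exact ⟨ρ, T + 1, .branchFalse hb h1, by omega, h3, by rwa [Nat.sub_sub, add_comm 1] at h4⟩
  | loop b p hp => exact fun h hσ => h hσ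

theorem wp.mono {w ℓ : ℕ} {p : Program} : ∀ {Q R : State → ℕ → Prop} {σ : State} {c : ℕ},
    wp w ℓ p Q σ c → (∀ τ c', Q τ c' → R τ c') → wp w ℓ p R σ c := by
  induction p with
  | skip => exact fun h hQ => ⟨h.1, hQ _ _ h.2⟩
  | setIdx a i v => exact fun h hQ => ⟨h.1, h.2.1, hQ _ _ h.2.2⟩
  | setNum a i v => exact fun h hQ => ⟨h.1, h.2.1, hQ _ _ h.2.2⟩
  | seq p q hp hq => exact fun h hQ => hp h fun _ _ h' => hq h' hQ
  | branch b p q hp hq =>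
    exact fun h hQ => ⟨h.1, fun hb => hp (h.2.1 hb) hQ, fun hb => hq (h.2.2 hb) hQ⟩
  | loop b p hp =>
    intro Q R σ c h hQ hσ
    obtain ⟨τ, T, h1, h2, h3, h4⟩ := h hσ
    exact ⟨τ, T, h1, h2, h3, hQ _ _ h4⟩

/-- The loop rule: the time credits guarantee termination. -/
theorem wp_loop {w ℓ : ℕ} {b : Test} {p : Program} {Q : State → ℕ → Prop}
    (I : State → ℕ → Prop) {σ : State} {c : ℕ} (h0 : I σ c)
    (hstep : ∀ σ c, I σ c → b.Holds σ → 1 ≤ c ∧ wp w ℓ p I σ (c - 1))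
    (hend : ∀ σ c, I σ c → ¬ b.Holds σ → 1 ≤ c ∧ Q σ (c - 1)) :
    wp w ℓ (.loop b p) Q σ c := by
  -- Each round consumes a credit for its test, so the credits serve as the termination measure.
  induction c using Nat.strong_induction_on generalizing σ with
  | _ c ih =>
    intro hσ
    by_cases hb : b.Holds σ
    · obtain ⟨hc, h⟩ := hstep σ c h0 hb
      obtain ⟨ρ, T, h1, h2, h3, h4⟩ := h.exec hσ
      obtain ⟨τ, U, h5, h6, h7, h8⟩ := ih _ (by omega) h4 h3
      refine ⟨τ, T + U + 1, .loopTrue hb h1 h5, by omega, h7, ?_⟩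
      rwa [show c - (T + U + 1) = c - 1 - T - U by omega]
    · obtain ⟨hc, h⟩ := hend σ c h0 hb
      exact ⟨σ, 1, .loopFalse hb, hc, hσ, h⟩

/-- `for a = 0, …, bound - 1 do body`. -/
def forLoop (a : ℕ) (bound : IdxExpr) (body : Program) : Program :=
  .seq (.setIdx a (.lit 0) (.lit 0))
    (.loop (.idxLt (var a) bound) (.seq body (.setIdx a (.lit 0) (.add (var a) (.lit 1)))))

/-- The state with the scalar variable `a` set to `v`. -/
def State.setVar (σ : State) (a v : ℕ) : State := ⟨write σ.idx a 0 v, σ.num⟩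

/-- A counting loop whose body takes at most `K` steps. -/
theorem wp_forLoop {w ℓ a K M : ℕ} {bound : IdxExpr} {body : Program} {Q : State → ℕ → Prop}
    (I : ℕ → State → Prop) {σ : State} {c : ℕ} (hM : M ≤ w) (hc : (K + 2) * M + 2 ≤ c)
    (h0 : I 0 (σ.setVar a 0))
    (hbound : ∀ i ρ, I i ρ → bound.eval ρ = M)
    (hbody : ∀ i ρ c, i < M → ρ.idx a 0 = i → I i ρ → K ≤ c →
      wp w ℓ body (fun τ c' => c ≤ c' + K ∧ τ.idx a 0 = i ∧ I (i + 1) (τ.setVar a (i + 1))) ρ c)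
    (hend : ∀ τ c', I M τ → c ≤ c' + ((K + 2) * M + 2) → Q τ c') :
    wp w ℓ (forLoop a bound body) Q σ c := by
  refine ⟨by omega, Nat.zero_le _, ?_⟩
  -- A round costs `K` for the body, one step for the test and one for the increment; the outer
  -- constant 2 pays for clearing the counter and for the last, failing test.
  refine wp_loop (fun τ c' => ∃ i ≤ M, τ.idx a 0 = i ∧ I i τ ∧
    c ≤ c' + (K + 2) * i + 1 ∧ (K + 2) * (M - i) + 1 ≤ c') ?_ ?_ ?_
  · refine ⟨0, Nat.zero_le _, by simp [IdxExpr.eval], h0, by omega, by simp; omega⟩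
  · rintro ρ c' ⟨i, hi, h1, h2, h3, h4⟩ hb
    have hb' : i < M := by simpa [Test.Holds, h1, hbound _ _ h2] using hb
    have e1 : (K + 2) * (M - i) = (K + 2) * (M - (i + 1)) + (K + 2) := by
      rw [show M - i = M - (i + 1) + 1 by omega]; ring
    refine ⟨by omega, (hbody i ρ (c' - 1) hb' h1 h2 (by omega)).mono ?_⟩
    rintro τ c'' ⟨g1, g2, g3⟩
    rw [wp_setIdx]
    refine ⟨by omega, by simp [IdxExpr.eval, g2]; omega, i + 1, hb', by simp [IdxExpr.eval, g2], ?_, ?_, ?_⟩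
    · simpa [IdxExpr.eval, g2, State.setVar] using g3
    · have : (K + 2) * (i + 1) = (K + 2) * i + (K + 2) := by ring
      omega
    · omega
  · rintro ρ c' ⟨i, hi, h1, h2, h3, h4⟩ hb
    have hb' : ¬ i < M := by simpa [Test.Holds, h1, hbound _ _ h2] using hb
    obtain rfl : i = M := by omega
    exact ⟨by omega, hend _ _ h2 (by omega)⟩

/-! ## Fibonacci heaps in arrays -/

/-- A Fibonacci heap on the vertices `y < n` with `dead y = 0`. A vertex with `par y = p + 1` is the
`pos y`-th child of `p`, a vertex with `par y = 0` is a root. The mark of a child counts the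
children that it has lost since it became a child. -/
structure Heap (n : ℕ) (dead par deg mark pos child : ℕ → ℕ) (key : ℕ → ℚ) : Prop where
  parent : ∀ y < n, dead y = 0 → ∀ p, par y = p + 1 →
    p < n ∧ dead p = 0 ∧ pos y < deg p ∧ child (pos y * n + p) = y ∧ key p ≤ key y
  children : ∀ p < n, dead p = 0 → ∀ i < deg p, child (i * n + p) < n ∧
    dead (child (i * n + p)) = 0 ∧ par (child (i * n + p)) = p + 1 ∧ pos (child (i * n + p)) = i
  acyclic : ∃ ht : ℕ → ℕ, ∀ y < n, dead y = 0 → ∀ p, par y = p + 1 → ht y < ht p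
  mark_le : ∀ y < n, mark y ≤ 2
  degrees : ∀ p < n, dead p = 0 → ∀ j,
    ((Finset.range n).filter fun y => dead y = 0 ∧ par y = p + 1 ∧ deg y + mark y ≤ j).card ≤ j + 1

/-- No child has lost more than one child. -/
def Tidy (n : ℕ) (dead par mark : ℕ → ℕ) : Prop :=
  ∀ y < n, dead y = 0 → par y ≠ 0 → mark y ≤ 1

/-- The child lists of all nodes share one array, slot `i` of node `p` being cell `i * n + p`;
distinct slots do not collide because `p < n` is the remainder modulo `n`. -/
theorem address_inj {n i j p q : ℕ} (hp : p < n) (hq : q < n) :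
    i * n + p = j * n + q ↔ i = j ∧ p = q := by
  refine ⟨fun h => ?_, fun h => by rw [h.1, h.2]⟩
  have h1 : (i * n + p) % n = (j * n + q) % n := by rw [h]
  rw [Nat.mul_add_mod_of_lt hp, Nat.mul_add_mod_of_lt hq] at h1
  subst h1
  exact ⟨Nat.eq_of_mul_eq_mul_right (by omega) (Nat.add_right_cancel h), rfl⟩

namespace Heap

variable {n : ℕ} {dead par deg mark pos child : ℕ → ℕ} {key : ℕ → ℚ}

theorem init (hpar : ∀ y < n, par y = 0) (hdeg : ∀ y < n, deg y = 0) (hmark : ∀ y < n, mark y = 0) :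
    Heap n dead par deg mark pos child key where
  parent y hy _ p hp := by simp [hpar y hy] at hp
  children p hp _ i hi := by simp [hdeg p hp] at hi
  acyclic := ⟨fun _ => 0, fun y hy _ p hp => by simp [hpar y hy] at hp⟩
  mark_le y hy := by simp [hmark y hy]
  degrees p _ _ j := by
    rw [Finset.card_eq_zero.2]
    · omega
    · refine Finset.filter_eq_empty_iff.2 fun y hy h => ?_
      simp [hpar y (Finset.mem_range.1 hy)] at h

/-- The gap that `y` leaves in the child list of `p` is filled by the last child `z` (which may be
`y` itself). The degree of `p` drops, so the degree invariant one level higher survives only if its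
mark makes up for it; `hm'` asks for this, and exempts roots, which are nobody's child. -/
theorem cut (H : Heap n dead par deg mark pos child key) {y p d z : ℕ} {mark' : ℕ → ℕ}
    (hy : y < n) (hdy : dead y = 0) (hp : par y = p + 1) (hd : d = deg p - 1)
    (hz : z = child (d * n + p)) (hm : ∀ v < n, mark' v ≤ 2)
    (hm' : ∀ v < n, v ≠ y → dead v = 0 → par v ≠ 0 →
      deg v + mark v ≤ Function.update deg p d v + mark' v) :
    Heap n dead (Function.update par y 0) (Function.update deg p d) mark'
      (Function.update pos z (pos y)) (Function.update child (pos y * n + p) z) key := by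
  obtain ⟨hpn, hdp, h1, h2, h3⟩ := H.parent y hy hdy p hp
  obtain ⟨hzn, hdz, hz1, hz2⟩ := H.children p hpn hdp d (by omega)
  rw [← hz] at hzn hdz hz1 hz2
  have hyz : pos y = d → z = y := fun h => by rw [hz, ← h, h2]
  constructor
  · intro v hv hdv q hq
    have hvy : v ≠ y := by rintro rfl; simp at hq
    rw [Function.update_of_ne hvy] at hq
    obtain ⟨hqn, hdq, g1, g2, g3⟩ := H.parent v hv hdv q hq
    refine ⟨hqn, hdq, ?_⟩
    by_cases hvz : v = z
    · subst hvz
      obtain rfl : q = p := by omega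
      have : pos y ≠ d := fun h => hvy (hyz h)
      simp only [Function.update_self]
      exact ⟨by omega, trivial, g3⟩
    · rw [Function.update_of_ne hvz]
      by_cases hqp : q = p
      · subst hqp
        have e1 : pos v ≠ d := fun h => hvz (by rw [hz, ← h, g2])
        have e2 : pos v ≠ pos y := fun h => hvy (by rw [← g2, ← h2, h])
        rw [Function.update_self, Function.update_of_ne]
        · exact ⟨by omega, g2, g3⟩
        · rw [Ne, address_inj hqn hqn]; tauto
      · rw [Function.update_of_ne hqp, Function.update_of_ne]
        · exact ⟨g1, g2, g3⟩
        · rw [Ne, address_inj hqn hpn]; tauto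
  · intro q hq hdq i hi
    by_cases hqp : q = p
    · subst hqp
      rw [Function.update_self] at hi
      by_cases hiy : i = pos y
      · subst hiy
        have hzy : z ≠ y := by rintro rfl; omega
        simp only [Function.update_self, Function.update_of_ne hzy]
        exact ⟨hzn, hdz, hz1, trivial⟩
      · obtain ⟨g1, g2, g3, g4⟩ := H.children q hpn hdp i (by omega)
        rw [Function.update_of_ne (by rw [Ne, address_inj hpn hpn]; tauto)]
        rw [Function.update_of_ne (by intro h; rw [h] at g4; omega),
          Function.update_of_ne (by intro h; rw [h] at g4; omega)]
        exact ⟨g1, g2, g3, g4⟩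
    · rw [Function.update_of_ne hqp] at hi
      obtain ⟨g1, g2, g3, g4⟩ := H.children q hq hdq i hi
      rw [Function.update_of_ne (by rw [Ne, address_inj hq hpn]; tauto)]
      rw [Function.update_of_ne (by intro h; rw [h] at g3; omega),
        Function.update_of_ne (by intro h; rw [h] at g3; omega)]
      exact ⟨g1, g2, g3, g4⟩
  · obtain ⟨ht, hht⟩ := H.acyclic
    refine ⟨ht, fun v hv hdv q hq => ?_⟩
    have hvy : v ≠ y := by rintro rfl; simp at hq
    rw [Function.update_of_ne hvy] at hq
    exact hht v hv hdv q hq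
  · exact hm
  · intro q hq hdq j
    refine (Finset.card_le_card ?_).trans (H.degrees q hq hdq j)
    intro v hv
    simp only [Finset.mem_filter, Finset.mem_range] at hv ⊢
    obtain ⟨hv, hdv, g1, g2⟩ := hv
    have hvy : v ≠ y := by rintro rfl; simp at g1
    rw [Function.update_of_ne hvy] at g1
    exact ⟨hv, hdv, g1, (hm' v hv hvy hdv (by omega)).trans g2⟩

/-- Raising marks is free for the invariant, since `degrees` only bounds how many children have a
small sum of degree and mark. The value 2 then forces a cut. -/
theorem raise_mark (H : Heap n dead par deg mark pos child key) (x : ℕ) :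
    Heap n dead par deg (Function.update mark x 2) pos child key where
  parent := H.parent
  children := H.children
  acyclic := H.acyclic
  mark_le y hy := by
    rw [Function.update_apply]; split_ifs; exacts [le_rfl, H.mark_le y hy]
  degrees p hp hdp j := by
    refine (Finset.card_le_card ?_).trans (H.degrees p hp hdp j)
    intro v hv
    simp only [Finset.mem_filter, Finset.mem_range] at hv ⊢
    refine ⟨hv.1, hv.2.1, hv.2.2.1, le_trans ?_ hv.2.2.2⟩
    have := H.mark_le v hv.1
    rw [Function.update_apply]; split_ifs <;> omega

/-- A smaller key can violate the heap order only towards the parent, and a root has none.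
Decreasing a key is thus reduced to making the node a root. -/
theorem decrease_root (H : Heap n dead par deg mark pos child key) {x : ℕ} {k : ℚ}
    (hx : par x = 0) (hk : k ≤ key x) :
    Heap n dead par deg mark pos child (Function.update key x k) where
  parent y hy hdy p hp := by
    obtain ⟨h1, h2, h3, h4, h5⟩ := H.parent y hy hdy p hp
    refine ⟨h1, h2, h3, h4, ?_⟩
    have : y ≠ x := by rintro rfl; omega
    rw [Function.update_of_ne this, Function.update_apply]
    split_ifs with h
    · subst h; exact hk.trans h5
    · exact h5
  children := H.children
  acyclic := H.acyclic
  mark_le := H.mark_le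
  degrees := H.degrees

theorem remove (H : Heap n dead par deg mark pos child key) {x : ℕ} (hx : par x = 0)
    (hd : deg x = 0) : Heap n (Function.update dead x 1) par deg mark pos child key := by
  have key' : ∀ v, Function.update dead x 1 v = 0 → v ≠ x ∧ dead v = 0 := by
    intro v hv
    have : v ≠ x := by rintro rfl; simp at hv
    exact ⟨this, by rwa [Function.update_of_ne this] at hv⟩
  constructor
  · intro y hy hdy p hp
    obtain ⟨hyx, hdy⟩ := key' y hdy
    obtain ⟨h1, h2, h3, h4, h5⟩ := H.parent y hy hdy p hp
    have : p ≠ x := by rintro rfl; omega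
    exact ⟨h1, by rwa [Function.update_of_ne this], h3, h4, h5⟩
  · intro p hp hdp i hi
    obtain ⟨hpx, hdp⟩ := key' p hdp
    obtain ⟨h1, h2, h3, h4⟩ := H.children p hp hdp i hi
    have : child (i * n + p) ≠ x := by intro h; rw [h] at h3; omega
    exact ⟨h1, by rwa [Function.update_of_ne this], h3, h4⟩
  · obtain ⟨ht, hht⟩ := H.acyclic
    exact ⟨ht, fun y hy hdy p hp => hht y hy (key' y hdy).2 p hp⟩
  · exact H.mark_le
  · intro p hp hdp j
    refine (Finset.card_le_card ?_).trans (H.degrees p hp (key' p hdp).2 j)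
    intro v hv
    simp only [Finset.mem_filter, Finset.mem_range] at hv ⊢
    exact ⟨hv.1, (key' v hv.2.1).2, hv.2.2⟩

/-- Together with `le_card_children`: `pos` and `child` are inverse to each other, so the degree
counts the children. -/
theorem card_children_le (H : Heap n dead par deg mark pos child key) (p : ℕ) :
    ((Finset.range n).filter fun y => dead y = 0 ∧ par y = p + 1).card ≤ deg p := by
  rw [← Finset.card_range (deg p)]
  refine Finset.card_le_card_of_injOn pos (fun y hy => ?_) fun y hy z hz hyz => ?_
  · simp only [Finset.coe_filter, Finset.mem_range, Set.mem_ofPred_eq] at hy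
    simpa using (H.parent y hy.1 hy.2.1 p hy.2.2).2.2.1
  · simp only [Finset.coe_filter, Finset.mem_range, Set.mem_ofPred_eq] at hy hz
    rw [← (H.parent y hy.1 hy.2.1 p hy.2.2).2.2.2.1, hyz,
      (H.parent z hz.1 hz.2.1 p hz.2.2).2.2.2.1]

theorem le_card_children (H : Heap n dead par deg mark pos child key) {p : ℕ} (hp : p < n)
    (hdp : dead p = 0) :
    deg p ≤ ((Finset.range n).filter fun y => dead y = 0 ∧ par y = p + 1).card := by
  rw [← Finset.card_range (deg p)]
  refine Finset.card_le_card_of_injOn (fun i => child (i * n + p)) (fun i hi => ?_)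
    fun i hi j hj hij => ?_
  · obtain ⟨h1, h2, h3, h4⟩ := H.children p hp hdp i (by simpa using hi)
    simp [h1, h2, h3]
  · rw [← (H.children p hp hdp i (by simpa using hi)).2.2.2, ← (H.children p hp hdp j (by simpa using hj)).2.2.2]
    exact congrArg pos hij

/-- Both roots have the same degree `g`, and the new child enters with mark 0, hence with sum `g`.
For `j < g` it is not counted in `degrees`; for `j ≥ g` the bound holds because there are only `g +
1` children in all. -/
theorem link (H : Heap n dead par deg mark pos child key) {x z : ℕ} (hx : x < n) (hz : z < n)
    (hdx : dead x = 0) (hdz : dead z = 0) (hpx : par x = 0) (hpz : par z = 0) (hxz : x ≠ z)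
    (hdeg : deg z = deg x) (hkey : key x ≤ key z) :
    Heap n dead (Function.update par z (x + 1)) (Function.update deg x (deg x + 1))
      (Function.update mark z 0) (Function.update pos z (deg x))
      (Function.update child (deg x * n + x) z) key := by
  constructor
  · intro y hy hdy p hp
    by_cases hyz : y = z
    · subst hyz
      simp only [Function.update_self, Nat.add_right_cancel_iff] at hp
      subst hp
      simp [hx, hdx, hkey]
    · rw [Function.update_of_ne hyz] at hp
      obtain ⟨h1, h2, h3, h4, h5⟩ := H.parent y hy hdy p hp
      rw [Function.update_of_ne hyz, Function.update_of_ne (a := pos y * n + p)]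
      · refine ⟨h1, h2, ?_, h4, h5⟩
        rw [Function.update_apply]
        split_ifs with h
        · subst h; omega
        · exact h3
      · rw [Ne, address_inj h1 hx]
        rintro ⟨h6, rfl⟩
        omega
  · intro p hp hdp i hi
    by_cases hnew : i = deg x ∧ p = x
    · obtain ⟨rfl, rfl⟩ := hnew
      simp [hz, hdz]
    · rw [Function.update_of_ne (by rwa [Ne, address_inj hp hx])]
      have hi' : i < deg p := by
        rw [Function.update_apply] at hi
        split_ifs at hi with h
        · subst h
          have : i ≠ deg p := fun h => hnew ⟨h, rfl⟩
          omega
        · exact hi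
      obtain ⟨h1, h2, h3, h4⟩ := H.children p hp hdp i hi'
      have : child (i * n + p) ≠ z := by intro h; rw [h] at h3; omega
      rw [Function.update_of_ne this, Function.update_of_ne this]
      exact ⟨h1, h2, h3, h4⟩
  · obtain ⟨ht, hht⟩ := H.acyclic
    -- Raising the height of `x` is harmless as `x` is a root, so no parent has to stay above it.
    refine ⟨Function.update ht x (max (ht x) (ht z + 1)), fun y hy hdy p hp => ?_⟩
    by_cases hyz : y = z
    · subst hyz
      simp only [Function.update_self, Nat.add_right_cancel_iff] at hp
      subst hp
      simp [Function.update_of_ne hxz.symm]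
    · rw [Function.update_of_ne hyz] at hp
      have := hht y hy hdy p hp
      have hyx : y ≠ x := by rintro rfl; omega
      rw [Function.update_of_ne hyx, Function.update_apply]
      split_ifs with h
      · subst h; exact lt_max_of_lt_left this
      · exact this
  · intro y hy
    rw [Function.update_apply]
    split_ifs
    · omega
    · exact H.mark_le y hy
  · intro p hp hdp j
    by_cases hpx' : p = x
    · subst hpx'
      have hch := H.card_children_le p
      rcases lt_or_ge j (deg p) with hj | hj
      · refine (Finset.card_le_card ?_).trans (H.degrees p hp hdp j)
        intro v hv
        simp only [Finset.mem_filter, Finset.mem_range] at hv ⊢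
        obtain ⟨hv, hdv, g1, g2⟩ := hv
        have hvz : v ≠ z := by
          rintro rfl
          rw [Function.update_of_ne hxz.symm] at g2
          omega
        rw [Function.update_of_ne hvz] at g1 g2
        have hvp : v ≠ p := by rintro rfl; omega
        rw [Function.update_of_ne hvp] at g2
        exact ⟨hv, hdv, g1, g2⟩
      · have : ((Finset.range n).filter fun y => dead y = 0 ∧ Function.update par z (p + 1) y = p + 1 ∧
            Function.update deg p (deg p + 1) y + Function.update mark z 0 y ≤ j) ⊆
            insert z ((Finset.range n).filter fun y => dead y = 0 ∧ par y = p + 1) := by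
          intro v hv
          simp only [Finset.mem_filter, Finset.mem_range, Finset.mem_insert] at hv ⊢
          by_cases hvz : v = z
          · exact .inl hvz
          · rw [Function.update_of_ne hvz] at hv
            exact .inr ⟨hv.1, hv.2.1, hv.2.2.1⟩
        have h1 := Finset.card_le_card this
        have h2 := Finset.card_insert_le z ((Finset.range n).filter fun y => dead y = 0 ∧ par y = p + 1)
        omega
    · refine (Finset.card_le_card ?_).trans (H.degrees p hp hdp j)
      intro v hv
      simp only [Finset.mem_filter, Finset.mem_range] at hv ⊢
      obtain ⟨hv, hdv, g1, g2⟩ := hv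
      have hvz : v ≠ z := by
        rintro rfl
        simp only [Function.update_self, Nat.add_right_cancel_iff] at g1
        exact hpx' g1.symm
      rw [Function.update_of_ne hvz] at g1 g2
      have hvx : v ≠ x := by rintro rfl; omega
      rw [Function.update_of_ne hvx] at g2
      exact ⟨hv, hdv, g1, g2⟩

/-- In a tidy heap marks of children are at most 1, so all children of degree below `j` have sum at
most `j`; there are at most `j + 1` of these. A node of degree at least `j + 3` therefore has two
children of degree at least `j`, and different nodes have different children. -/
theorem two_mul_card_le (H : Heap n dead par deg mark pos child key) (ht : Tidy n dead par mark)
    (j : ℕ) :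
    2 * ((Finset.range n).filter fun x => dead x = 0 ∧ j + 3 ≤ deg x).card ≤
      ((Finset.range n).filter fun x => dead x = 0 ∧ j ≤ deg x).card := by
  set S := (Finset.range n).filter fun x => dead x = 0 ∧ j + 3 ≤ deg x with hS
  let ch : ℕ → Finset ℕ := fun x =>
    (Finset.range n).filter fun y => dead y = 0 ∧ par y = x + 1 ∧ j ≤ deg y
  have h1 : ∀ x ∈ S, 2 ≤ (ch x).card := by
    intro x hx
    simp only [hS, Finset.mem_filter, Finset.mem_range] at hx
    have e1 := H.le_card_children hx.1 hx.2.1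
    have e2 := H.degrees x hx.1 hx.2.1 j
    have e3 : ((Finset.range n).filter fun y => dead y = 0 ∧ par y = x + 1) ⊆ ch x ∪
        ((Finset.range n).filter fun y => dead y = 0 ∧ par y = x + 1 ∧ deg y + mark y ≤ j) := by
      intro y hy
      simp only [Finset.mem_filter, Finset.mem_range, Finset.mem_union, ch] at hy ⊢
      have := ht y hy.1 hy.2.1 (by omega)
      rcases lt_or_ge j (deg y + mark y) with h | h
      · exact .inl ⟨hy.1, hy.2.1, hy.2.2, by omega⟩
      · exact .inr ⟨hy.1, hy.2.1, hy.2.2, h⟩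
    have e4 := (Finset.card_le_card e3).trans (Finset.card_union_le _ _)
    omega
  have h2 : (S.biUnion ch).card = ∑ x ∈ S, (ch x).card := by
    refine Finset.card_biUnion fun x _ y _ hxy => Finset.disjoint_left.2 fun v hv hv' => ?_
    simp only [Finset.mem_filter, ch] at hv hv'
    omega
  calc 2 * S.card = ∑ _x ∈ S, 2 := by rw [Finset.sum_const, smul_eq_mul, mul_comm]
    _ ≤ ∑ x ∈ S, (ch x).card := Finset.sum_le_sum h1
    _ = (S.biUnion ch).card := h2.symm
    _ ≤ _ := Finset.card_le_card fun v hv => by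
      simp only [Finset.mem_biUnion, Finset.mem_filter, ch] at hv ⊢
      obtain ⟨x, -, h⟩ := hv
      exact ⟨h.1, h.2.1, h.2.2.2⟩

theorem deg_lt (H : Heap n dead par deg mark pos child key) (ht : Tidy n dead par mark) {x : ℕ}
    (hx : x < n) (hdx : dead x = 0) : deg x < 3 * n.size := by
  -- Iterated halving: the number of nodes shrinks by a factor 2 each time the degree threshold
  -- rises by 3.
  have h : ∀ i, 2 ^ i * ((Finset.range n).filter fun x => dead x = 0 ∧ 3 * i ≤ deg x).card ≤ n := by
    intro i
    induction i with
    | zero => simpa using (Finset.card_filter_le (Finset.range n) _)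
    | succ i ih =>
      refine le_trans ?_ ih
      rw [pow_succ, mul_assoc]
      exact Nat.mul_le_mul_left _ (H.two_mul_card_le ht (3 * i))
  by_contra hlt
  have h1 : 1 ≤ ((Finset.range n).filter fun x => dead x = 0 ∧ 3 * n.size ≤ deg x).card :=
    Finset.card_pos.2 ⟨x, by simp [hx, hdx]; omega⟩
  have h2 := h n.size
  have h3 := Nat.lt_size_self n
  nlinarith

/-- Climb to the parent as long as there is one; the height function from `acyclic` makes this stop.
So the minimum over all nodes is attained at a root. -/
theorem exists_root_le (H : Heap n dead par deg mark pos child key) {y : ℕ} (hy : y < n)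
    (hdy : dead y = 0) : ∃ r < n, dead r = 0 ∧ par r = 0 ∧ key r ≤ key y := by
  obtain ⟨ht, hht⟩ := H.acyclic
  obtain ⟨b, hb⟩ : ∃ b, ∀ v < n, ht v ≤ b :=
    ⟨(Finset.range n).sup ht, fun v hv => Finset.le_sup (Finset.mem_range.2 hv)⟩
  induction hk : b - ht y using Nat.strong_induction_on generalizing y with
  | _ k ih =>
    rcases hp : par y with _ | p
    · exact ⟨y, hy, hdy, hp, le_rfl⟩
    · obtain ⟨h1, h2, -, -, h5⟩ := H.parent y hy hdy p hp
      have h6 := hht y hy hdy p hp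
      have h7 := hb p h1
      obtain ⟨r, hr, hdr, hpr, hkr⟩ := ih (b - ht p) (by omega) h1 h2 rfl
      exact ⟨r, hr, hdr, hpr, hkr.trans h5⟩

end Heap

/-! ## Lists of roots and the potential of a heap -/

/-- The array `R` lists pairwise distinct roots in its cells `0, …, rc - 1`. -/
structure Stacked (n : ℕ) (dead par R : ℕ → ℕ) (rc : ℕ) : Prop where
  mem : ∀ i < rc, R i < n ∧ dead (R i) = 0 ∧ par (R i) = 0
  inj : ∀ i < rc, ∀ j < rc, R i = R j → i = j

/-- The array `R` lists all roots in its cells `0, …, rc - 1`. -/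
structure Listed (n : ℕ) (dead par R : ℕ → ℕ) (rc : ℕ) : Prop extends Stacked n dead par R rc where
  cover : ∀ y < n, dead y = 0 → par y = 0 → ∃ i < rc, R i = y

def rootCount (n : ℕ) (dead par : ℕ → ℕ) : ℕ :=
  ((Finset.range n).filter fun y => dead y = 0 ∧ par y = 0).card

def markSum (n : ℕ) (mark : ℕ → ℕ) : ℕ := ∑ y ∈ Finset.range n, mark y

section Potential

variable {n rc : ℕ} {dead par R : ℕ → ℕ}

theorem Stacked.le (h : Stacked n dead par R rc) : rc ≤ n := by
  simpa using Finset.card_le_card_of_injOn (s := Finset.range rc) (t := Finset.range n) R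
    (fun i hi => by simpa using (h.mem i (by simpa using hi)).1)
    (fun i hi j hj hij => h.inj i (by simpa using hi) j (by simpa using hj) hij)

theorem Stacked.push (h : Stacked n dead par R rc) {y : ℕ} (hy : y < n) (hdy : dead y = 0)
    (hpy : par y = 0) (hR : ∀ i < rc, R i ≠ y) :
    Stacked n dead par (Function.update R rc y) (rc + 1) where
  mem i hi := by
    rw [Function.update_apply]
    split_ifs with h1
    · exact ⟨hy, hdy, hpy⟩
    · exact h.mem i (by omega)
  inj i hi j hj hij := by
    rw [Function.update_apply, Function.update_apply] at hij
    split_ifs at hij with h1 h2 h2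
    · omega
    · exact absurd hij.symm (hR j (by omega))
    · exact absurd hij (hR i (by omega))
    · exact h.inj i (by omega) j (by omega) hij

theorem Listed.cut (h : Listed n dead par R rc) {y : ℕ} (hy : y < n) (hdy : dead y = 0)
    (hpy : par y ≠ 0) :
    Listed n dead (Function.update par y 0) (Function.update R rc y) (rc + 1) where
  toStacked := by
    refine Stacked.push ⟨fun i hi => ?_, h.inj⟩ hy hdy (by simp) fun i hi => ?_
    · obtain ⟨h1, h2, h3⟩ := h.mem i hi
      refine ⟨h1, h2, ?_⟩
      rw [Function.update_apply]; split_ifs; exacts [rfl, h3]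
    · rintro rfl
      exact hpy (h.mem i hi).2.2
  cover v hv hdv hpv := by
    by_cases hvy : v = y
    · exact ⟨rc, by omega, by simp [hvy]⟩
    · rw [Function.update_of_ne hvy] at hpv
      obtain ⟨i, hi, rfl⟩ := h.cover v hv hdv hpv
      exact ⟨i, by omega, by rw [Function.update_of_ne (by omega)]⟩

/-- The last entry of the list is moved into the freed cell. -/
theorem Listed.remove (h : Listed n dead par R rc) {b : ℕ} (hb : b < rc) :
    Listed n (Function.update dead (R b) 1) par (Function.update R b (R (rc - 1))) (rc - 1) where
  mem i hi := by
    have e : ∀ j < rc, j ≠ b → R j < n ∧ Function.update dead (R b) 1 (R j) = 0 ∧ par (R j) = 0 := by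
      intro j hj hjb
      obtain ⟨h1, h2, h3⟩ := h.mem j hj
      exact ⟨h1, by rw [Function.update_of_ne (fun h' => hjb (h.inj j hj b hb h'))]; exact h2, h3⟩
    rw [Function.update_apply (f := R)]
    split_ifs with hib
    · exact e _ (by omega) (by omega)
    · exact e _ (by omega) hib
  inj i hi j hj hij := by
    rw [Function.update_apply, Function.update_apply] at hij
    split_ifs at hij with h1 h2 h2
    · omega
    · have := h.inj _ (by omega) _ (by omega) hij; omega
    · have := h.inj _ (by omega) _ (by omega) hij; omega
    · exact h.inj i (by omega) j (by omega) hij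
  cover v hv hdv hpv := by
    have hvb : v ≠ R b := by rintro rfl; simp at hdv
    rw [Function.update_of_ne hvb] at hdv
    obtain ⟨i, hi, rfl⟩ := h.cover v hv hdv hpv
    by_cases hi' : i = rc - 1
    · have : b ≠ rc - 1 := by rintro rfl; exact hvb (by rw [hi'])
      exact ⟨b, by omega, by simp [hi']⟩
    · refine ⟨i, by omega, ?_⟩
      rw [Function.update_of_ne]
      rintro rfl
      exact hvb rfl

theorem rootCount_cut {y : ℕ} (hy : y < n) (hdy : dead y = 0) (hpy : par y ≠ 0) :
    rootCount n dead (Function.update par y 0) = rootCount n dead par + 1 := by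
  unfold rootCount
  rw [← Finset.card_insert_of_notMem (a := y) (by simp [hpy])]
  congr 1
  ext v
  by_cases hvy : v = y
  · subst hvy; simp [hy, hdy]
  · simp [hvy]

theorem rootCount_link {z x : ℕ} (hz : z < n) (hdz : dead z = 0) (hpz : par z = 0) :
    rootCount n dead (Function.update par z (x + 1)) + 1 = rootCount n dead par := by
  unfold rootCount
  rw [← Finset.card_insert_of_notMem (a := z) (by simp)]
  congr 1
  ext v
  by_cases hvz : v = z
  · subst hvz; simp [hz, hdz, hpz]
  · simp [hvz]

theorem rootCount_remove (x : ℕ) : rootCount n (Function.update dead x 1) par ≤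
    rootCount n dead par := by
  refine Finset.card_le_card fun v hv => ?_
  simp only [Finset.mem_filter] at hv ⊢
  have : v ≠ x := by rintro rfl; simp at hv
  rwa [Function.update_of_ne this] at hv

theorem markSum_update {mark : ℕ → ℕ} {x v : ℕ} (hx : x < n) :
    markSum n (Function.update mark x v) + mark x = markSum n mark + v := by
  unfold markSum
  rw [Finset.sum_update_of_mem (by simpa using hx),
    ← Finset.add_sum_erase _ _ (Finset.mem_range.2 hx), Finset.erase_eq]
  omega

end Potential

/-! ## The heap operations -/

/-- `g` agrees with `f` on all arrays that are not in `S`. -/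
def Frame {α : Type*} (S : List ℕ) (f g : ℕ → α) : Prop := ∀ a, a ∉ S → g a = f a

/-- Cut the vertex in variable `24` from its parent, and store the parent in variable `25`. -/
def cutProgram : Program := block [
  .setIdx 25 (.lit 0) (.sub (.read 8 (var 24)) (.lit 1)),
  .setIdx 26 (.lit 0) (.sub (.read 9 (var 25)) (.lit 1)),
  .setIdx 28 (.lit 0) (.read 12 (.add (.mul (var 26) (var 0)) (var 25))),
  .setIdx 12 (.add (.mul (.read 11 (var 24)) (var 0)) (var 25)) (var 28),
  .setIdx 11 (var 28) (.read 11 (var 24)),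
  .setIdx 9 (var 25) (var 26),
  .setIdx 8 (var 24) (.lit 0),
  .setIdx 10 (var 24) (.lit 0),
  .setIdx 13 (var 20) (var 24),
  .setIdx 20 (.lit 0) (.add (var 20) (.lit 1))]

/-- Memory layout of the heap: index arrays 7 to 12 are `dead`, `par`, `deg`, `mark`, `pos` and
`child`; array 13 is the stack of roots and variable 20 its height; number array 3 holds the keys.
Array 14 will hold the buckets of the consolidation and array 15 the predecessor edges, shifted by
one. -/
abbrev State.HeapAt (n : ℕ) (σ : State) : Prop :=
  Heap n (σ.idx 7) (σ.idx 8) (σ.idx 9) (σ.idx 10) (σ.idx 11) (σ.idx 12) (σ.num 3)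

abbrev State.TidyAt (n : ℕ) (σ : State) : Prop := Tidy n (σ.idx 7) (σ.idx 8) (σ.idx 10)

abbrev State.ListedAt (n : ℕ) (σ : State) : Prop :=
  Listed n (σ.idx 7) (σ.idx 8) (σ.idx 13) (σ.idx 20 0)

/-- The potential of the heap, in time credits. -/
def State.potential (n : ℕ) (σ : State) : ℕ :=
  20 * rootCount n (σ.idx 7) (σ.idx 8) + 20 * σ.idx 20 0 + 60 * markSum n (σ.idx 10)

/-- The effect is described array by array rather than by the heap invariant, because the latter is
restored only once the caller has adjusted the mark of the parent. -/
theorem wp_cutProgram {w ℓ n : ℕ} {Q : State → ℕ → Prop} {σ : State} {c : ℕ} (hw : n + 1 ≤ w)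
    (hn : σ.idx 0 0 = n) {y p : ℕ} (hy : σ.idx 24 0 = y) (hp : σ.idx 8 y = p + 1) (hyn : y < n)
    (hdy : σ.idx 7 y = 0)
    (H : σ.HeapAt n) (hrc : σ.idx 20 0 ≤ n) (hc : 11 ≤ c)
    (hQ : ∀ τ : State, Frame [8, 9, 10, 11, 12, 13, 20, 25, 26, 28] σ.idx τ.idx → τ.num = σ.num →
      τ.idx 25 0 = p → τ.idx 8 = Function.update (σ.idx 8) y 0 →
      τ.idx 9 = Function.update (σ.idx 9) p (σ.idx 9 p - 1) →
      τ.idx 10 = Function.update (σ.idx 10) y 0 →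
      τ.idx 11 = Function.update (σ.idx 11) (σ.idx 12 ((σ.idx 9 p - 1) * n + p)) (σ.idx 11 y) →
      τ.idx 12 = Function.update (σ.idx 12) (σ.idx 11 y * n + p)
        (σ.idx 12 ((σ.idx 9 p - 1) * n + p)) →
      τ.idx 13 = Function.update (σ.idx 13) (σ.idx 20 0) y → τ.idx 20 0 = σ.idx 20 0 + 1 →
      Q τ (c - 11)) :
    wp w ℓ cutProgram Q σ c := by
  obtain ⟨h1, h2, h3, -, -⟩ := H.parent y hyn hdy p hp
  have h4 := (H.le_card_children h1 h2).trans (Finset.card_filter_le _ _)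
  rw [Finset.card_range] at h4
  have h5 := (H.children p h1 h2 (σ.idx 9 p - 1) (by omega)).1
  simp only [cutProgram, wp_cons, wp_nil, wp_setIdx, IdxExpr.eval, var_eval, write_same,
    write_ne, hy, hn, hp, ne_eq, Nat.reduceEqDiff, not_false_eq_true, reduceCtorEq,
    Function.update_self, Nat.sub_sub, Nat.reduceAdd, Nat.add_sub_cancel]
  repeat refine And.intro (by omega) ?_
  apply hQ
  · intro a ha
    simp only [List.mem_cons, List.not_mem_nil, or_false, not_or] at ha
    simp [write_ne, ha]
  all_goals simp [write_ne]

theorem Frame.write {α : Type*} {S : List ℕ} {f g : ℕ → ℕ → α} (h : Frame S f g) {a : ℕ}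
    (ha : a ∈ S) (i : ℕ) (v : α) : Frame S f (BCMF.write g a i v) := fun b hb =>
  (write_ne _ _ _ (fun h' => hb (by rwa [h']))).trans (h b hb)

theorem Frame.trans {α : Type*} {S S' : List ℕ} {f g h : ℕ → α} (h1 : Frame S f g)
    (h2 : Frame S' g h) (hS : S' ⊆ S) : Frame S f h := fun b hb =>
  (h2 b fun hb' => hb (hS hb')).trans (h1 b hb)

theorem Frame.refl {α : Type*} (S : List ℕ) (f : ℕ → α) : Frame S f f := fun _ _ => rfl

/-- Make the vertex in variable `31` a root, by cascading cuts. -/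
def cascadeProgram : Program := block [
  .setIdx 10 (var 31) (.lit 2),
  .setIdx 24 (.lit 0) (var 31),
  .loop (.and (.not (.idxEq (.read 8 (var 24)) (.lit 0))) (.idxEq (.read 10 (var 24)) (.lit 2)))
    (block [
      cutProgram,
      .branch (.not (.idxEq (.read 8 (var 25)) (.lit 0)))
        (.setIdx 10 (var 25) (.add (.read 10 (var 25)) (.lit 1))) .skip,
      .setIdx 24 (.lit 0) (var 25)])]

/-- Amortized constant cost. A cut adds a root and a stack entry (40 credits of potential) and may
raise the mark of the parent by one (60), but resets a mark from 2 to 0 (120); the 20 credits that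
are released pay for the round. The mark 2 given to `x` at the start accounts for the additive
constant. -/
theorem wp_cascadeProgram {w ℓ n : ℕ} {Q : State → ℕ → Prop} {σ : State} {c : ℕ}
    (hw : n + 2 ≤ w) (hn : σ.idx 0 0 = n) {x : ℕ} (hx : σ.idx 31 0 = x) (hxn : x < n)
    (hdx : σ.idx 7 x = 0) (H : σ.HeapAt n) (hT : σ.TidyAt n) (hL : σ.ListedAt n)
    (hc : σ.potential n + 140 ≤ c)
    (hQ : ∀ (τ : State) (c' : ℕ), Frame [8, 9, 10, 11, 12, 13, 20, 24, 25, 26, 28] σ.idx τ.idx →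
      τ.num = σ.num → τ.HeapAt n → τ.TidyAt n → τ.ListedAt n → τ.idx 8 x = 0 →
      c + τ.potential n ≤ c' + σ.potential n + 130 → Q τ c') :
    wp w ℓ cascadeProgram Q σ c := by
  have hmx : markSum n (Function.update (σ.idx 10) x 2) ≤ markSum n (σ.idx 10) + 2 :=
    (Nat.le_add_right _ _).trans (markSum_update hxn).le
  simp only [cascadeProgram, wp_cons, wp_nil, wp_setIdx, IdxExpr.eval, var_eval, write_same,
    write_ne, hx, ne_eq, Nat.reduceEqDiff, not_false_eq_true, reduceCtorEq,
    Function.update_self, Nat.sub_sub, Nat.reduceAdd]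
  repeat refine And.intro (by omega) ?_
  -- The current node `y` is the only child that may carry mark 2. On exit it is a root or has a
  -- smaller mark, so the heap is tidy again.
  refine wp_loop (fun τ c' => ∃ y, τ.idx 24 0 = y ∧ y < n ∧ σ.idx 7 y = 0 ∧
    Frame [8, 9, 10, 11, 12, 13, 20, 24, 25, 26, 28] σ.idx τ.idx ∧ τ.num = σ.num ∧ τ.HeapAt n ∧
    (∀ v < n, τ.idx 7 v = 0 → τ.idx 8 v ≠ 0 → v ≠ y → τ.idx 10 v ≤ 1) ∧ τ.ListedAt n ∧
    (x = y ∧ τ.idx 10 y = 2 ∨ τ.idx 8 x = 0) ∧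
    c + τ.potential n + 2 ≤ c' + σ.potential n + 130 ∧ τ.potential n + 10 ≤ c') ?_ ?_ ?_
  · refine ⟨x, by simp, hxn, hdx, ?_, rfl, ?_, ?_, ?_, .inl ⟨rfl, ?_⟩, ?_, ?_⟩
    · exact ((Frame.refl _ _).write (by simp) _ _).write (by simp) _ _
    · simpa [State.HeapAt, write_ne] using H.raise_mark x
    · intro v hv hdv hpv hvx
      simp only [write_same, write_ne, ne_eq, Nat.reduceEqDiff, not_false_eq_true,
        Function.update_of_ne hvx] at hdv hpv ⊢
      exact hT v hv hdv hpv
    · simpa [State.ListedAt, write_ne] using hL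
    · simp [write_ne]
    · simp only [State.potential] at hc ⊢
      simp only [write_same, write_ne, ne_eq, Nat.reduceEqDiff, not_false_eq_true]
      omega
    · simp only [State.potential] at hc ⊢
      simp only [write_same, write_ne, ne_eq, Nat.reduceEqDiff, not_false_eq_true]
      omega
  · rintro τ c' ⟨y, hy, hyn, hdy, hF, hnum, H, hT, hL, hxy, hc1, hc2⟩ hb
    simp only [Test.Holds, IdxExpr.eval, var_eval, hy] at hb
    obtain ⟨hpy, hmy⟩ := hb
    obtain ⟨p, hp⟩ := Nat.exists_eq_succ_of_ne_zero hpy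
    have h7 : τ.idx 7 = σ.idx 7 := hF 7 (by simp)
    have h0 : τ.idx 0 = σ.idx 0 := hF 0 (by simp)
    rw [← h7] at hdy
    obtain ⟨hpn, hdp, g1, -⟩ := H.parent y hyn hdy p hp
    -- A node is not its own parent, by acyclicity; the updates at `p` and `y` therefore do not
    -- interfere.
    have hpy' : p ≠ y := by
      obtain ⟨ht, hht⟩ := H.acyclic
      rintro rfl
      exact lt_irrefl _ (hht _ hyn hdy _ hp)
    refine ⟨by omega, ?_⟩
    simp only [wp_cons]
    refine wp_cutProgram (by omega) (by rw [h0, hn]) hy hp hyn hdy H hL.le (by omega) ?_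
    intro ρ hF' hnum' h25 h8 h9 h10 h11 h12 h13 h20
    have hr := rootCount_cut (par := τ.idx 8) hyn hdy hpy
    have hm := markSum_update (mark := τ.idx 10) (v := 0) hyn
    have hm2 := markSum_update (mark := Function.update (τ.idx 10) y 0) (v := τ.idx 10 p + 1) hpn
    rw [Function.update_of_ne hpy'] at hm2
    have h7' : ρ.idx 7 = τ.idx 7 := hF' 7 (by simp)
    have hL' := hL.cut hyn hdy hpy
    simp only [State.potential] at hc1 hc2 ⊢
    simp only [wp_cons, wp_branch, Test.Holds, IdxExpr.eval, var_eval, h25, h8, Function.update_of_ne hpy', wp_skip,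
      wp_setIdx, h10, wp_nil, write_same, write_ne, ne_eq, Nat.reduceEqDiff, not_false_eq_true,
      Nat.sub_sub, Nat.reduceAdd]
    have hFρ : Frame [8, 9, 10, 11, 12, 13, 20, 24, 25, 26, 28] σ.idx ρ.idx := hF.trans hF' (by simp)
    refine ⟨by omega, fun hpp => ?_, fun hpp => ?_⟩
    · have hmp := hT p hpn hdp hpp hpy'
      repeat refine And.intro (by omega) ?_
      refine ⟨p, by simp, hpn, by rw [← h7]; exact hdp,
        (hFρ.write (by simp) _ _).write (by simp) _ _, hnum'.trans hnum, ?_, ?_, ?_, .inr ?_,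
        ?_, ?_⟩
      · simp only [State.HeapAt, write_same, write_ne, ne_eq, Nat.reduceEqDiff, not_false_eq_true,
          h7', h8, h9, h10, h11, h12, hnum']
        refine H.cut hyn hdy hp rfl rfl (fun v hv => ?_) fun v hv hvy hdv hpv => ?_
        · rw [Function.update_apply, Function.update_apply]
          have := H.mark_le v hv
          split_ifs <;> omega
        · by_cases hvp : v = p
          · subst hvp; simp; omega
          · simp [hvp, hvy]
      · intro v hv hdv hpv hvp
        simp only [write_same, write_ne, ne_eq, Nat.reduceEqDiff, not_false_eq_true,
          h7', h8, h10, Function.update_of_ne hvp] at hdv hpv ⊢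
        have hvy : v ≠ y := by rintro rfl; simp at hpv
        rw [Function.update_of_ne hvy] at hpv ⊢
        exact hT v hv hdv hpv hvy
      · simpa [State.ListedAt, write_ne, h7', h8, h13, h20] using hL'
      · rcases hxy with ⟨rfl, -⟩ | hx
        · simp
        · rw [Function.update_apply]; split_ifs; exacts [rfl, hx]
      · simp [write_ne, h7', h8, h10, h20]; omega
      · simp [write_ne, h7', h8, h10, h20]; omega
    · have hpp : τ.idx 8 p = 0 := not_not.1 hpp
      repeat refine And.intro (by omega) ?_
      refine ⟨p, by simp, hpn, by rw [← h7]; exact hdp,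
        hFρ.write (by simp) _ _, hnum'.trans hnum, ?_, ?_, ?_, .inr ?_, ?_, ?_⟩
      · simp only [State.HeapAt, write_ne, ne_eq, Nat.reduceEqDiff, not_false_eq_true,
          h7', h8, h9, h10, h11, h12, hnum']
        refine H.cut hyn hdy hp rfl rfl (fun v hv => ?_) fun v hv hvy hdv hpv => ?_
        · rw [Function.update_apply]
          have := H.mark_le v hv
          split_ifs <;> omega
        · have hvp : v ≠ p := by rintro rfl; omega
          simp [hvp, hvy]
      · intro v hv hdv hpv hvp
        simp only [write_ne, ne_eq, Nat.reduceEqDiff, not_false_eq_true,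
          h7', h8, h10] at hdv hpv ⊢
        have hvy : v ≠ y := by rintro rfl; simp at hpv
        rw [Function.update_of_ne hvy] at hpv ⊢
        exact hT v hv hdv hpv hvy
      · simpa [State.ListedAt, write_ne, h7', h8, h13, h20] using hL'
      · rcases hxy with ⟨rfl, -⟩ | hx
        · simp
        · rw [Function.update_apply]; split_ifs; exacts [rfl, hx]
      · simp [write_ne, h7', h8, h10, h20]; omega
      · simp [write_ne, h7', h8, h10, h20]; omega
  · rintro τ c' ⟨y, hy, hyn, hdy, hF, hnum, H, hT, hL, hxy, hc1, hc2⟩ hb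
    simp only [Test.Holds, IdxExpr.eval, var_eval, hy, not_and, not_not] at hb
    refine ⟨by omega, by omega, hQ _ _ hF hnum H ?_ hL ?_ (by omega)⟩
    · intro v hv hdv hpv
      by_cases hvy : v = y
      · subst hvy
        have h1 := hb hpv
        have h2 := H.mark_le v hv
        omega
      · exact hT v hv hdv hpv hvy
    · rcases hxy with ⟨rfl, h2⟩ | hx
      · by_contra h; exact hb h h2
      · exact hx

/-! ## Extracting the minimum -/

/-- During the consolidation, the roots are the entries of the stack `R`, the entries of the buckets
`A`, which are indexed by degree, and the current vertex `cur - 1` if `cur ≠ 0`. -/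
structure Buckets (n : ℕ) (dead par deg R : ℕ → ℕ) (rc : ℕ) (A : ℕ → ℕ) (L cur : ℕ) : Prop
    extends Stacked n dead par R rc where
  bucket : ∀ d < L, ∀ z, A d = z + 1 →
    z < n ∧ dead z = 0 ∧ par z = 0 ∧ deg z = d ∧ ∀ i < rc, R i ≠ z
  current : ∀ y, cur = y + 1 →
    y < n ∧ dead y = 0 ∧ par y = 0 ∧ (∀ i < rc, R i ≠ y) ∧ ∀ d < L, A d ≠ y + 1
  cover : ∀ y < n, dead y = 0 → par y = 0 →
    (∃ i < rc, R i = y) ∨ A (deg y) = y + 1 ∨ cur = y + 1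

namespace Buckets

variable {n rc L : ℕ} {dead par deg R A : ℕ → ℕ}

theorem ofListed (h : Listed n dead par R rc) (hA : ∀ d < L, A d = 0) :
    Buckets n dead par deg R rc A L 0 where
  toStacked := h.toStacked
  bucket d hd z hz := by simp [hA d hd] at hz
  current y hy := by simp at hy
  cover y hy hdy hpy := .inl (h.cover y hy hdy hpy)

theorem pop (h : Buckets n dead par deg R rc A L 0) (hrc : rc ≠ 0) :
    Buckets n dead par deg R (rc - 1) A L (R (rc - 1) + 1) where
  mem i hi := h.mem i (by omega)
  inj i hi j hj hij := h.inj i (by omega) j (by omega) hij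
  bucket d hd z hz := by
    obtain ⟨h1, h2, h3, h4, h5⟩ := h.bucket d hd z hz
    exact ⟨h1, h2, h3, h4, fun i hi => h5 i (by omega)⟩
  current y hy := by
    obtain rfl : R (rc - 1) = y := by omega
    obtain ⟨h1, h2, h3⟩ := h.mem (rc - 1) (by omega)
    refine ⟨h1, h2, h3, fun i hi hi' => ?_, fun d hd hd' => ?_⟩
    · have := h.inj i (by omega) (rc - 1) (by omega) hi'
      omega
    · exact (h.bucket d hd _ hd').2.2.2.2 (rc - 1) (by omega) rfl
  cover y hy hdy hpy := by
    rcases h.cover y hy hdy hpy with ⟨i, hi, rfl⟩ | h' | h'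
    · by_cases hi' : i = rc - 1
      · subst hi'; exact .inr (.inr rfl)
      · exact .inl ⟨i, by omega, rfl⟩
    · exact .inr (.inl h')
    · simp at h'

theorem store {y : ℕ} (h : Buckets n dead par deg R rc A L (y + 1)) (hA : A (deg y) = 0) :
    Buckets n dead par deg R rc (Function.update A (deg y) (y + 1)) L 0 where
  toStacked := h.toStacked
  bucket d hd z hz := by
    rw [Function.update_apply] at hz
    split_ifs at hz with h'
    · obtain rfl : y = z := by omega
      obtain ⟨h1, h2, h3, h4, h5⟩ := h.current y rfl
      exact ⟨h1, h2, h3, h'.symm, h4⟩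
    · exact h.bucket d hd z hz
  current y hy := by simp at hy
  cover v hv hdv hpv := by
    rcases h.cover v hv hdv hpv with h' | h' | h'
    · exact .inl h'
    · refine .inr (.inl ?_)
      rw [Function.update_of_ne]
      · exact h'
      · intro h''; rw [h''] at h'; omega
    · obtain rfl : y = v := by omega
      exact .inr (.inl (by simp))

/-- The loser ceases to be a root. The winner stays current with a larger degree, so the bucket of
the old degree is emptied and no bucket mentions the current node. -/
theorem link {y z x l : ℕ} (h : Buckets n dead par deg R rc A L (y + 1)) (hL : deg y < L)
    (hA : A (deg y) = z + 1) (hxl : x = y ∧ l = z ∨ x = z ∧ l = y) :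
    Buckets n dead (Function.update par l (x + 1)) (Function.update deg x (deg x + 1)) R rc
      (Function.update A (deg y) 0) L (x + 1) := by
  obtain ⟨hyn, hdy, hpy, hyR, hyA⟩ := h.current y rfl
  obtain ⟨hzn, hdz, hpz, hz, hzR⟩ := h.bucket _ hL z hA
  have hyz : y ≠ z := by rintro rfl; exact hyA _ hL hA
  have hA' : ∀ d < L, ∀ v, Function.update A (deg y) 0 d = v + 1 → A d = v + 1 ∧ v ≠ y ∧ v ≠ z := by
    intro d hd v hv
    have hdy : d ≠ deg y := by rintro rfl; simp at hv
    rw [Function.update_of_ne hdy] at hv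
    refine ⟨hv, ?_, ?_⟩
    · rintro rfl; exact hyA d hd hv
    · rintro rfl; exact hdy (hz ▸ ((h.bucket d hd v hv).2.2.2.1).symm)
  have hx : x = y ∨ x = z := by tauto
  have hl : l = y ∨ l = z := by tauto
  have hlx : x ≠ l := by rintro rfl; rcases hxl with h | h <;> omega
  constructor
  · refine ⟨fun i hi => ?_, h.inj⟩
    obtain ⟨h1, h2, h3⟩ := h.mem i hi
    have h4 := hyR i hi
    have h5 := hzR i hi
    refine ⟨h1, h2, ?_⟩
    rw [Function.update_of_ne (by rcases hl with rfl | rfl <;> assumption)]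
    exact h3
  · intro d hd v hv
    obtain ⟨hv, hvy, hvz⟩ := hA' d hd v hv
    obtain ⟨h1, h2, h3, h4, h5⟩ := h.bucket d hd v hv
    rw [Function.update_of_ne (by rcases hl with rfl | rfl <;> assumption),
      Function.update_of_ne (by rcases hx with rfl | rfl <;> assumption)]
    exact ⟨h1, h2, h3, h4, h5⟩
  · intro v hv
    obtain rfl : x = v := by omega
    rw [Function.update_of_ne hlx]
    refine ⟨?_, ?_, ?_, ?_, fun d hd hd' => ?_⟩
    · rcases hx with rfl | rfl <;> assumption
    · rcases hx with rfl | rfl <;> assumption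
    · rcases hx with rfl | rfl <;> assumption
    · rcases hx with rfl | rfl <;> assumption
    · obtain ⟨-, h1, h2⟩ := hA' d hd x hd'
      tauto
  · intro v hv hdv hpv
    have hvl : v ≠ l := by rintro rfl; simp at hpv
    rw [Function.update_of_ne hvl] at hpv
    by_cases hvx : v = x
    · exact .inr (.inr (by rw [hvx]))
    · have hvy : v ≠ y := by
        rintro rfl
        rcases hxl with h | h <;> omega
      have hvz : v ≠ z := by
        rintro rfl
        rcases hxl with h | h <;> omega
      rcases h.cover v hv hdv hpv with h' | h' | h'
      · exact .inl h'
      · refine .inr (.inl ?_)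
        rw [Function.update_of_ne hvx, Function.update_of_ne]
        · exact h'
        · intro h''; rw [h''] at h'; omega
      · omega

end Buckets

/-- Link the current root (variable `24`) to the root in the bucket of its degree. -/
def linkProgram : Program := block [
  .setIdx 28 (.lit 0) (.sub (.read 14 (.read 9 (var 24))) (.lit 1)),
  .setIdx 14 (.read 9 (var 24)) (.lit 0),
  .branch (.numLt (.read 3 (var 28)) (.read 3 (var 24)))
    (block [.setIdx 25 (.lit 0) (var 24), .setIdx 24 (.lit 0) (var 28),
      .setIdx 28 (.lit 0) (var 25)]) .skip,
  .setIdx 12 (.add (.mul (.read 9 (var 24)) (var 0)) (var 24)) (var 28),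
  .setIdx 11 (var 28) (.read 9 (var 24)),
  .setIdx 8 (var 28) (.add (var 24) (.lit 1)),
  .setIdx 10 (var 28) (.lit 0),
  .setIdx 9 (var 24) (.add (.read 9 (var 24)) (.lit 1))]

theorem wp_linkProgram {w ℓ n : ℕ} {Q : State → ℕ → Prop} {σ : State} {c y z g : ℕ}
    (hw : n + 1 ≤ w) (hn : σ.idx 0 0 = n) (hy : σ.idx 24 0 = y) (hyn : y < n) (hzn : z < n)
    (hg : σ.idx 9 y = g) (hgz : σ.idx 9 z = g) (hgw : g + 1 ≤ w) (hz : σ.idx 14 g = z + 1)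
    (hc : 13 ≤ c)
    (hQ : ∀ (τ : State) (c' x l : ℕ), (x = y ∧ l = z ∨ x = z ∧ l = y) →
      σ.num 3 x ≤ σ.num 3 l → Frame [8, 9, 10, 11, 12, 14, 24, 25, 28] σ.idx τ.idx →
      τ.num = σ.num → τ.idx 24 0 = x →
      τ.idx 8 = Function.update (σ.idx 8) l (x + 1) →
      τ.idx 9 = Function.update (σ.idx 9) x (g + 1) →
      τ.idx 10 = Function.update (σ.idx 10) l 0 →
      τ.idx 11 = Function.update (σ.idx 11) l g →
      τ.idx 12 = Function.update (σ.idx 12) (g * n + x) l →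
      τ.idx 14 = Function.update (σ.idx 14) g 0 → c ≤ c' + 13 → Q τ c') :
    wp w ℓ linkProgram Q σ c := by
  simp only [linkProgram, wp_cons, wp_nil, wp_setIdx, wp_branch, wp_skip, IdxExpr.eval, var_eval,
    write_same, write_ne, hy, hn, hg, hgz, hz, ne_eq, Nat.reduceEqDiff, not_false_eq_true, reduceCtorEq,
    Function.update_self, Nat.sub_sub, Nat.reduceAdd, Nat.add_sub_cancel, Test.Holds, NumExpr.eval]
  refine ⟨by omega, by omega, by omega, by omega, by omega, fun hlt => ?_, fun hlt => ?_⟩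
  · repeat refine And.intro (by omega) ?_
    refine hQ _ _ z y (.inr ⟨rfl, rfl⟩) hlt.le ?_ rfl ?_ ?_ ?_ ?_ ?_ ?_ ?_ (by omega)
    · intro a ha
      simp only [List.mem_cons, List.not_mem_nil, or_false, not_or] at ha
      simp [write_ne, ha]
    all_goals simp [write_ne]
  · repeat refine And.intro (by omega) ?_
    refine hQ _ _ y z (.inl ⟨rfl, rfl⟩) (not_lt.1 hlt) ?_ rfl ?_ ?_ ?_ ?_ ?_ ?_ ?_ (by omega)
    · intro a ha
      simp only [List.mem_cons, List.not_mem_nil, or_false, not_or] at ha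
      simp [write_ne, ha]
    all_goals simp [write_ne, hy]

/-- Link all roots on the stack, until the roots have different degrees and are in the buckets. -/
def consolidateProgram : Program :=
  .loop (.not (.idxEq (var 20) (.lit 0))) (block [
    .setIdx 20 (.lit 0) (.sub (var 20) (.lit 1)),
    .setIdx 24 (.lit 0) (.read 13 (var 20)),
    .loop (.not (.idxEq (.read 14 (.read 9 (var 24))) (.lit 0))) linkProgram,
    .setIdx 14 (.read 9 (var 24)) (.add (var 24) (.lit 1))])

abbrev State.BucketsAt (n L cur : ℕ) (σ : State) : Prop :=
  Buckets n (σ.idx 7) (σ.idx 8) (σ.idx 9) (σ.idx 13) (σ.idx 20 0) (σ.idx 14) L cur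

/-- Every link removes a root and every pop shortens the stack, and either releases 20 credits of
potential. So the whole consolidation is paid for by the potential, up to one step. The degree bound
keeps all bucket addresses below `3 * n.size`. -/
theorem wp_consolidateProgram {w ℓ n : ℕ} {Q : State → ℕ → Prop} {σ : State} {c : ℕ}
    (hw : 3 * n.size + n + 2 ≤ w) (hn : σ.idx 0 0 = n) (H : σ.HeapAt n) (hT : σ.TidyAt n)
    (hB : σ.BucketsAt n (3 * n.size) 0) (hc : σ.potential n + 10 ≤ c)
    (hQ : ∀ (τ : State) (c' : ℕ),
      Frame [8, 9, 10, 11, 12, 14, 20, 24, 25, 28] σ.idx τ.idx →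
      τ.num = σ.num → τ.HeapAt n → τ.TidyAt n → τ.BucketsAt n (3 * n.size) 0 →
      τ.idx 20 0 = 0 → c + τ.potential n ≤ c' + σ.potential n + 1 → Q τ c') :
    wp w ℓ consolidateProgram Q σ c := by
  refine wp_loop (fun τ c' => Frame [8, 9, 10, 11, 12, 14, 20, 24, 25, 28] σ.idx τ.idx ∧
    τ.num = σ.num ∧ τ.HeapAt n ∧ τ.TidyAt n ∧ τ.BucketsAt n (3 * n.size) 0 ∧
    c + τ.potential n ≤ c' + σ.potential n ∧ τ.potential n + 10 ≤ c') ?_ ?_ ?_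
  · exact ⟨Frame.refl _ _, rfl, H, hT, hB, le_rfl, hc⟩
  · rintro τ c' ⟨hF, hnum, H, hT, hB, hc1, hc2⟩ hb
    simp only [Test.Holds, IdxExpr.eval, var_eval] at hb
    have hle := hB.toStacked.le
    have hRn := (hB.toStacked.mem (τ.idx 20 0 - 1) (by omega)).1
    simp only [State.potential] at hc1 hc2
    simp only [wp_cons, wp_setIdx, IdxExpr.eval, var_eval, write_same,
      write_ne, ne_eq, Nat.reduceEqDiff, not_false_eq_true, Function.update_self, Nat.sub_sub,
      Nat.reduceAdd]
    repeat refine And.intro (by omega) ?_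
    -- Popping lowers the potential by 20; 10 of these credits stay in reserve for leaving the inner
    -- loop and for storing the root in its bucket.
    refine wp_loop (fun ρ c'' => Frame [8, 9, 10, 11, 12, 14, 20, 24, 25, 28] σ.idx ρ.idx ∧
      ρ.num = σ.num ∧ ρ.HeapAt n ∧ ρ.TidyAt n ∧
      ρ.BucketsAt n (3 * n.size) (ρ.idx 24 0 + 1) ∧
      c + ρ.potential n + 10 ≤ c'' + σ.potential n ∧ ρ.potential n + 20 ≤ c'') ?_ ?_ ?_
    · refine ⟨(hF.write (by simp) _ _).write (by simp) _ _, hnum, ?_, ?_, ?_, ?_, ?_⟩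
      · simpa [State.HeapAt, write_ne] using H
      · simpa [State.TidyAt, write_ne] using hT
      · simpa [State.BucketsAt, write_ne] using hB.pop hb
      · simp [State.potential, write_ne]; omega
      · simp [State.potential, write_ne]; omega
    · rintro ρ c'' ⟨hF, hnum, H, hT, hB, hc1, hc2⟩ hb
      simp only [Test.Holds, IdxExpr.eval, var_eval] at hb
      obtain ⟨hyn, hdy, hpy, hyR, hyA⟩ := hB.current _ rfl
      obtain ⟨z, hz⟩ := Nat.exists_eq_succ_of_ne_zero hb
      have hdeg := H.deg_lt hT hyn hdy
      obtain ⟨hzn, hdz, hpz, hzg, hzR⟩ := hB.bucket _ hdeg z hz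
      have hyz : ρ.idx 24 0 ≠ z := fun h => hyA _ hdeg (h ▸ hz)
      refine ⟨by omega, ?_⟩
      refine wp_linkProgram (by omega) ((congrFun (hF 0 (by simp)) 0).trans hn) rfl hyn hzn rfl hzg
        (by omega) hz (by omega) ?_
      intro τ c3 x l hxl hkey hF' hnum' h24 h8 h9 h10 h11 h12 h14 hc3
      have hxn : x < n ∧ ρ.idx 7 x = 0 ∧ ρ.idx 8 x = 0 ∧
          ρ.idx 9 x = ρ.idx 9 (ρ.idx 24 0) := by
        rcases hxl with ⟨rfl, rfl⟩ | ⟨rfl, rfl⟩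
        · exact ⟨hyn, hdy, hpy, rfl⟩
        · exact ⟨hzn, hdz, hpz, hzg⟩
      have hln : l < n ∧ ρ.idx 7 l = 0 ∧ ρ.idx 8 l = 0 ∧ ρ.idx 9 l = ρ.idx 9 (ρ.idx 24 0) := by
        rcases hxl with ⟨rfl, rfl⟩ | ⟨rfl, rfl⟩
        · exact ⟨hzn, hdz, hpz, hzg⟩
        · exact ⟨hyn, hdy, hpy, rfl⟩
      have hxl' : x ≠ l := by rcases hxl with ⟨rfl, rfl⟩ | ⟨rfl, rfl⟩; exacts [hyz, hyz.symm]
      obtain ⟨hxn, hdx, hpx, hgx⟩ := hxn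
      obtain ⟨hln, hdl, hpl, hgl⟩ := hln
      have h7 : τ.idx 7 = ρ.idx 7 := hF' 7 (by simp)
      have h13 : τ.idx 13 = ρ.idx 13 := hF' 13 (by simp)
      have h20 : τ.idx 20 = ρ.idx 20 := hF' 20 (by simp)
      have hr := rootCount_link (x := x) hln hdl hpl
      have hm := markSum_update (mark := ρ.idx 10) (v := 0) hln
      rw [← hgx] at h9 h11 h12
      refine ⟨hF.trans hF' (by simp), hnum'.trans hnum, ?_, ?_, ?_, ?_, ?_⟩
      · simp only [State.HeapAt, h7, h8, h9, h10, h11, h12, hnum']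
        exact H.link hxn hln hdx hdl hpx hpl hxl' (hgl.trans hgx.symm) hkey
      · intro v hv hdv hpv
        rw [h7] at hdv
        rw [h8] at hpv
        rw [h10]
        by_cases hvl : v = l
        · simp [hvl]
        · rw [Function.update_of_ne hvl] at hpv ⊢
          exact hT v hv hdv hpv
      · simp only [State.BucketsAt, h7, h8, h9, h13, h14, h20, h24]
        exact hB.link hdeg hz hxl
      · simp only [State.potential, h7, h8, h10, h20] at hc1 ⊢
        omega
      · simp only [State.potential, h7, h8, h10, h20] at hc2 ⊢
        omega
    · rintro ρ c'' ⟨hF, hnum, H, hT, hB, hc1, hc2⟩ hb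
      simp only [Test.Holds, IdxExpr.eval, var_eval, not_not] at hb
      obtain ⟨hyn, -⟩ := hB.current _ rfl
      simp only [wp_cons, wp_nil, wp_setIdx, IdxExpr.eval, var_eval, Nat.sub_sub, Nat.reduceAdd]
      repeat refine And.intro (by omega) ?_
      refine ⟨hF.write (by simp) _ _, hnum, ?_, ?_, ?_, ?_, ?_⟩
      · simpa [State.HeapAt, write_ne] using H
      · simpa [State.TidyAt, write_ne] using hT
      · simpa [State.BucketsAt, write_ne] using hB.store hb
      · simp only [State.potential] at hc1; simp [State.potential, write_ne]; omega
      · simp only [State.potential] at hc2; simp [State.potential, write_ne]; omega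
  · rintro τ c' ⟨hF, hnum, H, hT, hB, hc1, hc2⟩ hb
    simp only [Test.Holds, IdxExpr.eval, var_eval, not_not] at hb
    exact ⟨by omega, hQ _ _ hF hnum H hT hB hb (by omega)⟩

/-- Move the roots from the buckets to the stack and store the position of a minimum in
variable `29`. -/
def collectProgram : Program := block [
  .setIdx 29 (.lit 0) (.lit 0),
  forLoop 21 (var 27) (.branch (.not (.idxEq (.read 14 (var 21)) (.lit 0)))
    (block [
      .setIdx 13 (var 20) (.sub (.read 14 (var 21)) (.lit 1)),
      .setIdx 14 (var 21) (.lit 0),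
      .branch (.numLt (.read 3 (.read 13 (var 20))) (.read 3 (.read 13 (var 29))))
        (.setIdx 29 (.lit 0) (var 20)) .skip,
      .setIdx 20 (.lit 0) (.add (var 20) (.lit 1))]) .skip)]

/-- Afterwards there is at most one root per possible degree, hence a logarithmic number of them.
The buckets are emptied on the way, ready for the next consolidation. -/
theorem wp_collectProgram {w ℓ n : ℕ} {Q : State → ℕ → Prop} {σ : State} {c L : ℕ}
    (hw : 3 * n.size + n + 2 ≤ w) (hL : L = 3 * n.size) (h27 : σ.idx 27 0 = L) (H : σ.HeapAt n)
    (hT : σ.TidyAt n) (hB : σ.BucketsAt n L 0) (hrc : σ.idx 20 0 = 0) (hc : 9 * L + 4 ≤ c)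
    (hQ : ∀ (τ : State) (c' : ℕ), Frame [13, 14, 20, 21, 29] σ.idx τ.idx → τ.num = σ.num →
      τ.ListedAt n → (∀ j < L, τ.idx 14 j = 0) → τ.idx 20 0 ≤ L →
      (τ.idx 20 0 ≠ 0 → τ.idx 29 0 < τ.idx 20 0) →
      (∀ k < τ.idx 20 0, σ.num 3 (τ.idx 13 (τ.idx 29 0)) ≤ σ.num 3 (τ.idx 13 k)) →
      c ≤ c' + (9 * L + 4) → Q τ c') :
    wp w ℓ collectProgram Q σ c := by
  simp only [collectProgram, wp_cons, wp_nil, wp_setIdx, IdxExpr.eval]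
  refine ⟨by omega, by omega, ?_⟩
  refine wp_forLoop (K := 7) (M := L) (fun i τ => Frame [13, 14, 20, 21, 29] σ.idx τ.idx ∧
    τ.num = σ.num ∧ (∀ j < i, τ.idx 14 j = 0) ∧ (∀ j, i ≤ j → τ.idx 14 j = σ.idx 14 j) ∧
    Stacked n (σ.idx 7) (σ.idx 8) (τ.idx 13) (τ.idx 20 0) ∧ τ.idx 20 0 ≤ i ∧
    (∀ k < τ.idx 20 0, σ.idx 9 (τ.idx 13 k) < i) ∧
    (∀ y < n, σ.idx 7 y = 0 → σ.idx 8 y = 0 → σ.idx 9 y < i → ∃ k < τ.idx 20 0, τ.idx 13 k = y) ∧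
    (τ.idx 20 0 ≠ 0 → τ.idx 29 0 < τ.idx 20 0) ∧
    (τ.idx 20 0 = 0 → τ.idx 29 0 = 0) ∧
    ∀ k < τ.idx 20 0, σ.num 3 (τ.idx 13 (τ.idx 29 0)) ≤ σ.num 3 (τ.idx 13 k))
    (by omega) (by omega) ?_ ?_ ?_ ?_
  · simp only [State.setVar, write_ne, write_same, ne_eq, Nat.reduceEqDiff, not_false_eq_true, hrc]
    refine ⟨((Frame.refl _ _).write (by simp) _ _).write (by simp) _ _, trivial, by simp, by simp,
      ⟨by simp, by simp⟩, by simp, by simp, by simp, by simp, by simp, by simp⟩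
  · rintro i ρ ⟨hF, -⟩
    rw [var_eval, hF 27 (by simp), h27]
  · rintro i ρ c' hi h21 ⟨hF, hnum, hA0, hA, hS, hrci, hdeg, hcov, hb1, hb2, hb3⟩ hc'
    have hle := hS.le
    simp only [wp_branch, wp_skip, wp_cons, wp_nil, wp_setIdx, Test.Holds, IdxExpr.eval,
      NumExpr.eval, var_eval, h21, write_same, write_ne, ne_eq, Nat.reduceEqDiff,
      not_false_eq_true, Nat.sub_sub, Nat.reduceAdd, Function.update_self, hnum]
    refine ⟨by omega, fun hAi => ?_, fun hAi => ?_⟩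
    · obtain ⟨z, hz⟩ := Nat.exists_eq_succ_of_ne_zero hAi
      obtain ⟨hzn, hdz, hpz, hgz, -⟩ := hB.bucket i (by omega) z (by rw [← hA i le_rfl]; exact hz)
      simp only [hz, Nat.succ_eq_add_one, Nat.add_sub_cancel]
      have hzR : ∀ k < ρ.idx 20 0, ρ.idx 13 k ≠ z := by
        intro k hk h
        have := hdeg k hk
        rw [h] at this
        omega
      have hS' := hS.push hzn hdz hpz hzR
      have hR : ∀ k < ρ.idx 20 0, Function.update (ρ.idx 13) (ρ.idx 20 0) z k = ρ.idx 13 k :=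
        fun k hk => Function.update_of_ne (by omega) _ _
      have hdeg' : ∀ k < ρ.idx 20 0 + 1,
          σ.idx 9 (Function.update (ρ.idx 13) (ρ.idx 20 0) z k) < i + 1 := by
        intro k hk
        rcases Nat.lt_succ_iff_lt_or_eq.1 hk with hk | rfl
        · rw [hR k hk]; exact (hdeg k hk).trans (by omega)
        · rw [Function.update_self]; omega
      have hcov' : ∀ y < n, σ.idx 7 y = 0 → σ.idx 8 y = 0 → σ.idx 9 y < i + 1 →
          ∃ k < ρ.idx 20 0 + 1, Function.update (ρ.idx 13) (ρ.idx 20 0) z k = y := by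
        intro y hy hdy hpy hgy
        rcases Nat.lt_succ_iff_lt_or_eq.1 hgy with hgy | hgy
        · obtain ⟨k, hk, rfl⟩ := hcov y hy hdy hpy hgy
          exact ⟨k, by omega, hR k hk⟩
        · have h1 := hA i le_rfl
          rcases hB.cover y hy hdy hpy with ⟨k, hk, -⟩ | h | h
          · omega
          · rw [hgy, ← h1, hz] at h
            exact ⟨ρ.idx 20 0, by omega, by rw [Function.update_self]; omega⟩
          · omega
      have hA0' : ∀ j < i + 1, Function.update (ρ.idx 14) i 0 j = 0 := by
        intro j hj
        rw [Function.update_apply]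
        split_ifs with h
        · rfl
        · exact hA0 j (by omega)
      have hA' : ∀ j, i + 1 ≤ j → Function.update (ρ.idx 14) i 0 j = σ.idx 14 j := by
        intro j hj
        rw [Function.update_of_ne (by omega)]
        exact hA j (by omega)
      refine ⟨by omega, by omega, by omega, by omega, by omega, fun hlt => ?_, fun hlt => ?_⟩
      · repeat refine And.intro (by omega) ?_
        simp only [State.setVar, write_ne, write_same, ne_eq, Nat.reduceEqDiff, not_false_eq_true,
          Function.update_self, h21]
        refine ⟨trivial, ?_, trivial, hA0', hA', hS', by omega, hdeg', hcov', fun _ => by omega,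
          by intro h; simp at h, ?_⟩
        · exact ((((hF.write (by simp) _ _).write (by simp) _ _).write (by simp) _ _).write
            (by simp) _ _).write (by simp) _ _
        · intro k hk
          rcases Nat.lt_succ_iff_lt_or_eq.1 hk with hk | rfl
          · rw [hR k hk]
            rw [hR _ (hb1 (by omega))] at hlt
            exact hlt.le.trans (hb3 k hk)
          · simp
      · repeat refine And.intro (by omega) ?_
        simp only [State.setVar, write_ne, write_same, ne_eq, Nat.reduceEqDiff, not_false_eq_true,
          Function.update_self, h21]
        refine ⟨trivial, ?_, trivial, hA0', hA', hS', by omega, hdeg', hcov', ?_,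
          by intro h; simp at h, ?_⟩
        · exact (((hF.write (by simp) _ _).write (by simp) _ _).write (by simp) _ _).write
            (by simp) _ _
        · intro _
          by_cases h0 : ρ.idx 20 0 = 0
          · rw [hb2 h0]; omega
          · have := hb1 h0; omega
        · intro k hk
          by_cases h0 : ρ.idx 20 0 = 0
          · obtain rfl : k = 0 := by omega
            rw [hb2 h0]
          · rcases Nat.lt_succ_iff_lt_or_eq.1 hk with hk | rfl
            · rw [hR k hk, hR _ (hb1 h0)]
              exact hb3 k hk
            · simpa using hlt
    · have hAi' : ρ.idx 14 i = 0 := not_not.1 hAi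
      repeat refine And.intro (by omega) ?_
      simp only [State.setVar, write_ne, write_same, ne_eq, Nat.reduceEqDiff, not_false_eq_true,
          Function.update_self, h21]
      refine ⟨trivial, hF.write (by simp) _ _, hnum, ?_, fun j hj => hA j (by omega), hS, by omega,
        fun k hk => (hdeg k hk).trans (by omega), ?_, hb1, hb2, hb3⟩
      · intro j hj
        rcases Nat.lt_succ_iff_lt_or_eq.1 hj with hj | rfl
        · exact hA0 j hj
        · exact hAi'
      · intro y hy hdy hpy hgy
        rcases Nat.lt_succ_iff_lt_or_eq.1 hgy with hgy | hgy
        · exact hcov y hy hdy hpy hgy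
        · have h1 := hA i le_rfl
          rcases hB.cover y hy hdy hpy with ⟨k, hk, -⟩ | h | h
          · omega
          · rw [hgy] at h; omega
          · omega
  · rintro τ c' ⟨hF, hnum, hA0, hA, hS, hrci, hdeg, hcov, hb1, hb2, hb3⟩ hc'
    refine ⟨by omega, hQ _ _ hF hnum ?_ hA0 hrci hb1 hb3 (by omega)⟩
    rw [State.ListedAt, hF 7 (by simp), hF 8 (by simp)]
    -- Every root has been met, since its degree is below the number of buckets.
    exact ⟨hS, fun y hy hdy hpy => hcov y hy hdy hpy (hL ▸ H.deg_lt hT hy hdy)⟩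

/-- Remove the root at position `29` of the stack; it is stored in variable `22`. -/
def removeProgram : Program := block [
  .setIdx 22 (.lit 0) (.read 13 (var 29)),
  .loop (.not (.idxEq (.read 9 (var 22)) (.lit 0))) (block [
    .setIdx 24 (.lit 0)
      (.read 12 (.add (.mul (.sub (.read 9 (var 22)) (.lit 1)) (var 0)) (var 22))),
    cutProgram]),
  .setIdx 13 (var 29) (.read 13 (.sub (var 20) (.lit 1))),
  .setIdx 20 (.lit 0) (.sub (var 20) (.lit 1)),
  .setIdx 7 (var 22) (.lit 1)]

/-- The children of the minimum are cut off one by one, from the last slot downwards. No cascade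
arises because their parent is a root. Each cut takes 14 steps and raises the potential by at most
40, which gives the factor 54; new roots go on top of the stack, so the position in variable 29
stays valid. -/
theorem wp_removeProgram {w ℓ n : ℕ} {Q : State → ℕ → Prop} {σ : State} {c L u : ℕ}
    (hw : n + 2 ≤ w) (hL : L = 3 * n.size) (hn : σ.idx 0 0 = n) (H : σ.HeapAt n)
    (hT : σ.TidyAt n) (hLi : σ.ListedAt n) (hb : σ.idx 29 0 < σ.idx 20 0)
    (hu : σ.idx 13 (σ.idx 29 0) = u)
    (hc : 14 * L + 10 ≤ c)
    (hQ : ∀ (τ : State) (c' : ℕ), Frame [7, 8, 9, 10, 11, 12, 13, 20, 22, 24, 25, 26, 28] σ.idx τ.idx →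
      τ.num = σ.num → τ.idx 22 0 = u → τ.idx 7 = Function.update (σ.idx 7) u 1 →
      τ.HeapAt n → τ.TidyAt n → τ.ListedAt n →
      c + τ.potential n ≤ c' + σ.potential n + 54 * L + 10 → Q τ c') :
    wp w ℓ removeProgram Q σ c := by
  obtain ⟨hun, hdu, hpu⟩ := hLi.mem _ hb
  rw [hu] at hun hdu hpu
  have hdeg := H.deg_lt hT hun hdu
  rw [← hL] at hdeg
  simp only [removeProgram, wp_cons, wp_setIdx, IdxExpr.eval, var_eval, hu]
  refine ⟨by omega, by omega, ?_⟩
  refine wp_loop (fun τ c' => Frame [8, 9, 10, 11, 12, 13, 20, 22, 24, 25, 26, 28] σ.idx τ.idx ∧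
    τ.num = σ.num ∧ τ.idx 22 0 = u ∧ τ.HeapAt n ∧ τ.TidyAt n ∧ τ.ListedAt n ∧
    σ.idx 29 0 < τ.idx 20 0 ∧ τ.idx 13 (σ.idx 29 0) = u ∧ τ.idx 9 u ≤ L ∧
    c + τ.potential n + 54 * τ.idx 9 u ≤ c' + σ.potential n + 54 * L + 1 ∧
    14 * τ.idx 9 u + 9 ≤ c') ?_ ?_ ?_
  · refine ⟨(Frame.refl _ _).write (by simp) _ _, rfl, by simp, ?_, ?_, ?_, ?_, ?_, ?_, ?_, ?_⟩
    · simpa [State.HeapAt, write_ne] using H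
    · simpa [State.TidyAt, write_ne] using hT
    · simpa [State.ListedAt, write_ne] using hLi
    · simpa [write_ne] using hb
    · simpa [write_ne] using hu
    · simpa [write_ne] using hdeg.le
    · simp [State.potential, write_ne]; omega
    · simp [write_ne]; omega
  · rintro τ c' ⟨hF, hnum, h22, H, hT, hLi, hb, hu, hg, hc1, hc2⟩ hb'
    simp only [Test.Holds, IdxExpr.eval, var_eval, h22] at hb'
    obtain ⟨hun, hdu, hpu⟩ := hLi.mem _ hb
    rw [hu] at hun hdu hpu
    have h0 : τ.idx 0 0 = n := by rw [hF 0 (by simp), hn]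
    obtain ⟨hyn, hdy, hpy, hposy⟩ := H.children u hun hdu (τ.idx 9 u - 1) (by omega)
    set y := τ.idx 12 ((τ.idx 9 u - 1) * n + u) with hy
    refine ⟨by omega, ?_⟩
    simp only [wp_cons, wp_setIdx, IdxExpr.eval, var_eval, h22, h0, ← hy]
    refine ⟨by omega, by omega, ?_⟩
    refine wp_cutProgram (n := n) (y := y) (p := u) (by omega) (by simp [write_ne, h0]) (by simp)
      (by simpa [write_ne] using hpy) hyn (by simpa [write_ne] using hdy)
      (by simpa [State.HeapAt, write_ne] using H) (by simpa [write_ne] using hLi.le) (by omega) ?_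
    intro ρ hF' hnum' h25 h8 h9 h10 h11 h12 h13 h20
    simp only [write_ne, ne_eq, Nat.reduceEqDiff, not_false_eq_true] at h8 h9 h10 h11 h12 h13 h20
    have h7 : ρ.idx 7 = τ.idx 7 := by simpa [write_ne] using hF' 7 (by simp)
    have h22' : ρ.idx 22 = τ.idx 22 := by simpa [write_ne] using hF' 22 (by simp)
    have hr := rootCount_cut (par := τ.idx 8) hyn hdy (by omega)
    have hm := markSum_update (mark := τ.idx 10) (v := 0) hyn
    rw [wp_nil]
    have hyu : y ≠ u := by intro h; rw [h] at hpy; omega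
    refine ⟨by omega, (hF.write (by simp) _ _).trans hF' (by simp), hnum'.trans hnum,
      by rw [h22', h22], ?_, ?_, ?_, ?_, ?_, ?_, ?_, ?_⟩
    · simp only [State.HeapAt, h7, h8, h9, h10, h11, h12, hnum']
      refine H.cut hyn hdy hpy rfl rfl (fun v hv => ?_) fun v hv hvy hdv hpv => ?_
      · rw [Function.update_apply]
        have := H.mark_le v hv
        split_ifs <;> omega
      · have hvp : v ≠ u := by rintro rfl; omega
        simp [hvp, hvy]
    · intro v hv hdv hpv
      rw [h7] at hdv
      rw [h8] at hpv
      rw [h10]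
      have hvy : v ≠ y := by rintro rfl; simp at hpv
      rw [Function.update_of_ne hvy] at hpv ⊢
      exact hT v hv hdv hpv
    · simp only [State.ListedAt, h7, h8, h13, h20]
      exact hLi.cut hyn hdy (by omega)
    · omega
    · rw [h13, Function.update_of_ne (by omega), hu]
    · rw [h9, Function.update_self]; omega
    · simp only [State.potential] at hc1 ⊢
      rw [h7, h8, h9, h10, h20, Function.update_self]; omega
    · rw [h9, Function.update_self]; omega
  · rintro τ c' ⟨hF, hnum, h22, H, hT, hLi, hb, hu, hg, hc1, hc2⟩ hb'
    simp only [Test.Holds, IdxExpr.eval, var_eval, h22, not_not] at hb'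
    obtain ⟨hun, hdu, hpu⟩ := hLi.mem _ hb
    rw [hu] at hun hdu hpu
    have h29 : τ.idx 29 = σ.idx 29 := hF 29 (by simp)
    have hRn := (hLi.mem (τ.idx 20 0 - 1) (by omega)).1
    have hle := hLi.le
    have h7 : τ.idx 7 = σ.idx 7 := hF 7 (by simp)
    have hrem := hLi.remove hb
    rw [hu] at hrem
    simp only [wp_cons, wp_nil, wp_setIdx, IdxExpr.eval, var_eval, h22, h29, write_same, write_ne, ne_eq,
      Nat.reduceEqDiff, not_false_eq_true, Nat.sub_sub, Nat.reduceAdd]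
    repeat refine And.intro (by omega) ?_
    refine hQ _ _ ?_ hnum (by simpa [write_ne] using h22) (by simp [write_ne, h7]) ?_ ?_ ?_ ?_
    · exact (((Frame.trans (S := [7, 8, 9, 10, 11, 12, 13, 20, 22, 24, 25, 26, 28])
        (Frame.refl _ _) hF (by simp)).write (by simp) _ _).write (by simp) _ _).write (by simp) _ _
    · simpa [State.HeapAt, write_ne] using H.remove hpu hb'
    · intro v hv hdv hpv
      simp only [write_same, write_ne, ne_eq, Nat.reduceEqDiff, not_false_eq_true] at hdv hpv ⊢
      have : v ≠ u := by rintro rfl; simp at hdv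
      rw [Function.update_of_ne this] at hdv
      exact hT v hv hdv hpv
    · simpa [State.ListedAt, write_ne] using hrem
    · have hr := rootCount_remove (n := n) (dead := τ.idx 7) (par := τ.idx 8) u
      simp only [State.potential] at hc1 ⊢
      simp only [write_same, write_ne, ne_eq, Nat.reduceEqDiff, not_false_eq_true,
        Function.update_self]
      omega

/-! ## The invariant of Dijkstra's algorithm -/

namespace Network

variable {n m : ℕ} (N : Network n m)

theorem IsWalk.append {u v w : Fin n} {p q : List (Fin m)} (hp : N.IsWalk u p v)
    (hq : N.IsWalk v q w) : N.IsWalk u (p ++ q) w := by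
  induction p generalizing u with
  | nil => obtain rfl : u = v := hp; exact hq
  | cons e p ih => exact ⟨hp.1, ih hp.2⟩

/-- `p` is a simple walk from `s` to `v` of length `k` along predecessor edges, all of whose inner
nodes are settled. -/
structure TracePath (d : Fin m → ℚ) (dead pred : ℕ → ℕ) (v : Fin n) (p : List (Fin m)) (k : ℚ) :
    Prop where
  walk : N.IsWalk N.s p v
  nodup : (N.s :: p.map N.dst).Nodup
  pred_eq : ∀ e ∈ p, pred (N.dst e) = e + 1
  inner : ∀ e ∈ p, N.dst e = v ∨ dead (N.dst e) ≠ 0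
  start : N.s = v ∨ dead N.s ≠ 0
  length : (p.map d).sum = k

/-- The invariant of Dijkstra's algorithm with settled nodes `dead`, predecessor edges `pred`,
tentative distances `key ≤ M`, and a list `rem` of edges that still have to be relaxed. -/
structure Dijkstra (d : Fin m → ℚ) (M : ℚ) (dead pred : ℕ → ℕ) (key : ℕ → ℚ) (rem : List ℕ) :
    Prop where
  key_nonneg : ∀ v : Fin n, 0 ≤ key v
  key_s : key N.s = 0
  pred_s : pred N.s = 0
  key_le : ∀ v : Fin n, key v ≤ M
  order : ∀ u v : Fin n, dead u ≠ 0 → dead v = 0 → key u ≤ key v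
  trace : ∀ v : Fin n, key v < M → ∃ p, N.TracePath d dead pred v p (key v)
  pred_lt : ∀ v : Fin n, pred v ≠ 0 → key v < M
  relaxed : ∀ e : Fin m, dead (N.src e) ≠ 0 → (e : ℕ) ∉ rem →
    key (N.dst e) ≤ key (N.src e) + d e

namespace Dijkstra

variable {N} {d : Fin m → ℚ} {M : ℚ} {dead pred : ℕ → ℕ} {key : ℕ → ℚ} {rem : List ℕ}

theorem init (hM : 0 < M) (hs : key N.s = 0) (hkey : ∀ v : Fin n, v ≠ N.s → key v = M)
    (hpred : ∀ v : Fin n, pred v = 0) (hdead : ∀ v : Fin n, dead v = 0) :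
    N.Dijkstra d M dead pred key [] where
  key_nonneg v := by
    by_cases hv : v = N.s
    · rw [hv, hs]
    · rw [hkey v hv]; exact hM.le
  key_s := hs
  pred_s := hpred _
  key_le v := by
    by_cases hv : v = N.s
    · rw [hv, hs]; exact hM.le
    · rw [hkey v hv]
  order u v hu := absurd (hdead u) hu
  trace v hv := by
    obtain rfl : v = N.s := by
      by_contra h
      exact hv.ne (hkey v h)
    exact ⟨[], rfl, by simp, by simp, by simp, .inl rfl, by simp [hs]⟩
  pred_lt v hv := absurd (hpred v) hv
  relaxed e he := absurd (hdead _) he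

/-- Settling `u` creates the obligation to relax the edges leaving `u`; the list `l` takes them
over, so `relaxed` is not violated. -/
theorem settle (h : N.Dijkstra d M dead pred key []) {u : Fin n} {l : List ℕ}
    (hmin : ∀ v : Fin n, dead v = 0 → key u ≤ key v) (hl : ∀ e : Fin m, N.src e = u → (e : ℕ) ∈ l) :
    N.Dijkstra d M (Function.update dead u 1) pred key l where
  key_nonneg := h.key_nonneg
  key_s := h.key_s
  pred_s := h.pred_s
  key_le := h.key_le
  order v w hv hw := by
    have hwu : (w : ℕ) ≠ u := by intro h; simp [h] at hw
    rw [Function.update_of_ne hwu] at hw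
    by_cases hvu : (v : ℕ) = u
    · rw [hvu]; exact hmin w hw
    · rw [Function.update_of_ne hvu] at hv
      exact h.order v w hv hw
  trace v hv := by
    obtain ⟨p, hp⟩ := h.trace v hv
    have key' : ∀ w : ℕ, dead w ≠ 0 → Function.update dead u 1 w ≠ 0 := by
      intro w hw
      rw [Function.update_apply]; split_ifs; exacts [one_ne_zero, hw]
    exact ⟨p, hp.walk, hp.nodup, hp.pred_eq, fun e he => (hp.inner e he).imp_right (key' _),
      hp.start.imp_right (key' _), hp.length⟩
  pred_lt := h.pred_lt
  relaxed e he hel := by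
    have hsu : (N.src e : ℕ) ≠ u := fun h => hel (hl e (Fin.ext h))
    rw [Function.update_of_ne hsu] at he
    exact h.relaxed e he (by simp)

/-- If the head is already settled, its key is at most that of the tail by `hmax`, so the edge is
relaxed by non-negativity of its length. -/
theorem skip {e : Fin m} (h : N.Dijkstra d M dead pred key (e :: rem)) (hd : ∀ e, 0 ≤ d e)
    (hmax : ∀ w : Fin n, dead w ≠ 0 → key w ≤ key (N.src e))
    (he : ¬ (dead (N.dst e) = 0 ∧ key (N.src e) + d e < key (N.dst e))) :
    N.Dijkstra d M dead pred key rem where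
  __ := h
  relaxed f hf hfr := by
    by_cases hfe : f = e
    · subst hfe
      by_cases hdead : dead (N.dst f) = 0
      · exact not_lt.1 fun h => he ⟨hdead, h⟩
      · have := hmax _ hdead
        have := hd f
        linarith
    · exact h.relaxed f hf (by simp [hfr, Fin.val_inj, hfe])

/-- The trace of the tail runs through settled nodes and the head is unsettled, so appending the
edge keeps the walk simple. The tail has a trace, for its key lies below that of the head and hence
below `M`; the head is not `s`, whose key 0 cannot be undercut. -/
theorem exists_trace {e : Fin m} (h : N.Dijkstra d M dead pred key (e :: rem)) (hd : ∀ e, 0 ≤ d e)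
    (hu : dead (N.src e) ≠ 0) (hv : dead (N.dst e) = 0)
    (hlt : key (N.src e) + d e < key (N.dst e)) :
    ∃ p, N.TracePath d dead (Function.update pred (N.dst e) (e + 1)) (N.dst e) (p ++ [e])
      (key (N.src e) + d e) := by
  have hde := hd e
  have hle := h.key_le (N.dst e)
  obtain ⟨p, hp⟩ := h.trace (N.src e) (by linarith)
  have hvs : N.s ≠ N.dst e := by
    intro h'
    have h1 := h.key_nonneg (N.src e)
    have h2 := h.key_s
    rw [h'] at h2
    linarith
  have hin : ∀ f ∈ p, dead (N.dst f) ≠ 0 := fun f hf =>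
    (hp.inner f hf).elim (fun h' => h' ▸ hu) id
  have hne : ∀ f ∈ p, N.dst f ≠ N.dst e := fun f hf h' => hin f hf (h' ▸ hv)
  refine ⟨p, hp.walk.append N ⟨rfl, rfl⟩, ?_, ?_, ?_, ?_, ?_⟩
  · rw [List.map_append, ← List.cons_append]
    refine hp.nodup.append (by simp) ?_
    simp only [List.map_cons, List.map_nil, List.disjoint_singleton, List.mem_cons, List.mem_map,
      not_or, not_exists, not_and]
    exact ⟨hvs.symm, hne⟩
  · intro f hf
    rcases List.mem_append.1 hf with hf | hf
    · rw [Function.update_of_ne (by rw [Ne, Fin.val_inj]; exact hne f hf)]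
      exact hp.pred_eq f hf
    · obtain rfl : f = e := by simpa using hf
      simp
  · intro f hf
    rcases List.mem_append.1 hf with hf | hf
    · exact .inr (hin f hf)
    · obtain rfl : f = e := by simpa using hf
      exact .inl rfl
  · exact .inr (hp.start.elim (fun h' => h' ▸ hu) id)
  · simp [hp.length]

/-- Only data of an unsettled node change, while traces of other nodes avoid unsettled nodes and are
unaffected. The new key is at least that of the node just settled, hence at least every settled key.
-/
theorem improve {e : Fin m} (h : N.Dijkstra d M dead pred key (e :: rem)) (hd : ∀ e, 0 ≤ d e)
    (hmax : ∀ w : Fin n, dead w ≠ 0 → key w ≤ key (N.src e))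
    (hu : dead (N.src e) ≠ 0) (hv : dead (N.dst e) = 0)
    (hlt : key (N.src e) + d e < key (N.dst e)) :
    N.Dijkstra d M dead (Function.update pred (N.dst e) (e + 1))
      (Function.update key (N.dst e) (key (N.src e) + d e)) rem := by
  have hde := hd e
  have hnn := h.key_nonneg (N.src e)
  have hle := h.key_le (N.dst e)
  have hvs : N.s ≠ N.dst e := by
    intro h'
    have h2 := h.key_s
    rw [h'] at h2
    linarith
  have hvs' : (N.s : ℕ) ≠ N.dst e := by rwa [Ne, Fin.val_inj]
  have hvu : (N.src e : ℕ) ≠ N.dst e := by intro h'; rw [h'] at hu; exact hu hv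
  have hkle : ∀ w : Fin n, Function.update key (N.dst e) (key (N.src e) + d e) w ≤ key w := by
    intro w
    rw [Function.update_apply]
    split_ifs with h'
    · rw [h']; exact hlt.le
    · exact le_rfl
  constructor
  · intro w
    rw [Function.update_apply]
    split_ifs
    · linarith
    · exact h.key_nonneg w
  · rw [Function.update_of_ne hvs', h.key_s]
  · rw [Function.update_of_ne hvs', h.pred_s]
  · exact fun w => (hkle w).trans (h.key_le w)
  · intro x y hx hy
    have hxv : (x : ℕ) ≠ N.dst e := by intro h'; rw [h'] at hx; exact hx hv
    rw [Function.update_of_ne hxv, Function.update_apply]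
    split_ifs
    · have := hmax x hx
      linarith
    · exact h.order x y hx hy
  · intro w hw
    by_cases hwv : w = N.dst e
    · subst hwv
      obtain ⟨p, hp⟩ := h.exists_trace hd hu hv hlt
      rw [Function.update_self]
      exact ⟨_, hp⟩
    · have hwv' : (w : ℕ) ≠ N.dst e := by rwa [Ne, Fin.val_inj]
      rw [Function.update_of_ne hwv'] at hw ⊢
      obtain ⟨p, hp⟩ := h.trace w hw
      refine ⟨p, hp.walk, hp.nodup, fun f hf => ?_, hp.inner, hp.start, hp.length⟩
      rw [Function.update_of_ne]
      · exact hp.pred_eq f hf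
      · intro h'
        rcases hp.inner f hf with h1 | h1
        · exact hwv' (by rw [← h1, h'])
        · rw [h'] at h1; exact h1 hv
  · intro w hw
    by_cases hwv : (w : ℕ) = N.dst e
    · rw [hwv, Function.update_self]; linarith
    · rw [Function.update_of_ne hwv] at hw ⊢
      exact h.pred_lt w hw
  · intro f hf hfr
    have hsf : (N.src f : ℕ) ≠ N.dst e := by intro h'; rw [h'] at hf; exact hf hv
    rw [Function.update_of_ne hsf]
    by_cases hfe : f = e
    · subst hfe; rw [Function.update_self]
    · exact (hkle _).trans (h.relaxed f hf (by simp [hfr, Fin.val_inj, hfe]))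

/-- Once everything is settled the keys form a feasible potential, and the relaxed inequalities
telescope along a walk. -/
theorem key_le_length (h : N.Dijkstra d M dead pred key []) (hdead : ∀ v : Fin n, dead v ≠ 0)
    {u v : Fin n} {p : List (Fin m)} (hp : N.IsWalk u p v) : key v ≤ key u + (p.map d).sum := by
  induction p generalizing u with
  | nil => obtain rfl : u = v := hp; simp
  | cons e p ih =>
    obtain ⟨rfl, hp⟩ := hp
    have h1 := ih hp
    have h2 := h.relaxed e (hdead _) (by simp)
    rw [List.map_cons, List.sum_cons]
    linarith

end Dijkstra

end Network

/-! ## Dijkstra's algorithm -/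

/-- `ptr` is the head of the linked list `l` with successor array `next`; pointers are shifted by
one, and `0` ends the list. -/
def IsChain (next : ℕ → ℕ) : ℕ → List ℕ → Prop
  | ptr, [] => ptr = 0
  | ptr, e :: l => ptr = e + 1 ∧ IsChain next (next e) l

/-- The state holds the network in the index arrays `0`, `1`, `2`. -/
structure State.Holds {n m : ℕ} (N : Network n m) (σ : State) : Prop where
  nodes : σ.idx 0 0 = n
  edges : σ.idx 0 1 = m
  s : σ.idx 0 2 = N.s
  t : σ.idx 0 3 = N.t
  src : ∀ e : Fin m, σ.idx 1 e = N.src e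
  dst : ∀ e : Fin m, σ.idx 2 e = N.dst e

theorem State.Holds.frame {n m : ℕ} {N : Network n m} {σ τ : State} (h : σ.Holds N) {S : List ℕ}
    (hF : Frame S σ.idx τ.idx) (h0 : 0 ∉ S) (h1 : 1 ∉ S) (h2 : 2 ∉ S) : τ.Holds N where
  nodes := by rw [hF 0 h0, h.nodes]
  edges := by rw [hF 0 h0, h.edges]
  s := by rw [hF 0 h0, h.s]
  t := by rw [hF 0 h0, h.t]
  src e := by rw [hF 1 h1, h.src]
  dst e := by rw [hF 2 h2, h.dst]

/-- Relax the edges that leave the vertex in variable `22`. -/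
def relaxProgram : Program := block [
  .setIdx 23 (.lit 0) (.read 5 (var 22)),
  .loop (.not (.idxEq (var 23) (.lit 0))) (block [
    .setIdx 30 (.lit 0) (.sub (var 23) (.lit 1)),
    .setIdx 31 (.lit 0) (.read 2 (var 30)),
    .branch (.and (.idxEq (.read 7 (var 31)) (.lit 0))
        (.numLt (.add (.read 3 (var 22)) (.read 1 (var 30))) (.read 3 (var 31))))
      (block [
        cascadeProgram,
        .setNum 3 (var 31) (.add (.read 3 (var 22)) (.read 1 (var 30))),
        .setIdx 15 (var 31) (var 23)]) .skip,
    .setIdx 23 (.lit 0) (.read 6 (var 30))])]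

abbrev State.DijkstraAt {n m : ℕ} (N : Network n m) (d : Fin m → ℚ) (M : ℚ) (rem : List ℕ)
    (σ : State) : Prop :=
  N.Dijkstra d M (σ.idx 7) (σ.idx 15) (σ.num 3) rem

/-- Every new key is the length of a path with distinct edges, which is why `hℓ` for duplicate-free
lists bounds the encoding lengths. An edge costs 150 credits: the amortized 130 of a cascade and
some bookkeeping. -/
theorem wp_relaxProgram {w ℓ n m : ℕ} {N : Network n m} {d : Fin m → ℚ} {M : ℚ} (hd : ∀ e, 0 ≤ d e)
    {Q : State → ℕ → Prop} {σ : State} {c : ℕ} {u : Fin n} {l : List ℕ} (hw : n + m + 2 ≤ w)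
    (hℓ : ∀ p : List (Fin m), p.Nodup → bits (p.map d).sum ≤ ℓ)
    (hN : σ.Holds N) (hd1 : ∀ e : Fin m, σ.num 1 e = d e) (hu : σ.idx 22 0 = u)
    (hdu : σ.idx 7 u ≠ 0) (hmax : ∀ v : Fin n, σ.idx 7 v ≠ 0 → σ.num 3 v ≤ σ.num 3 u)
    (H : σ.HeapAt n) (hT : σ.TidyAt n) (hL : σ.ListedAt n) (hD : σ.DijkstraAt N d M l)
    (hl : IsChain (σ.idx 6) (σ.idx 5 u) l) (hlm : ∀ e ∈ l, ∃ h : e < m, N.src ⟨e, h⟩ = u)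
    (hc : σ.potential n + 150 * l.length + 160 ≤ c)
    (hQ : ∀ (τ : State) (c' : ℕ),
      Frame [8, 9, 10, 11, 12, 13, 15, 20, 23, 24, 25, 26, 28, 30, 31] σ.idx τ.idx →
      Frame [3] σ.num τ.num → τ.HeapAt n → τ.TidyAt n → τ.ListedAt n → τ.DijkstraAt N d M [] →
      c + τ.potential n ≤ c' + σ.potential n + 150 * l.length + 10 → Q τ c') :
    wp w ℓ relaxProgram Q σ c := by
  have hch : σ.idx 5 u ≤ m := by
    cases l with
    | nil => have : σ.idx 5 u = 0 := hl; omega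
    | cons e l => have := (hlm e (by simp)).1; have := hl.1; omega
  simp only [relaxProgram, wp_cons, wp_setIdx, IdxExpr.eval, var_eval, hu]
  refine ⟨by omega, by omega, ?_⟩
  refine wp_loop (fun τ c' => ∃ r, Frame [8, 9, 10, 11, 12, 13, 15, 20, 23, 24, 25, 26, 28, 30, 31]
      σ.idx τ.idx ∧ Frame [3] σ.num τ.num ∧ τ.HeapAt n ∧ τ.TidyAt n ∧ τ.ListedAt n ∧
      τ.DijkstraAt N d M r ∧ IsChain (τ.idx 6) (τ.idx 23 0) r ∧
      (∀ e ∈ r, ∃ h : e < m, N.src ⟨e, h⟩ = u) ∧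
      (∀ v : Fin n, τ.idx 7 v ≠ 0 → τ.num 3 v ≤ τ.num 3 u) ∧
      c + τ.potential n + 150 * r.length ≤ c' + σ.potential n + 150 * l.length + 1 ∧
      τ.potential n + 150 * r.length + 150 ≤ c') ?_ ?_ ?_
  · refine ⟨l, (Frame.refl _ _).write (by simp) _ _, Frame.refl _ _, ?_, ?_, ?_, ?_, ?_, hlm, ?_,
      ?_, ?_⟩
    · simpa [State.HeapAt, write_ne] using H
    · simpa [State.TidyAt, write_ne] using hT
    · simpa [State.ListedAt, write_ne] using hL
    · simpa [State.DijkstraAt, write_ne] using hD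
    · simpa [write_ne] using hl
    · simpa [write_ne] using hmax
    · simp [State.potential, write_ne]; omega
    · simp only [State.potential] at hc; simp [State.potential, write_ne]; omega
  · rintro τ c' ⟨r, hF, hFn, H, hT, hL, hD, hr, hrm, hmax, hc1, hc2⟩ hb
    simp only [Test.Holds, IdxExpr.eval, var_eval] at hb
    cases r with
    | nil => exact absurd hr hb
    | cons e r =>
    obtain ⟨he, hr⟩ := hr
    obtain ⟨hem, hsrc⟩ := hrm e (by simp)
    obtain ⟨e, rfl⟩ : ∃ f : Fin m, (f : ℕ) = e := ⟨⟨e, hem⟩, rfl⟩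
    replace hsrc : N.src e = u := hsrc
    subst hsrc
    have hN' := hN.frame hF (by simp) (by simp) (by simp)
    have h7 : τ.idx 7 = σ.idx 7 := hF 7 (by simp)
    have h22 : τ.idx 22 = σ.idx 22 := hF 22 (by simp)
    have hn1 : τ.num 1 = σ.num 1 := hFn 1 (by simp)
    have hdst := (N.dst e).isLt
    have hnext : τ.idx 6 e ≤ m := by
      cases r with
      | nil => have : τ.idx 6 e = 0 := hr; omega
      | cons f r => have := (hrm f (by simp)).1; have := hr.1; omega
    simp only [List.length_cons] at hc1 hc2
    refine ⟨by omega, ?_⟩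
    simp only [wp_cons, wp_nil, wp_setIdx, wp_branch, wp_skip, Test.Holds, NumExpr.eval,
      IdxExpr.eval, var_eval, he, h22, hu, hn1, hd1, hN'.dst, write_same, write_ne, ne_eq,
      Nat.reduceEqDiff, not_false_eq_true, Function.update_self, Nat.add_sub_cancel, Nat.sub_sub,
      Nat.reduceAdd]
    refine ⟨by omega, by omega, by omega, by omega, by omega, ?_, ?_⟩
    · rintro ⟨hdv, hlt⟩
      refine wp_cascadeProgram (n := n) (x := N.dst e) (by omega)
        (by simpa [write_ne] using hN'.nodes) (by simp) hdst (by simpa [write_ne] using hdv)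
        (by simpa [State.HeapAt, write_ne] using H) (by simpa [State.TidyAt, write_ne] using hT)
        (by simpa [State.ListedAt, write_ne] using hL)
        (by simp only [State.potential] at hc2; simp [State.potential, write_ne]; omega) ?_
      intro ρ c2 hF' hnum' H' hT' hL' hpar hc3
      have hF3 := ((hF.write (a := 30) (by simp) 0 e).write (a := 31) (by simp) 0 (N.dst e)).trans
        hF' (by simp)
      have g7 : ρ.idx 7 = τ.idx 7 := by simpa [write_ne] using hF' 7 (by simp)
      have g15 : ρ.idx 15 = τ.idx 15 := by simpa [write_ne] using hF' 15 (by simp)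
      have g6 : ρ.idx 6 = τ.idx 6 := by simpa [write_ne] using hF' 6 (by simp)
      have g22 : ρ.idx 22 0 = N.src e := by simpa [write_ne, h22, hu] using congrFun (hF' 22 (by simp)) 0
      have g30 : ρ.idx 30 0 = e := by simpa [write_ne] using congrFun (hF' 30 (by simp)) 0
      have g31 : ρ.idx 31 0 = N.dst e := by simpa [write_ne] using congrFun (hF' 31 (by simp)) 0
      have g23 : ρ.idx 23 0 = e + 1 := by simpa [write_ne, he] using congrFun (hF' 23 (by simp)) 0
      replace hnum' : ρ.num = τ.num := hnum'
      have hdu' : τ.idx 7 (N.src e) ≠ 0 := by rwa [h7]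
      obtain ⟨p, hp⟩ := hD.exists_trace hd hdu' hdv hlt
      have hbits := hℓ _ (List.Nodup.of_map _ hp.nodup.of_cons)
      rw [hp.length] at hbits
      have hsd : (N.src e : ℕ) ≠ N.dst e := fun h => hdu' (h ▸ hdv)
      simp only [State.potential] at hc1 hc2 hc3
      simp only [write_ne, ne_eq, Nat.reduceEqDiff, not_false_eq_true] at hc3
      simp only [wp_cons, wp_setNum, wp_setIdx, wp_nil, NumExpr.eval, IdxExpr.eval, var_eval, g22, g30, g31,
        hnum', hn1, hd1, g23, g6, write_same, write_ne, ne_eq, Nat.reduceEqDiff, not_false_eq_true,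
        Nat.sub_sub, Nat.reduceAdd]
      refine ⟨by omega, hbits, ?_⟩
      repeat refine And.intro (by omega) ?_
      refine ⟨r, (hF3.write (by simp) _ _).write (by simp) _ _, ?_, ?_, ?_, ?_, ?_, ?_, ?_, ?_, ?_, ?_⟩
      · exact hFn.write (by simp) _ _
      · simp only [State.HeapAt, write_ne, write_same, ne_eq, Nat.reduceEqDiff, not_false_eq_true]
        rw [State.HeapAt, hnum'] at H'
        exact H'.decrease_root hpar hlt.le
      · simpa [State.TidyAt, write_ne] using hT'
      · simpa [State.ListedAt, write_ne] using hL'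
      · simp only [State.DijkstraAt, write_ne, write_same, ne_eq, Nat.reduceEqDiff,
          not_false_eq_true, g7, g15]
        exact hD.improve hd hmax hdu' hdv hlt
      · simpa [write_ne, g6] using hr
      · exact fun f hf => hrm f (by simp [hf])
      · intro v hv
        simp only [write_ne, write_same, ne_eq, Nat.reduceEqDiff, not_false_eq_true, g7] at hv ⊢
        have : (v : ℕ) ≠ N.dst e := fun h => hv (h ▸ hdv)
        rw [Function.update_of_ne this, Function.update_of_ne hsd]
        exact hmax v hv
      · simp only [State.potential, write_ne, write_same, ne_eq, Nat.reduceEqDiff,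
          not_false_eq_true]
        omega
      · simp only [State.potential, write_ne, write_same, ne_eq, Nat.reduceEqDiff,
          not_false_eq_true]
        omega
    · intro hb
      repeat refine And.intro (by omega) ?_
      refine ⟨r, ((hF.write (by simp) _ _).write (by simp) _ _).write (by simp) _ _, hFn, ?_, ?_, ?_,
        ?_, ?_, fun f hf => hrm f (by simp [hf]), ?_, ?_, ?_⟩
      · simpa [State.HeapAt, write_ne] using H
      · simpa [State.TidyAt, write_ne] using hT
      · simpa [State.ListedAt, write_ne] using hL
      · simpa [State.DijkstraAt, write_ne] using hD.skip hd hmax hb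
      · simpa [write_ne] using hr
      · simpa [write_ne] using hmax
      · simp only [State.potential] at hc1; simp [State.potential, write_ne]; omega
      · simp only [State.potential] at hc2; simp [State.potential, write_ne]; omega
  · rintro τ c' ⟨r, hF, hFn, H, hT, hL, hD, hr, hrm, hmax, hc1, hc2⟩ hb
    simp only [Test.Holds, IdxExpr.eval, var_eval, not_not] at hb
    have : r = [] := by
      cases r with
      | nil => rfl
      | cons e r => have := hr.1; omega
    subst this
    simp only [List.length_nil] at hc1
    rw [wp_nil]
    exact ⟨by omega, by omega, hQ _ _ hF hFn H hT hL hD (by omega)⟩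

/-! ## Initialization -/

theorem size_div_two {q : ℕ} (hq : q ≠ 0) : q.size = (q / 2).size + 1 := by
  refine le_antisymm (Nat.size_le.2 ?_) ?_
  · have := Nat.lt_size_self (q / 2)
    rw [pow_succ]; omega
  · by_contra h
    have h1 : q.size ≤ (q / 2).size := by omega
    have h2 : 0 < q.size := Nat.size_pos.2 (by omega)
    obtain ⟨k, hk⟩ := Nat.exists_eq_succ_of_ne_zero h2.ne'
    have h3 : (q / 2).size ≤ k := Nat.size_le.2 (by
      have := Nat.lt_size_self q
      rw [hk, pow_succ] at this
      omega)
    omega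

/-- Store `3 * n.size` in variable `27` and clear as many buckets. -/
def bucketInitProgram : Program := block [
  .setIdx 27 (.lit 0) (.lit 0),
  .setIdx 21 (.lit 0) (var 0),
  .loop (.not (.idxEq (var 21) (.lit 0))) (block [
    .setIdx 21 (.lit 0) (.div (var 21) (.lit 2)),
    .setIdx 14 (var 27) (.lit 0),
    .setIdx 14 (.add (var 27) (.lit 1)) (.lit 0),
    .setIdx 14 (.add (var 27) (.lit 2)) (.lit 0),
    .setIdx 27 (.lit 0) (.add (var 27) (.lit 3))])]

/-- Halving a number lowers its binary length by one, so `n.size` rounds occur, each of which clears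
three buckets. -/
theorem wp_bucketInitProgram {w ℓ n : ℕ} {Q : State → ℕ → Prop} {σ : State} {c : ℕ}
    (hw : 3 * n.size + n ≤ w) (hn : σ.idx 0 0 = n) (hc : 7 * n.size + 4 ≤ c)
    (hQ : ∀ (τ : State) (c' : ℕ), Frame [14, 21, 27] σ.idx τ.idx → τ.num = σ.num →
      τ.idx 27 0 = 3 * n.size → (∀ j < 3 * n.size, τ.idx 14 j = 0) →
      c ≤ c' + (7 * n.size + 4) → Q τ c') :
    wp w ℓ bucketInitProgram Q σ c := by
  simp only [bucketInitProgram, wp_cons, wp_setIdx, IdxExpr.eval, var_eval, write_ne, ne_eq,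
    Nat.reduceEqDiff, not_false_eq_true, hn, Nat.sub_sub, Nat.reduceAdd]
  repeat refine And.intro (by omega) ?_
  refine wp_loop (fun τ c' => Frame [14, 21, 27] σ.idx τ.idx ∧ τ.num = σ.num ∧ τ.idx 21 0 ≤ n ∧
    τ.idx 27 0 + 3 * (τ.idx 21 0).size = 3 * n.size ∧ (∀ j < τ.idx 27 0, τ.idx 14 j = 0) ∧
    c + 7 * (τ.idx 21 0).size ≤ c' + (7 * n.size + 2) ∧ 7 * (τ.idx 21 0).size + 2 ≤ c') ?_ ?_ ?_
  · refine ⟨((Frame.refl _ _).write (by simp) _ _).write (by simp) _ _, rfl, ?_, ?_, ?_, ?_, ?_⟩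
    all_goals simp [write_ne]
    all_goals omega
  · rintro τ c' ⟨hF, hnum, h21, h27, h14, hc1, hc2⟩ hb
    simp only [Test.Holds, IdxExpr.eval, var_eval] at hb
    have hs := size_div_two hb
    refine ⟨by omega, ?_⟩
    simp only [wp_cons, wp_nil, wp_setIdx, IdxExpr.eval, var_eval, write_ne, write_same, ne_eq,
      Nat.reduceEqDiff, not_false_eq_true, Nat.sub_sub, Nat.reduceAdd, Function.update_self]
    repeat refine And.intro (by omega) ?_
    refine ⟨((((hF.write (by simp) _ _).write (by simp) _ _).write (by simp) _ _).write (by simp)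
      _ _).write (by simp) _ _, hnum, by omega, by omega, ?_, by omega, by omega⟩
    intro j hj
    simp only [Function.update_apply]
    split_ifs
    any_goals rfl
    exact h14 j (by omega)
  · rintro τ c' ⟨hF, hnum, h21, h27, h14, hc1, hc2⟩ hb
    simp only [Test.Holds, IdxExpr.eval, var_eval, not_not] at hb
    simp only [hb, Nat.size_zero] at h27 hc1
    rw [wp_nil]
    exact ⟨by omega, by omega, hQ _ _ hF hnum (by omega) (by rw [show τ.idx 27 0 = 3 * n.size by omega] at h14; exact h14) (by omega)⟩

/-- An upper bound on the length of a path. -/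
def lengthBound {m : ℕ} (d : Fin m → ℚ) : ℚ := 1 + ((List.finRange m).map d).sum

/-- Store the upper bound in cell `n` of the array of tentative distances. -/
def boundProgram : Program := block [
  .setNum 3 (var 0) (.lit 1),
  forLoop 21 (.read 0 (.lit 1)) (.setNum 3 (var 0) (.add (.read 3 (var 0)) (.read 1 (var 21))))]

theorem wp_boundProgram {w ℓ n m : ℕ} {d : Fin m → ℚ} {Q : State → ℕ → Prop} {σ : State} {c : ℕ}
    (hw : m ≤ w) (hℓ : ∀ p : List (Fin m), p.Nodup → bits (1 + (p.map d).sum) ≤ ℓ)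
    (hn : σ.idx 0 0 = n) (hm : σ.idx 0 1 = m) (hd : ∀ e : Fin m, σ.num 1 e = d e)
    (hc : 3 * m + 4 ≤ c)
    (hQ : ∀ (τ : State) (c' : ℕ), Frame [21] σ.idx τ.idx → Frame [3] σ.num τ.num →
      τ.num 3 n = lengthBound d → c ≤ c' + (3 * m + 4) → Q τ c') :
    wp w ℓ boundProgram Q σ c := by
  simp only [boundProgram, wp_cons, wp_setNum, NumExpr.eval, var_eval, hn]
  refine ⟨by omega, by simpa using hℓ [] (by simp), ?_⟩
  -- Cell `n` of the key array belongs to no node and accumulates the bound.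
  refine wp_forLoop (K := 1) (M := m) (fun i τ => Frame [21] σ.idx τ.idx ∧ Frame [3] σ.num τ.num ∧
    τ.num 3 n = 1 + (((List.finRange m).take i).map d).sum) (by omega) (by omega) ?_ ?_ ?_ ?_
  · refine ⟨(Frame.refl _ _).write (by simp) _ _, (Frame.refl _ _).write (by simp) _ _, ?_⟩
    simp [State.setVar]
  · rintro i ρ ⟨hF, -⟩
    simp [IdxExpr.eval, hF 0 (by simp), hm]
  · rintro i ρ c' hi h21 ⟨hF, hFn, h3⟩ hc'
    have h : ((List.finRange m).take (i + 1)) = ((List.finRange m).take i) ++ [⟨i, hi⟩] := by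
      rw [List.take_succ_eq_append_getElem (by simpa using hi)]
      simp
    have h' : ρ.num 3 n + d ⟨i, hi⟩ = 1 + (((List.finRange m).take (i + 1)).map d).sum := by
      rw [h3, h, List.map_append, List.sum_append]; simp [add_assoc]
    have h1 : ρ.num 1 i = d ⟨i, hi⟩ := by rw [hFn 1 (by simp)]; exact hd ⟨i, hi⟩
    have h0 : ρ.idx 0 0 = n := by rw [hF 0 (by simp), hn]
    simp only [wp_setNum, NumExpr.eval, var_eval, h0, h21, h1, h']
    refine ⟨by omega, hℓ _ ((List.nodup_finRange m).sublist (List.take_sublist _ _)), by omega,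
      trivial, hF.write (by simp) _ _, hFn.write (by simp) _ _, ?_⟩
    simp [State.setVar]
  · rintro τ c' ⟨hF, hFn, h3⟩ hc'
    rw [wp_nil]
    refine ⟨by omega, hQ _ _ hF hFn ?_ (by omega)⟩
    rw [h3, lengthBound, List.take_of_length_le (by simp)]

/-- Initialize the data of all nodes. -/
def nodeInitProgram : Program :=
  forLoop 21 (var 0) (block [
    .setIdx 5 (var 21) (.lit 0),
    .setIdx 7 (var 21) (.lit 0),
    .setIdx 8 (var 21) (.lit 0),
    .setIdx 9 (var 21) (.lit 0),
    .setIdx 10 (var 21) (.lit 0),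
    .setIdx 13 (var 21) (var 21),
    .setIdx 15 (var 21) (.lit 0),
    .setNum 3 (var 21) (.read 3 (var 0))])

theorem wp_nodeInitProgram {w ℓ n : ℕ} {Q : State → ℕ → Prop} {σ : State} {c : ℕ}
    (hw : n ≤ w) (hn : σ.idx 0 0 = n) (hbits : bits (σ.num 3 n) ≤ ℓ) (hc : 11 * n + 2 ≤ c)
    (hQ : ∀ (τ : State) (c' : ℕ), Frame [5, 7, 8, 9, 10, 13, 15, 21] σ.idx τ.idx →
      Frame [3] σ.num τ.num →
      (∀ v < n, τ.idx 5 v = 0 ∧ τ.idx 7 v = 0 ∧ τ.idx 8 v = 0 ∧ τ.idx 9 v = 0 ∧ τ.idx 10 v = 0 ∧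
        τ.idx 13 v = v ∧ τ.idx 15 v = 0 ∧ τ.num 3 v = σ.num 3 n) →
      c ≤ c' + (11 * n + 2) → Q τ c') :
    wp w ℓ nodeInitProgram Q σ c := by
  refine wp_forLoop (K := 9) (M := n) (fun i τ => Frame [5, 7, 8, 9, 10, 13, 15, 21] σ.idx τ.idx ∧
    Frame [3] σ.num τ.num ∧ τ.num 3 n = σ.num 3 n ∧
    (∀ v < i, τ.idx 5 v = 0 ∧ τ.idx 7 v = 0 ∧ τ.idx 8 v = 0 ∧ τ.idx 9 v = 0 ∧ τ.idx 10 v = 0 ∧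
        τ.idx 13 v = v ∧ τ.idx 15 v = 0 ∧ τ.num 3 v = σ.num 3 n)) hw (by omega) ?_ ?_ ?_ ?_
  · exact ⟨(Frame.refl _ _).write (by simp) _ _, Frame.refl _ _, rfl, by simp⟩
  · rintro i ρ ⟨hF, -⟩
    rw [var_eval, hF 0 (by simp), hn]
  · rintro i ρ c' hi h21 ⟨hF, hFn, h3, hv⟩ hc'
    have h0 : ρ.idx 0 0 = n := by rw [hF 0 (by simp), hn]
    simp only [wp_cons, wp_nil, wp_setIdx, wp_setNum, IdxExpr.eval, NumExpr.eval, var_eval,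
      write_ne, write_same, ne_eq,
      Nat.reduceEqDiff, not_false_eq_true, OfNat.zero_ne_ofNat, h0, h21, h3, Nat.sub_sub, Nat.reduceAdd]
    repeat refine And.intro (by omega) ?_
    refine ⟨trivial, ?_, hFn.write (by simp) _ _, ?_, ?_⟩
    · exact (((((((hF.write (by simp) _ _).write (by simp) _ _).write (by simp) _ _).write (by simp)
        _ _).write (by simp) _ _).write (by simp) _ _).write (by simp) _ _).write (by simp) _ _
    · simp [State.setVar, Function.update_of_ne hi.ne', h3]
    · intro v hv'
      simp only [State.setVar, write_ne, write_same, ne_eq, Nat.reduceEqDiff, not_false_eq_true]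
      rcases Nat.lt_succ_iff_lt_or_eq.1 hv' with hv' | rfl
      · simp only [Function.update_of_ne hv'.ne]
        exact hv v hv'
      · simp
  · rintro τ c' ⟨hF, hFn, h3, hv⟩ hc'
    exact hQ _ _ hF hFn hv (by omega)

theorem IsChain.congr {next next' : ℕ → ℕ} {ptr : ℕ} {l : List ℕ} (h : IsChain next ptr l)
    (hl : ∀ e ∈ l, next' e = next e) : IsChain next' ptr l := by
  induction l generalizing ptr with
  | nil => exact h
  | cons e l ih =>
    refine ⟨h.1, ?_⟩
    rw [hl e (by simp)]
    exact ih h.2 fun f hf => hl f (by simp [hf])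

/-- The edges that leave `u`, in reverse order. -/
def outEdges (src : ℕ → ℕ) (m u : ℕ) : List ℕ := ((List.range m).filter fun e => src e = u).reverse

theorem mem_outEdges {src : ℕ → ℕ} {m u e : ℕ} : e ∈ outEdges src m u ↔ e < m ∧ src e = u := by
  simp [outEdges]

theorem outEdges_succ (src : ℕ → ℕ) (m u : ℕ) : outEdges src (m + 1) u =
    if src m = u then m :: outEdges src m u else outEdges src m u := by
  unfold outEdges
  rw [List.range_succ, List.filter_append, List.reverse_append]
  split_ifs with h <;> simp [h]

/-- Every edge has exactly one tail; so the relaxations of all rounds together cost `O(m)`. -/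
theorem sum_length_outEdges {src : ℕ → ℕ} {n m : ℕ} (h : ∀ e < m, src e < n) :
    ∑ u ∈ Finset.range n, (outEdges src m u).length = m := by
  induction m with
  | zero => simp [outEdges]
  | succ m ih =>
    have h1 : ∀ u, (outEdges src (m + 1) u).length =
        (outEdges src m u).length + if src m = u then 1 else 0 := by
      intro u; rw [outEdges_succ]; split_ifs <;> simp
    simp only [h1, Finset.sum_add_distrib]
    rw [ih fun e he => h e (by omega), Finset.sum_ite_eq, if_pos (by simpa using h m (by omega))]

/-- Build the linked lists of the edges that leave the nodes. -/
def adjacencyProgram : Program :=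
  forLoop 21 (.read 0 (.lit 1)) (block [
    .setIdx 6 (var 21) (.read 5 (.read 1 (var 21))),
    .setIdx 5 (.read 1 (var 21)) (.add (var 21) (.lit 1))])

/-- Each edge becomes the head of the list of its tail, whence the reverse order in `outEdges`.
Existing lists contain only smaller edge numbers, so their successor cells are not overwritten. -/
theorem wp_adjacencyProgram {w ℓ n m : ℕ} {Q : State → ℕ → Prop} {σ : State} {c : ℕ}
    (hw : m ≤ w) (hm : σ.idx 0 1 = m) (hsrc : ∀ e < m, σ.idx 1 e < n)
    (h5 : ∀ v < n, σ.idx 5 v = 0) (hc : 5 * m + 2 ≤ c)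
    (hQ : ∀ (τ : State) (c' : ℕ), Frame [5, 6, 21] σ.idx τ.idx → τ.num = σ.num →
      (∀ u < n, IsChain (τ.idx 6) (τ.idx 5 u) (outEdges (σ.idx 1) m u)) →
      c ≤ c' + (5 * m + 2) → Q τ c') :
    wp w ℓ adjacencyProgram Q σ c := by
  refine wp_forLoop (K := 3) (M := m) (fun i τ => Frame [5, 6, 21] σ.idx τ.idx ∧ τ.num = σ.num ∧
    (∀ u < n, IsChain (τ.idx 6) (τ.idx 5 u) (outEdges (σ.idx 1) i u))) hw (by omega) ?_ ?_ ?_ ?_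
  · refine ⟨(Frame.refl _ _).write (by simp) _ _, rfl, ?_⟩
    intro u hu
    simpa [outEdges, State.setVar, write_ne, IsChain] using h5 u hu
  · rintro i ρ ⟨hF, -⟩
    simp [IdxExpr.eval, hF 0 (by simp), hm]
  · rintro i ρ c' hi h21 ⟨hF, hFn, hch⟩ hc'
    have h1 : ρ.idx 1 = σ.idx 1 := hF 1 (by simp)
    have hle : ρ.idx 5 (σ.idx 1 i) ≤ w := by
      have := hch _ (hsrc i hi)
      cases hl : outEdges (σ.idx 1) i (σ.idx 1 i) with
      | nil => rw [hl] at this; have h : ρ.idx 5 (σ.idx 1 i) = 0 := this; omega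
      | cons e l =>
        rw [hl] at this
        have h2 : e ∈ outEdges (σ.idx 1) i (σ.idx 1 i) := by rw [hl]; simp
        have h4 := (mem_outEdges.1 h2).1
        have h3 : ρ.idx 5 (σ.idx 1 i) = e + 1 := this.1
        omega
    simp only [wp_cons, wp_nil, wp_setIdx, IdxExpr.eval, var_eval, write_ne, write_same, ne_eq,
      Nat.reduceEqDiff, not_false_eq_true, h1, h21, Nat.sub_sub, Nat.reduceAdd]
    repeat refine And.intro (by omega) ?_
    refine ⟨trivial, ((hF.write (by simp) _ _).write (by simp) _ _).write (by simp) _ _, hFn, ?_⟩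
    intro u hu
    simp only [State.setVar, write_ne, write_same, ne_eq, Nat.reduceEqDiff, not_false_eq_true]
    have hcongr : ∀ f ∈ outEdges (σ.idx 1) i u,
        Function.update (ρ.idx 6) i (ρ.idx 5 (σ.idx 1 i)) f = ρ.idx 6 f := fun f hf =>
      Function.update_of_ne (mem_outEdges.1 hf).1.ne _ _
    rw [outEdges_succ]
    split_ifs with h
    · subst h
      refine ⟨by simp, ?_⟩
      rw [Function.update_self]
      exact (hch _ hu).congr hcongr
    · rw [Function.update_of_ne (Ne.symm h)]
      exact (hch _ hu).congr hcongr
  · rintro τ c' ⟨hF, hFn, hch⟩ hc'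
    exact hQ _ _ hF hFn hch (by omega)

/-! ## The main loop of Dijkstra's algorithm -/

/-- The total weight of the nodes that are not settled. -/
def remainingWork (n : ℕ) (f dead : ℕ → ℕ) : ℕ :=
  ∑ u ∈ Finset.range n, if dead u = 0 then f u else 0

theorem remainingWork_settle {n u : ℕ} {f dead : ℕ → ℕ} (hu : u < n) (hdu : dead u = 0) :
    remainingWork n f (Function.update dead u 1) + f u = remainingWork n f dead := by
  unfold remainingWork
  rw [← Finset.add_sum_erase _ _ (Finset.mem_range.2 hu),
    ← Finset.add_sum_erase (Finset.range n) (fun u => if dead u = 0 then f u else 0)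
      (Finset.mem_range.2 hu)]
  simp only [Function.update_self, one_ne_zero, if_false, hdu, if_true, zero_add]
  rw [add_comm]
  congr 1
  refine Finset.sum_congr rfl fun v hv => ?_
  rw [Function.update_of_ne (Finset.ne_of_mem_erase hv)]

/-- The time credits for settling `u` and relaxing the edges that leave `u`. -/
def settleCost (src : ℕ → ℕ) (n m u : ℕ) : ℕ :=
  300 * n.size + 100 + 150 * (outEdges src m u).length

def dijkstraLoop : Program :=
  .loop (.not (.idxEq (var 20) (.lit 0)))
    (block [consolidateProgram, collectProgram, removeProgram, relaxProgram])

/-- The invariant holds, besides the potential, enough credits for every unsettled node. Settling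
one releases `300 * n.size + 100` for consolidation, collection and removal, and 150 for each
leaving edge; only nodes, not edges, pay the logarithm. -/
theorem wp_dijkstraLoop {w ℓ n m : ℕ} {N : Network n m} {d : Fin m → ℚ} {M : ℚ}
    (hd : ∀ e, 0 ≤ d e) {Q : State → ℕ → Prop} {σ : State} {c c₀ : ℕ}
    (hw : 3 * n.size + n + m + 2 ≤ w)
    (hℓ : ∀ p : List (Fin m), p.Nodup → bits (p.map d).sum ≤ ℓ)
    (hN : σ.Holds N) (hd1 : ∀ e : Fin m, σ.num 1 e = d e) (h27 : σ.idx 27 0 = 3 * n.size)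
    (hA : ∀ j < 3 * n.size, σ.idx 14 j = 0)
    (H : σ.HeapAt n) (hT : σ.TidyAt n) (hL : σ.ListedAt n) (hD : σ.DijkstraAt N d M [])
    (hch : ∀ u < n, IsChain (σ.idx 6) (σ.idx 5 u) (outEdges (σ.idx 1) m u))
    (hc : σ.potential n + remainingWork n (settleCost (σ.idx 1) n m) (σ.idx 7) + c₀ + 200 ≤ c)
    (hQ : ∀ (τ : State) (c' : ℕ),
      Frame [7, 8, 9, 10, 11, 12, 13, 14, 15, 20, 21, 22, 23, 24, 25, 26, 28, 29, 30, 31]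
        σ.idx τ.idx → Frame [3] σ.num τ.num → τ.DijkstraAt N d M [] →
      (∀ v : Fin n, τ.idx 7 v ≠ 0) → c₀ ≤ c' → Q τ c') :
    wp w ℓ dijkstraLoop Q σ c := by
  refine wp_loop (fun τ c' =>
    Frame [7, 8, 9, 10, 11, 12, 13, 14, 15, 20, 21, 22, 23, 24, 25, 26, 28, 29, 30, 31]
      σ.idx τ.idx ∧ Frame [3] σ.num τ.num ∧ (∀ j < 3 * n.size, τ.idx 14 j = 0) ∧
    τ.HeapAt n ∧ τ.TidyAt n ∧ τ.ListedAt n ∧ τ.DijkstraAt N d M [] ∧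
    τ.potential n + remainingWork n (settleCost (σ.idx 1) n m) (τ.idx 7) + c₀ + 200 ≤ c') ?_ ?_ ?_
  · exact ⟨Frame.refl _ _, Frame.refl _ _, hA, H, hT, hL, hD, hc⟩
  · rintro τ c0 ⟨hF, hFn, hA, H, hT, hL, hD, hc0⟩ hb
    simp only [Test.Holds, IdxExpr.eval, var_eval] at hb
    obtain ⟨hx, hdx, -⟩ := hL.mem 0 (by omega)
    have hN0 := hN.frame hF (by simp) (by simp) (by simp)
    refine ⟨by omega, ?_⟩
    simp only [wp_cons]
    refine wp_consolidateProgram (by omega) hN0.nodes H hT (Buckets.ofListed hL hA) (by omega) ?_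
    intro τ1 c1 hF1 hn1 H1 hT1 hB1 hrc1 hc1
    have e7 : τ1.idx 7 = τ.idx 7 := hF1 7 (by simp)
    have e27 : τ1.idx 27 = σ.idx 27 := (hF1 27 (by simp)).trans (hF 27 (by simp))
    -- The minimum is not known yet; any unsettled node shows that there are credits for finding it.
    have hwork := remainingWork_settle (f := settleCost (σ.idx 1) n m) hx hdx
    have hwork' : 300 * n.size + 100 ≤ settleCost (σ.idx 1) n m (τ.idx 13 0) := by
      unfold settleCost; omega
    refine wp_collectProgram (by omega) rfl (by rw [e27, h27]) H1 hT1 hB1 hrc1 (by omega) ?_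
    intro τ2 c2 hF2 hn2 hL2 hA2 hrc2 hb2 hmin2 hc2
    have g : ∀ a, a ∉ [13, 14, 20, 21, 29] → τ2.idx a = τ1.idx a := hF2
    have H2 : τ2.HeapAt n := by
      simp only [State.HeapAt, g 7 (by simp), g 8 (by simp), g 9 (by simp), g 10 (by simp),
        g 11 (by simp), g 12 (by simp), hn2]
      exact H1
    have hT2 : τ2.TidyAt n := by
      simp only [State.TidyAt, g 7 (by simp), g 8 (by simp), g 10 (by simp)]
      exact hT1
    have hpot2 : τ2.potential n ≤ τ1.potential n + 60 * n.size := by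
      simp only [State.potential, g 7 (by simp), g 8 (by simp), g 10 (by simp)]
      omega
    have e7' : τ2.idx 7 = τ.idx 7 := (g 7 (by simp)).trans e7
    have hmin : ∀ v < n, τ.idx 7 v = 0 → τ2.idx 20 0 ≠ 0 ∧
        τ1.num 3 (τ2.idx 13 (τ2.idx 29 0)) ≤ τ1.num 3 v := by
      intro v hv hdv
      obtain ⟨r, hr, hdr, hpr, hkr⟩ := H2.exists_root_le hv (by rw [e7', hdv])
      obtain ⟨i, hi, rfl⟩ := hL2.cover r hr hdr hpr
      refine ⟨by omega, (hmin2 i hi).trans ?_⟩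
      rwa [hn2] at hkr
    have hb2' := hb2 (hmin _ hx hdx).1
    obtain ⟨hun, hdu, -⟩ := hL2.mem _ hb2'
    obtain ⟨u, hu⟩ : ∃ u : Fin n, (u : ℕ) = τ2.idx 13 (τ2.idx 29 0) := ⟨⟨_, hun⟩, rfl⟩
    rw [e7', ← hu] at hdu
    have hwork := remainingWork_settle (f := settleCost (σ.idx 1) n m) u.isLt hdu
    have hsettle : settleCost (σ.idx 1) n m u =
      300 * n.size + 100 + 150 * (outEdges (σ.idx 1) m u).length := rfl
    have e0 : τ2.idx 0 0 = n := by
      rw [hF2 0 (by simp), hF1 0 (by simp), hN0.nodes]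
    refine wp_removeProgram (by omega) rfl e0 H2 hT2 hL2 hb2' hu.symm (by omega) ?_
    intro τ3 c3 hF3 hn3 h22 h7 H3 hT3 hL3 hc3
    have hFall : Frame [7, 8, 9, 10, 11, 12, 13, 14, 15, 20, 21, 22, 23, 24, 25, 26, 28, 29, 30, 31]
        σ.idx τ3.idx := ((hF.trans hF1 (by simp)).trans hF2 (by simp)).trans hF3 (by simp)
    have hnum : τ3.num = τ.num := hn3.trans (hn2.trans hn1)
    have e15 : τ3.idx 15 = τ.idx 15 := by
      rw [hF3 15 (by simp), hF2 15 (by simp), hF1 15 (by simp)]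
    have hD3 : τ3.DijkstraAt N d M (outEdges (σ.idx 1) m u) := by
      simp only [State.DijkstraAt, h7, e7', e15, hnum]
      refine hD.settle (fun v hv => ?_) fun e he => mem_outEdges.2 ⟨e.isLt, ?_⟩
      · have := (hmin v v.isLt hv).2
        rwa [← hu, hn1] at this
      · rw [hN.src, he]
    refine wp_relaxProgram hd (u := u) (l := outEdges (σ.idx 1) m u) (by omega) hℓ
      (hN.frame hFall (by simp) (by simp) (by simp)) ?_ h22 (by rw [h7]; simp) ?_ H3 hT3 hL3 hD3 ?_ ?_
      (by omega) ?_
    · intro e; rw [hnum, hFn 1 (by simp), hd1]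
    · intro v hv
      rw [hnum]
      rw [h7, e7'] at hv
      by_cases hvu : (v : ℕ) = u
      · rw [hvu]
      · rw [Function.update_of_ne hvu] at hv
        exact hD.order v u hv hdu
    · rw [hFall 6 (by simp), hFall 5 (by simp)]
      exact hch u u.isLt
    · intro e he
      obtain ⟨h1, h2⟩ := mem_outEdges.1 he
      exact ⟨h1, Fin.ext (by rw [← hN.src ⟨e, h1⟩]; exact h2)⟩
    · intro τ4 c4 hF4 hn4 H4 hT4 hL4 hD4 hc4
      have e7'' : τ4.idx 7 = Function.update (τ.idx 7) u 1 := by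
        rw [hF4 7 (by simp), h7, e7']
      rw [wp_nil]
      refine ⟨by omega, hFall.trans hF4 (by simp), ?_, ?_, H4, hT4, hL4, hD4, ?_⟩
      · refine Frame.trans (hFn.trans ?_ (List.Subset.refl _)) hn4 (by simp)
        rw [hnum]; exact Frame.refl _ _
      · intro j hj
        rw [hF4 14 (by simp), hF3 14 (by simp), hA2 j hj]
      · rw [e7'']; omega
  · rintro τ c0 ⟨hF, hFn, hA, H, hT, hL, hD, hc0⟩ hb
    simp only [Test.Holds, IdxExpr.eval, var_eval, not_not] at hb
    -- An unsettled node would lie below a root, but the list of all roots is empty.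
    refine ⟨by omega, hQ _ _ hF hFn hD (fun v hv => ?_) (by omega)⟩
    obtain ⟨r, hr, hdr, hpr, -⟩ := H.exists_root_le v.isLt hv
    obtain ⟨i, hi, -⟩ := hL.cover r hr hdr hpr
    omega

/-! ## The minimizing oracle -/

theorem Network.IsWalk.of_concat {n m : ℕ} {N : Network n m} {u v : Fin n} {p : List (Fin m)}
    {e : Fin m} (h : N.IsWalk u (p ++ [e]) v) : N.IsWalk u p (N.src e) ∧ N.dst e = v := by
  induction p generalizing u with
  | nil => exact ⟨h.1.symm, h.2⟩
  | cons f p ih => exact ⟨⟨h.1, (ih h.2).1⟩, (ih h.2).2⟩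

/-- Write the incidence vector of the path of predecessor edges to `t` to the number array `3`. -/
def traceProgram : Program := block [
  forLoop 21 (.read 0 (.lit 1)) (.setNum 3 (var 21) (.lit 0)),
  .setIdx 24 (.lit 0) (.read 0 (.lit 3)),
  .loop (.not (.idxEq (.read 15 (var 24)) (.lit 0))) (block [
    .setIdx 23 (.lit 0) (.sub (.read 15 (var 24)) (.lit 1)),
    .setNum 3 (var 23) (.lit 1),
    .setIdx 24 (.lit 0) (.read 1 (var 23))])]

theorem wp_traceProgram {w ℓ n m : ℕ} {N : Network n m} {Q : State → ℕ → Prop} {σ : State} {c : ℕ}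
    {p : List (Fin m)} {x : Fin n} (hw : n + m ≤ w) (hℓ : 3 ≤ ℓ) (hN : σ.Holds N)
    (hx : σ.idx 15 x = 0) (hp : N.IsWalk x p N.t) (hpred : ∀ e ∈ p, σ.idx 15 (N.dst e) = e + 1)
    (hc : 3 * m + 5 * p.length + 5 ≤ c)
    (hQ : ∀ (τ : State) (c' : ℕ), Frame [21, 23, 24] σ.idx τ.idx → Frame [3] σ.num τ.num →
      (∀ e : Fin m, τ.num 3 e = unitFlow p e) → c ≤ c' + (3 * m + 5 * p.length + 5) → Q τ c') :
    wp w ℓ traceProgram Q σ c := by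
  have hb0 : bits 0 ≤ ℓ := le_trans (by decide) hℓ
  have hb1 : bits 1 ≤ ℓ := le_trans (by decide) hℓ
  simp only [traceProgram, wp_cons]
  refine wp_forLoop (K := 1) (M := m) (fun i τ => Frame [21, 23, 24] σ.idx τ.idx ∧
    Frame [3] σ.num τ.num ∧ ∀ e < i, τ.num 3 e = 0) (by omega) (by omega) ?_ ?_ ?_ ?_
  · exact ⟨(Frame.refl _ _).write (by simp) _ _, Frame.refl _ _, by simp⟩
  · rintro i ρ ⟨hF, -⟩
    simp [IdxExpr.eval, hF 0 (by simp), hN.edges]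
  · rintro i ρ c' hi h21 ⟨hF, hFn, h3⟩ hc'
    simp only [wp_setNum, NumExpr.eval, var_eval, h21]
    refine ⟨by omega, hb0, by omega, trivial, hF.write (by simp) _ _, hFn.write (by simp) _ _, ?_⟩
    intro e he
    simp only [State.setVar, write_same, Function.update_apply]
    split_ifs with h
    · rfl
    · exact h3 e (by omega)
  · rintro ρ c' ⟨hF, hFn, h3⟩ hc'
    have ht := N.t.isLt
    rw [wp_cons, wp_setIdx, wp_cons]
    simp only [IdxExpr.eval, hF 0 (by simp), hN.t]
    refine ⟨by omega, by omega, ?_⟩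
    -- The path splits into a part `q` still to be traced and a part `r` already written. At `s` the
    -- predecessor entry 0 ends the loop.
    refine wp_loop (fun τ c'' => ∃ (v : Fin n) (q r : List (Fin m)), τ.idx 24 0 = v ∧ p = q ++ r ∧
      N.IsWalk x q v ∧ Frame [21, 23, 24] σ.idx τ.idx ∧ Frame [3] σ.num τ.num ∧
      (∀ e : Fin m, τ.num 3 e = unitFlow r e) ∧ c' ≤ c'' + (1 + 5 * r.length) ∧
      5 * q.length + 2 ≤ c'') ?_ ?_ ?_
    · refine ⟨N.t, p, [], by simp, by simp, hp, hF.write (by simp) _ _, hFn, ?_, ?_, ?_⟩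
      · intro e; simpa [unitFlow] using h3 e e.isLt
      · simp; omega
      · omega
    · rintro τ c'' ⟨v, q, r, h24, hqr, hq, hF, hFn, h3, hc1, hc2⟩ hb
      simp only [Test.Holds, IdxExpr.eval, var_eval, h24] at hb
      rcases List.eq_nil_or_concat' q with rfl | ⟨q, e, rfl⟩
      · obtain rfl : x = v := hq
        rw [hF 15 (by simp)] at hb
        exact absurd hx hb
      · obtain ⟨hq', rfl⟩ := hq.of_concat
        have he : τ.idx 15 (N.dst e) = e + 1 := by
          rw [hF 15 (by simp)]; exact hpred e (by simp [hqr])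
        have hN' := hN.frame hF (by simp) (by simp) (by simp)
        have := (N.src e).isLt
        simp only [List.length_append, List.length_cons, List.length_nil] at hc2
        refine ⟨by omega, ?_⟩
        simp only [wp_cons, wp_nil, wp_setIdx, wp_setNum, IdxExpr.eval, NumExpr.eval, var_eval, h24,
          he, Nat.add_sub_cancel, write_same, write_ne, ne_eq, Nat.reduceEqDiff, not_false_eq_true,
          OfNat.one_ne_ofNat, Function.update_self, hN'.src, Nat.sub_sub, Nat.reduceAdd]
        refine ⟨by omega, by omega, by omega, hb1, by omega, by omega, by omega,
          N.src e, q, e :: r, by simp, by simp [hqr], hq',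
          (hF.write (by simp) _ _).write (by simp) _ _, hFn.write (by simp) _ _, ?_, ?_, by omega⟩
        · intro f
          simp only [write_same, Function.update_apply, Fin.val_inj, unitFlow, List.mem_cons]
          by_cases hfe : f = e
          · simp [hfe]
          · simpa [hfe, unitFlow] using h3 f
        · simp only [List.length_cons]; omega
    · rintro τ c'' ⟨v, q, r, h24, hqr, hq, hF, hFn, h3, hc1, hc2⟩ hb
      simp only [Test.Holds, IdxExpr.eval, var_eval, h24, not_not] at hb
      rcases List.eq_nil_or_concat' q with rfl | ⟨q, e, rfl⟩
      · obtain rfl : p = r := hqr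
        rw [wp_nil]
        exact ⟨by omega, by omega, hQ _ _ hF hFn h3 (by omega)⟩
      · obtain ⟨hq, rfl⟩ := hq.of_concat
        rw [hF 15 (by simp), hpred e (by simp [hqr])] at hb
        omega

/-! ## Encoding lengths of rational numbers -/

/-- Numerator and denominator of `q` are at most `2 ^ b`. -/
def BitBound (b : ℕ) (q : ℚ) : Prop := q.num.natAbs ≤ 2 ^ b ∧ q.den ≤ 2 ^ b

namespace BitBound

variable {a b : ℕ} {p q : ℚ}

theorem mono (h : BitBound a q) (hab : a ≤ b) : BitBound b q :=
  ⟨h.1.trans (Nat.pow_le_pow_right two_pos hab), h.2.trans (Nat.pow_le_pow_right two_pos hab)⟩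

theorem bits_le (h : BitBound b q) : bits q ≤ 2 * b + 3 := by
  have h1 : q.num.natAbs.size ≤ b + 1 :=
    Nat.size_le.2 (h.1.trans_lt (Nat.pow_lt_pow_right one_lt_two (Nat.lt_succ_self _)))
  have h2 : q.den.size ≤ b + 1 :=
    Nat.size_le.2 (h.2.trans_lt (Nat.pow_lt_pow_right one_lt_two (Nat.lt_succ_self _)))
  unfold bits
  omega

theorem of_bits (q : ℚ) : BitBound (bits q) q := by
  have h1 := (Nat.lt_size_self q.num.natAbs).le
  have h2 := (Nat.lt_size_self q.den).le
  refine ⟨h1.trans (Nat.pow_le_pow_right two_pos ?_), h2.trans (Nat.pow_le_pow_right two_pos ?_)⟩ <;>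
  unfold bits <;> omega

/-- Reduction to lowest terms only shrinks numerator and denominator. So the bounds for the field
operations can be read off the unreduced fractions. -/
theorem of_div {x : ℤ} {y : ℕ} (hy : 0 < y) (hx : x.natAbs ≤ 2 ^ b) (hyb : y ≤ 2 ^ b) :
    BitBound b ((x : ℚ) / y) := by
  have hy' : (y : ℤ) ≠ 0 := by omega
  have e : (x : ℚ) / y = Rat.divInt x y := by
    rw [Rat.divInt_eq_div]; simp
  rw [e]
  constructor
  · refine le_trans ?_ hx
    by_cases h0 : x = 0
    · simp [h0]
    · exact Nat.le_of_dvd (by omega) (Int.natAbs_dvd_natAbs.2 (Rat.num_dvd x hy'))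
  · refine le_trans ?_ hyb
    exact Nat.le_of_dvd hy (Int.natCast_dvd_natCast.1 (Rat.den_dvd x y))

theorem mul (hp : BitBound a p) (hq : BitBound b q) : BitBound (a + b) (p * q) := by
  have e : p * q = ((p.num * q.num : ℤ) : ℚ) / ((p.den * q.den : ℕ) : ℚ) := by
    conv_lhs => rw [← Rat.num_div_den p, ← Rat.num_div_den q]
    push_cast
    rw [div_mul_div_comm]
  rw [e]
  refine of_div (Nat.mul_pos p.den_pos q.den_pos) ?_ ?_
  · rw [Int.natAbs_mul, pow_add]; exact Nat.mul_le_mul hp.1 hq.1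
  · rw [pow_add]; exact Nat.mul_le_mul hp.2 hq.2

theorem add (hp : BitBound a p) (hq : BitBound b q) : BitBound (a + b + 1) (p + q) := by
  have hpd : (p.den : ℚ) ≠ 0 := by exact_mod_cast p.den_nz
  have hqd : (q.den : ℚ) ≠ 0 := by exact_mod_cast q.den_nz
  have e : p + q = ((p.num * q.den + p.den * q.num : ℤ) : ℚ) / ((p.den * q.den : ℕ) : ℚ) := by
    conv_lhs => rw [← Rat.num_div_den p, ← Rat.num_div_den q, div_add_div _ _ hpd hqd]
    push_cast
    rfl
  rw [e]
  refine of_div (Nat.mul_pos p.den_pos q.den_pos) ?_ ?_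
  · refine (Int.natAbs_add_le _ _).trans ?_
    rw [Int.natAbs_mul, Int.natAbs_mul, Int.natAbs_natCast, Int.natAbs_natCast, pow_succ, pow_add,
      mul_two]
    exact Nat.add_le_add (Nat.mul_le_mul hp.1 hq.2) (Nat.mul_le_mul hp.2 hq.1)
  · rw [pow_succ, pow_add]
    exact (Nat.mul_le_mul hp.2 hq.2).trans (Nat.le_mul_of_pos_right _ two_pos)

theorem inv (hq : BitBound b q) : BitBound b q⁻¹ := by
  by_cases h0 : q.num = 0
  · rw [Rat.num_eq_zero] at h0
    rw [h0, inv_zero]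
    exact ⟨by simp, by simpa using Nat.one_le_two_pow⟩
  · have e : q⁻¹ = ((q.num.sign * q.den : ℤ) : ℚ) / ((q.num.natAbs : ℕ) : ℚ) := by
      have h1 : ((q.num.natAbs : ℕ) : ℚ) = (q.num.sign : ℚ) * q.num := by
        rw [← Int.cast_mul, Int.sign_mul_self, Int.cast_natCast]
      have h2 : (q.num.sign : ℚ) ≠ 0 := by
        exact_mod_cast fun h => h0 (Int.sign_eq_zero_iff_zero.1 h)
      conv_lhs => rw [← Rat.num_div_den q, inv_div]
      rw [h1]
      push_cast
      rw [mul_div_mul_left _ _ h2]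
    rw [e]
    refine of_div (by omega) ?_ hq.1
    rw [Int.natAbs_mul, Int.natAbs_sign_of_ne_zero h0, one_mul, Int.natAbs_natCast]
    exact hq.2

theorem div (hp : BitBound a p) (hq : BitBound b q) : BitBound (a + b) (p / q) := by
  rw [div_eq_mul_inv]; exact hp.mul hq.inv

theorem natCast {k : ℕ} (hk : k ≤ 2 ^ b) : BitBound b (k : ℚ) :=
  ⟨by simpa using hk, by simpa using Nat.one_le_two_pow⟩

theorem list_sum {α : Type*} {f : α → ℚ} {l : List α} (h : ∀ e ∈ l, BitBound b (f e)) :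
    BitBound (l.length * (b + 1)) (l.map f).sum := by
  induction l with
  | nil => simpa using natCast (b := 0) (k := 0) (by simp)
  | cons e l ih =>
    rw [List.map_cons, List.sum_cons, List.length_cons]
    exact ((h e (by simp)).add (ih fun f hf => h f (by simp [hf]))).mono (by ring_nf; omega)

end BitBound

/-! ### Incidence vectors of paths and the size of connected networks. -/

theorem sum_mul_unitFlow {R : Type*} [NonAssocSemiring R] {m : ℕ} {p : List (Fin m)}
    (hp : p.Nodup) (f : Fin m → R) : ∑ e, f e * unitFlow p e = (p.map f).sum := by
  rw [← List.sum_toFinset f hp]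
  simp only [unitFlow, mul_ite, mul_one, mul_zero]
  rw [← Finset.sum_filter]
  congr 1
  ext e
  simp

namespace Network

variable {n m : ℕ} {N : Network n m}

theorem IsPath.edges_nodup {p : List (Fin m)} (h : N.IsPath p) : p.Nodup :=
  List.Nodup.of_map _ h.2.of_cons

/-- A connected simple graph has at least `n - 1` edges, and each comes from an edge of the network
once directions, loops and parallels are forgotten. -/
theorem card_le (N : Network n m) : n ≤ m + 1 := by
  classical
  let G : SimpleGraph (Fin n) := SimpleGraph.fromRel fun a b => ∃ e, N.src e = a ∧ N.dst e = b
  have hr : ∀ u v, G.Reachable u v := by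
    intro u v
    induction N.connected u v with
    | rel x y h =>
      by_cases hxy : x = y
      · exact hxy ▸ SimpleGraph.Reachable.refl _
      · exact SimpleGraph.Adj.reachable ((SimpleGraph.fromRel_adj _ _ _).2 ⟨hxy, .inl h⟩)
    | refl x => exact SimpleGraph.Reachable.refl _
    | symm x y _ ih => exact ih.symm
    | trans x y z _ _ ih1 ih2 => exact ih1.trans ih2
  have : Nonempty (Fin n) := ⟨N.s⟩
  have hG : G.Connected := { preconnected := hr }
  have h1 := hG.card_vert_le_card_edgeSet_add_one
  have h2 : G.edgeSet ⊆ Set.range fun e => s(N.src e, N.dst e) := by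
    intro x
    induction x using Sym2.ind with
    | _ a b =>
      intro h
      rw [SimpleGraph.mem_edgeSet, SimpleGraph.fromRel_adj] at h
      rcases h.2 with ⟨e, rfl, rfl⟩ | ⟨e, rfl, rfl⟩
      · exact ⟨e, rfl⟩
      · exact ⟨e, Sym2.eq_swap⟩
  have h3 : Nat.card G.edgeSet ≤ m :=
    (Nat.card_mono (Set.finite_range _) h2).trans
      ((Finite.card_range_le _).trans (by simp))
  rw [Nat.card_eq_fintype_card, Fintype.card_fin] at h1
  omega

theorem two_le (N : Network n m) : 2 ≤ n := by
  have h1 := N.s.isLt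
  have h2 := N.t.isLt
  have h3 : (N.s : ℕ) ≠ N.t := fun h => N.s_ne_t (Fin.ext h)
  omega

theorem length_le {p : List (Fin m)} {v : Fin n} (h : (v :: p.map N.dst).Nodup) :
    p.length ≤ n := by
  have := h.length_le_card
  simp at this
  omega

end Network

/-- Compute the incidence vector of a shortest `s`-`t`-path. -/
def oracleProgram : Program := block [
  bucketInitProgram, boundProgram, nodeInitProgram, adjacencyProgram,
  .setNum 3 (.read 0 (.lit 2)) (.lit 0),
  .setIdx 20 (.lit 0) (var 0),
  dijkstraLoop, traceProgram]

/-- Covers the linear initialization, the initial potential of `n` roots on the stack, the settling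
costs and the final tracing. -/
def oracleCost (n m : ℕ) : ℕ := 200 * m + 300 * (n * n.size) + 200 * n + 300

theorem wp_oracleProgram {w ℓ n m : ℕ} {N : Network n m} {d : Fin m → ℚ} (hd : ∀ e, 0 ≤ d e)
    {Q : State → ℕ → Prop} {σ : State} {c : ℕ} (hw : 4 * n + m + 2 ≤ w)
    (hℓ : ∀ p : List (Fin m), p.Nodup → bits (p.map d).sum ≤ ℓ)
    (hℓ' : ∀ p : List (Fin m), p.Nodup → bits (1 + (p.map d).sum) ≤ ℓ)
    (hN : σ.Holds N) (hd1 : ∀ e : Fin m, σ.num 1 e = d e) (hc : oracleCost n m ≤ c)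
    (hQ : ∀ (τ : State) (c' : ℕ) (p : List (Fin m)),
      Frame [5, 6, 7, 8, 9, 10, 11, 12, 13, 14, 15, 20, 21, 22, 23, 24, 25, 26, 27, 28, 29, 30, 31]
        σ.idx τ.idx → Frame [3] σ.num τ.num → (∀ e : Fin m, τ.num 3 e = unitFlow p e) →
      ((∃ q, N.IsPath q) → N.IsPath p ∧ ∀ q, N.IsPath q → (p.map d).sum ≤ (q.map d).sum) →
      ((¬ ∃ q, N.IsPath q) → p = []) → c ≤ c' + oracleCost n m → Q τ c') :
    wp w ℓ oracleProgram Q σ c := by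
  unfold oracleCost at hc hQ
  have hsize : n.size ≤ n := Nat.size_le.2 n.lt_two_pow_self
  have hsn := N.s.isLt
  have hn2 := N.two_le
  have hb0 : bits 0 ≤ ℓ := by simpa using hℓ [] (by simp)
  have hb1 : bits 1 ≤ ℓ := by simpa using hℓ' [] (by simp)
  simp only [oracleProgram, wp_cons]
  refine wp_bucketInitProgram (by omega) hN.nodes (by omega) ?_
  intro τ1 c1 hF1 hn1 h27 h14 hc1
  have hN1 := hN.frame hF1 (by simp) (by simp) (by simp)
  refine wp_boundProgram (by omega) hℓ' hN1.nodes hN1.edges (by rw [hn1]; exact hd1) (by omega) ?_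
  intro τ2 c2 hF2 hn2 hM hc2
  have hN2 := hN1.frame hF2 (by simp) (by simp) (by simp)
  refine wp_nodeInitProgram (by omega) hN2.nodes
    (by rw [hM]; exact hℓ' _ (List.nodup_finRange m)) (by omega) ?_
  intro τ3 c3 hF3 hn3 hv3 hc3
  have hN3 := hN2.frame hF3 (by simp) (by simp) (by simp)
  refine wp_adjacencyProgram (n := n) (m := m) (by omega) hN3.edges (fun e he => ?_)
    (fun v hv => (hv3 v hv).1) (by omega) ?_
  · rw [hN3.src ⟨e, he⟩]; exact (N.src _).isLt
  intro τ4 c4 hF4 hn4 hch hc4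
  have hN4 := hN3.frame hF4 (by simp) (by simp) (by simp)
  simp only [wp_cons, wp_setNum, wp_setIdx, NumExpr.eval, IdxExpr.eval, var_eval, hN4.s, hN4.nodes,
    Nat.sub_sub, Nat.reduceAdd]
  refine ⟨by omega, hb0, by omega, by omega, ?_⟩
  have hM0 : 0 < lengthBound d := by
    have : 0 ≤ ((List.finRange m).map d).sum := List.sum_nonneg (by simpa using hd)
    unfold lengthBound
    linarith
  have e7 : ∀ v < n, τ4.idx 7 v = 0 := fun v hv => by rw [hF4 7 (by simp)]; exact (hv3 v hv).2.1
  have e8 : ∀ v < n, τ4.idx 8 v = 0 := fun v hv => by rw [hF4 8 (by simp)]; exact (hv3 v hv).2.2.1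
  have e9 : ∀ v < n, τ4.idx 9 v = 0 := fun v hv => by
    rw [hF4 9 (by simp)]; exact (hv3 v hv).2.2.2.1
  have e10 : ∀ v < n, τ4.idx 10 v = 0 := fun v hv => by
    rw [hF4 10 (by simp)]; exact (hv3 v hv).2.2.2.2.1
  have e13 : ∀ v < n, τ4.idx 13 v = v := fun v hv => by
    rw [hF4 13 (by simp)]; exact (hv3 v hv).2.2.2.2.2.1
  have e15 : ∀ v < n, τ4.idx 15 v = 0 := fun v hv => by
    rw [hF4 15 (by simp)]; exact (hv3 v hv).2.2.2.2.2.2.1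
  have ekey : ∀ v < n, τ4.num 3 v = lengthBound d := fun v hv => by
    rw [hn4, (hv3 v hv).2.2.2.2.2.2.2, hM]
  have hsrc4 : τ4.idx 1 = τ3.idx 1 := hF4 1 (by simp)
  set σ' : State := ⟨write τ4.idx 20 0 n, write τ4.num 3 N.s 0⟩ with hσ'
  have hN' : σ'.Holds N := hN4.frame (S := [20]) ((Frame.refl _ _).write (by simp) _ _)
    (by simp) (by simp) (by simp)
  -- The credits `c₀` to be left over are the surplus beyond `oracleCost` plus what tracing a path
  -- of at most `n` edges needs.
  refine wp_dijkstraLoop (N := N) (d := d) (M := lengthBound d) 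
    (c₀ := c - (200 * m + 300 * (n * n.size) + 200 * n + 300) + (3 * m + 5 * n + 10)) hd
    (by omega) hℓ hN' ?_ ?_ ?_ ?_ ?_ ?_ ?_ ?_ ?_ ?_
  · intro e
    simp only [hσ', write_ne, ne_eq, Nat.reduceEqDiff, not_false_eq_true, OfNat.one_ne_ofNat]
    rw [hn4, hn3 1 (by simp), hn2 1 (by simp), hn1, hd1]
  · simp only [hσ', write_ne, ne_eq, Nat.reduceEqDiff, not_false_eq_true]
    rw [hF4 27 (by simp), hF3 27 (by simp), hF2 27 (by simp), h27]
  · simp only [hσ', write_ne, ne_eq, Nat.reduceEqDiff, not_false_eq_true]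
    rw [hF4 14 (by simp), hF3 14 (by simp), hF2 14 (by simp)]
    exact h14
  · exact Heap.init (by simpa [hσ', write_ne] using e8) (by simpa [hσ', write_ne] using e9)
      (by simpa [hσ', write_ne] using e10)
  · intro v hv _ hpv
    simp only [hσ', write_ne, ne_eq, Nat.reduceEqDiff, not_false_eq_true] at hpv
    exact absurd (e8 v hv) hpv
  · simp only [State.ListedAt, hσ', write_ne, write_same, ne_eq, Nat.reduceEqDiff,
      not_false_eq_true, Function.update_self]
    refine ⟨⟨fun i hi => ?_, fun i hi j hj hij => ?_⟩, fun v hv _ _ => ⟨v, hv, e13 v hv⟩⟩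
    · rw [e13 i hi]; exact ⟨hi, e7 i hi, e8 i hi⟩
    · rwa [e13 i hi, e13 j hj] at hij
  · simp only [State.DijkstraAt, hσ', write_ne, write_same, ne_eq, Nat.reduceEqDiff,
      not_false_eq_true]
    refine Network.Dijkstra.init hM0 (by simp) (fun v hv => ?_) (fun v => e15 v v.isLt)
      fun v => e7 v v.isLt
    rw [Function.update_of_ne (by rwa [Ne, Fin.val_inj]), ekey v v.isLt]
  · simp only [hσ', write_ne, ne_eq, Nat.reduceEqDiff, not_false_eq_true, OfNat.one_ne_ofNat, hsrc4]
    exact hch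
  · have h1 : rootCount n (τ4.idx 7) (τ4.idx 8) ≤ n :=
      (Finset.card_filter_le _ _).trans (by simp)
    have h2 : markSum n (τ4.idx 10) = 0 :=
      Finset.sum_eq_zero fun v hv => e10 v (Finset.mem_range.1 hv)
    have h3 : remainingWork n (settleCost (τ4.idx 1) n m) (τ4.idx 7) ≤
        300 * (n * n.size) + 100 * n + 150 * m := by
      refine (Finset.sum_le_sum (g := settleCost (τ4.idx 1) n m) fun v _ => ?_).trans ?_
      · split_ifs; exacts [le_rfl, Nat.zero_le _]
      · simp only [settleCost, Finset.sum_add_distrib, ← Finset.mul_sum]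
        rw [sum_length_outEdges (n := n) fun e he => by
          rw [hN4.src ⟨e, he⟩]; exact (N.src _).isLt]
        simp only [Finset.sum_const, Finset.card_range, smul_eq_mul]
        ring_nf
        omega
    simp only [State.potential, hσ', write_ne, write_same, ne_eq, Nat.reduceEqDiff,
      not_false_eq_true, OfNat.one_ne_ofNat, Function.update_self]
    omega
  intro τ5 c5 hF5 hn5 hD hdead hc5
  have hN5 := hN'.frame hF5 (by simp) (by simp) (by simp)
  have hFall : Frame [5, 6, 7, 8, 9, 10, 11, 12, 13, 14, 15, 20, 21, 22, 23, 24, 25, 26, 27, 28, 29, 30, 31]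
      σ.idx τ5.idx := by
    refine Frame.trans ?_ hF5 (by simp)
    refine Frame.write ?_ (by simp) _ _
    exact ((((Frame.refl _ _).trans hF1 (by simp)).trans hF2 (by simp)).trans hF3 (by simp)).trans
      hF4 (by simp)
  have hnall : Frame [3] σ.num τ5.num := by
    refine Frame.trans ?_ hn5 (by simp)
    refine Frame.write ?_ (by simp) _ _
    rw [hn4, ← hn1]
    exact hn2.trans hn3 (by simp)
  have hlt : ∀ q, N.IsPath q → τ5.num 3 N.t ≤ (q.map d).sum ∧ τ5.num 3 N.t < lengthBound d := by
    intro q hq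
    have h1 := hD.key_le_length hdead hq.1
    have h2 := hD.key_s
    have h3 : (q.map d).sum ≤ ((List.finRange m).map d).sum := by
      rw [← List.sum_toFinset d hq.edges_nodup, ← List.sum_toFinset d (List.nodup_finRange m)]
      exact Finset.sum_le_sum_of_subset_of_nonneg (fun e _ => by simp) fun e _ _ => hd e
    refine ⟨by linarith, ?_⟩
    unfold lengthBound
    linarith
  -- The key of `t` is below the bound exactly when an `s`-`t`-path exists, because simple paths are
  -- shorter than `lengthBound d`.
  by_cases ht : τ5.num 3 N.t < lengthBound d
  · obtain ⟨p, hp⟩ := hD.trace N.t ht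
    have hpath : N.IsPath p := ⟨hp.walk, hp.nodup⟩
    have hlen := Network.length_le hp.nodup
    refine wp_traceProgram (by omega) (le_trans (by decide) hb1) hN5 hD.pred_s hp.walk hp.pred_eq
      (by omega) ?_
    intro τ6 c6 hF6 hn6 h3 hc6
    rw [wp_nil]
    refine ⟨by omega, hQ _ _ p (hFall.trans hF6 (by simp)) (hnall.trans hn6 (by simp)) h3
      (fun _ => ⟨hpath, fun q hq => ?_⟩) (fun h => absurd ⟨p, hpath⟩ h) (by omega)⟩
    rw [hp.length]
    exact (hlt q hq).1
  · have hno : ¬ ∃ q, N.IsPath q := fun ⟨q, hq⟩ => ht (hlt q hq).2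
    refine wp_traceProgram (p := []) (x := N.t) (by omega) (le_trans (by decide) hb1) hN5 ?_ rfl
      (by simp) (by simp; omega) ?_
    · by_contra h
      -- A node whose key is still the bound has no predecessor, so tracing stops at `t` at once and
      -- writes the zero vector.
      exact ht (hD.pred_lt _ h)
    intro τ6 c6 hF6 hn6 h3 hc6
    rw [wp_nil]
    simp only [List.length_nil] at hc6
    exact ⟨by omega, hQ _ _ [] (hFall.trans hF6 (by simp)) (hnall.trans hn6 (by simp)) h3
      (fun h => absurd h hno) (fun _ => rfl) (by omega)⟩

/-! ### Running time and register sizes of the oracle. -/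

theorem Network.one_le_edges {n m : ℕ} (N : Network n m) : 1 ≤ m := by
  have := N.two_le
  have := N.card_le
  omega

/-- The binary length is at most one plus the logarithm to base 2, and `1 / log 2 < 2`. -/
theorem size_le_log {n : ℕ} (hn : 1 ≤ n) : (n.size : ℝ) ≤ 1 + 2 * Real.log n := by
  have h0 : 0 < n.size := Nat.size_pos.2 hn
  have h1 : 2 ^ (n.size - 1) ≤ n := Nat.lt_size.1 (by omega)
  have h2 : ((n.size - 1 : ℕ) : ℝ) * Real.log 2 ≤ Real.log n := by
    rw [← Real.log_pow]
    exact Real.log_le_log (by positivity) (by exact_mod_cast h1)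
  have h3 := Real.log_two_gt_d9
  have h4 : (n.size : ℝ) = (n.size - 1 : ℕ) + 1 := by
    rw [Nat.cast_sub (by omega)]; simp
  have h5 : (0 : ℝ) ≤ (n.size - 1 : ℕ) := Nat.cast_nonneg _
  nlinarith

theorem oracleCost_le {n m : ℕ} (N : Network n m) :
    (oracleCost n m : ℝ) ≤ 1500 * (m + n * Real.log n) := by
  have h2 : (2 : ℝ) ≤ n := by exact_mod_cast N.two_le
  have hnm : (n : ℝ) ≤ m + 1 := by exact_mod_cast N.card_le
  have hm : (1 : ℝ) ≤ m := by exact_mod_cast N.one_le_edges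
  have hs := size_le_log (n := n) (by have := N.two_le; omega)
  have hlog : 0 ≤ n * Real.log n := mul_nonneg (by linarith) (Real.log_nonneg (by linarith))
  have hns : (n : ℝ) * n.size ≤ n + 2 * (n * Real.log n) := by nlinarith
  unfold oracleCost
  push_cast
  nlinarith

theorem bits_zero : bits 0 = 2 := by decide

theorem bits_le_lengthsSize (n : ℕ) {m : ℕ} (d : Fin m → ℚ) (e : Fin m) :
    bits (d e) ≤ lengthsSize n d :=
  (Finset.single_le_sum (f := fun e => bits (d e)) (fun _ _ => Nat.zero_le _)
    (Finset.mem_univ e)).trans (Nat.le_add_left _ _)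

theorem cells_apply {α : Type*} [Zero α] {m : ℕ} (f : Fin m → α) (e : Fin m) :
    cells f e = f e := by
  simp [cells]

theorem Network.indexInput_le {n m : ℕ} (N : Network n m) (a i : ℕ) :
    N.indexInput a i ≤ n + m := by
  have hs := N.s.isLt
  have ht := N.t.isLt
  rcases a with _ | _ | _ | a
  · rcases i with _ | _ | _ | _ | i <;> simp [Network.indexInput] <;> omega
  · simp only [Network.indexInput, cells]
    split_ifs with h
    · have := (N.src ⟨i, h⟩).isLt; omega
    · omega
  · simp only [Network.indexInput, cells]
    split_ifs with h
    · have := (N.dst ⟨i, h⟩).isLt; omega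
    · omega
  · simp [Network.indexInput]

theorem Network.holds_of_idx {n m : ℕ} {N : Network n m} {σ : State}
    (h : σ.idx = N.indexInput) : σ.Holds N where
  nodes := by rw [h]; rfl
  edges := by rw [h]; rfl
  s := by rw [h]; rfl
  t := by rw [h]; rfl
  src e := by rw [h]; exact cells_apply (fun e => (N.src e : ℕ)) e
  dst e := by rw [h]; exact cells_apply (fun e => (N.dst e : ℕ)) e

theorem Network.start_within {n m : ℕ} (N : Network n m) (d : Fin m → ℚ) {w ℓ : ℕ}
    (hw : n + m ≤ w) (hℓ : lengthsSize n d ≤ ℓ) : (N.start d).Within w ℓ := by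
  have h2 : 2 ≤ ℓ := by
    have := N.two_le
    unfold lengthsSize at hℓ
    omega
  refine ⟨fun a i => (N.indexInput_le a i).trans hw, fun a i => ?_⟩
  by_cases ha : a = 1
  · subst ha
    simp only [Network.start, cells]
    split_ifs with h
    · exact (bits_le_lengthsSize n d _).trans hℓ
    · rwa [bits_zero]
  · have : (N.start d).num a = fun _ => 0 := by
      simp only [Network.start]
    rw [this, bits_zero]
    exact h2

theorem BitBound.nodup_sum {m b B : ℕ} {d : Fin m → ℚ} (hd : ∀ e, BitBound b (d e)) (hm : m ≤ B)
    (hb : b ≤ B) {p : List (Fin m)} (hp : p.Nodup) :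
    BitBound (B * (B + 1)) (p.map d).sum := by
  have hl : p.length ≤ m := by simpa using hp.length_le_card
  exact (BitBound.list_sum fun e _ => hd e).mono (Nat.mul_le_mul (hl.trans hm) (by omega))

theorem hasMinimizingOracle : HasMinimizingOracle := by
  refine ⟨oracleProgram, 1500, 4 * .X + 2, 2 * (.X * (.X + 1) + 1) + 3, fun n m N d hd => ?_⟩
  have hm : m ≤ lengthsSize n d := by unfold lengthsSize; omega
  have hsum : ∀ p : List (Fin m), p.Nodup →
      BitBound (lengthsSize n d * (lengthsSize n d + 1)) (p.map d).sum := fun p hp =>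
    BitBound.nodup_sum (fun e => (BitBound.of_bits (d e)).mono (bits_le_lengthsSize n d e)) hm
      le_rfl hp
  simp only [Polynomial.eval_add, Polynomial.eval_mul, Polynomial.eval_ofNat, Polynomial.eval_X,
    Polynomial.eval_one]
  set L := lengthsSize n d
  have hone : BitBound 0 (1 : ℚ) := by simpa using BitBound.natCast (b := 0) (k := 1) (by simp)
  have key := wp_oracleProgram (w := 4 * (n + m) + 2) (ℓ := 2 * (L * (L + 1) + 1) + 3)
    (σ := N.start d) (c := oracleCost n m) (N := N) hd
    (Q := fun τ _ => ((∃ q, N.IsPath q) → ∃ p, N.IsPath p ∧ (∀ e, τ.output m e = unitFlow p e) ∧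
          ∀ q, N.IsPath q → ∑ e, d e * unitFlow p e ≤ ∑ e, d e * unitFlow q e))
    (by omega) (fun p hp => (hsum p hp).bits_le.trans (by omega))
    (fun p hp => (hone.add (hsum p hp)).bits_le.trans (by omega))
    (Network.holds_of_idx rfl) (fun e => cells_apply d e) le_rfl
    (fun τ c' p _ _ h3 hp _ _ hex => by
      obtain ⟨h1, h2⟩ := hp hex
      refine ⟨p, h1, h3, fun q hq => ?_⟩
      rw [sum_mul_unitFlow h1.edges_nodup, sum_mul_unitFlow hq.edges_nodup]
      exact h2 q hq)
  obtain ⟨τ, T, h1, h2, -, h3⟩ := key.exec (N.start_within d (by omega) (by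
    have : L ≤ L * (L + 1) := Nat.le_mul_of_pos_right _ (by omega)
    change L ≤ _
    omega))
  exact ⟨τ, T, h1, le_trans (by exact_mod_cast h2) (oracleCost_le N), h3⟩

/-! ## Decomposition of flows into paths -/

namespace Network

variable {n m : ℕ} {N : Network n m}

theorem inflow_eq_sum (N : Network n m) (x : Fin m → ℝ) (v : Fin n) :
    N.inflow x v = ∑ e, (if N.dst e = v then 1 else 0) * x e := by
  simp [inflow, Finset.sum_filter]

theorem outflow_eq_sum (N : Network n m) (x : Fin m → ℝ) (v : Fin n) :
    N.outflow x v = ∑ e, (if N.src e = v then 1 else 0) * x e := by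
  simp [outflow, Finset.sum_filter]

theorem sum_inflow (N : Network n m) (x : Fin m → ℝ) (S : Finset (Fin n)) :
    ∑ v ∈ S, N.inflow x v = ∑ e with N.dst e ∈ S, x e := by
  rw [← Finset.sum_fiberwise_of_maps_to (t := S) (g := N.dst) (by simp)]
  refine Finset.sum_congr rfl fun v hv => ?_
  rw [inflow, Finset.filter_filter]
  refine Finset.sum_congr (Finset.filter_congr fun e _ => ?_) fun _ _ => rfl
  exact ⟨fun h => ⟨h ▸ hv, h⟩, fun h => h.2⟩

theorem sum_outflow (N : Network n m) (x : Fin m → ℝ) (S : Finset (Fin n)) :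
    ∑ v ∈ S, N.outflow x v = ∑ e with N.src e ∈ S, x e := by
  rw [← Finset.sum_fiberwise_of_maps_to (t := S) (g := N.src) (by simp)]
  refine Finset.sum_congr rfl fun v hv => ?_
  rw [outflow, Finset.filter_filter]
  refine Finset.sum_congr (Finset.filter_congr fun e _ => ?_) fun _ _ => rfl
  exact ⟨fun h => ⟨h ▸ hv, h⟩, fun h => h.2⟩

/-- The net inflow of a set of nodes that contains `t` but not `s` is the flow value. -/
theorem IsFlow.sum_balance {x : Fin m → ℝ} (hx : N.IsFlow x) {S : Finset (Fin n)} (ht : N.t ∈ S)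
    (hs : N.s ∉ S) : ∑ v ∈ S, N.inflow x v - ∑ v ∈ S, N.outflow x v = N.value x := by
  rw [← Finset.sum_sub_distrib]
  refine Finset.sum_eq_single_of_mem _ ht fun v hv hvt => ?_
  rw [hx.2 v (fun h => hs (h ▸ hv)) hvt, sub_self]

/-- Conservation at `t` is the assumption; at `s` it follows because total inflow and total outflow
over all nodes agree. -/
theorem IsFlow.conserved {x : Fin m → ℝ} (hx : N.IsFlow x) (h0 : N.value x = 0) (v : Fin n) :
    N.inflow x v = N.outflow x v := by
  by_cases hs : v = N.s
  · have h1 := hx.sum_balance (S := Finset.univ.erase N.s) (by simp [N.s_ne_t.symm]) (by simp)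
    have h2 : ∑ v, N.inflow x v = ∑ v, N.outflow x v := by
      rw [sum_inflow, sum_outflow]; simp
    rw [← Finset.add_sum_erase _ _ (Finset.mem_univ N.s),
      ← Finset.add_sum_erase _ (N.outflow x) (Finset.mem_univ N.s)] at h2
    rw [hs]
    linarith
  · by_cases ht : v = N.t
    · rw [ht]; unfold value at h0; linarith
    · exact hx.2 v hs ht

/-- Arrivals and departures along a walk cancel except at its ends. -/
theorem IsWalk.balance {p : List (Fin m)} {u w : Fin n} (h : N.IsWalk u p w) (v : Fin n) :
    (p.map fun e => if N.dst e = v then (1 : ℝ) else 0).sum + (if u = v then 1 else 0) =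
      (p.map fun e => if N.src e = v then (1 : ℝ) else 0).sum + if w = v then 1 else 0 := by
  induction p generalizing u with
  | nil => obtain rfl : u = w := h; simp
  | cons e p ih =>
    have := ih h.2
    obtain rfl := h.1
    simp only [List.map_cons, List.sum_cons]
    linarith

theorem IsPath.balance {p : List (Fin m)} (h : N.IsPath p) (v : Fin n) :
    N.inflow (unitFlow p) v + (if N.s = v then 1 else 0) =
      N.outflow (unitFlow p) v + if N.t = v then 1 else 0 := by
  rw [inflow_eq_sum, outflow_eq_sum, sum_mul_unitFlow h.edges_nodup, sum_mul_unitFlow h.edges_nodup]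
  exact h.1.balance v

theorem inflow_add_mul (N : Network n m) (x y : Fin m → ℝ) (a : ℝ) (v : Fin n) :
    N.inflow (fun e => x e + a * y e) v = N.inflow x v + a * N.inflow y v := by
  simp only [inflow, Finset.sum_add_distrib, Finset.mul_sum]

theorem outflow_add_mul (N : Network n m) (x y : Fin m → ℝ) (a : ℝ) (v : Fin n) :
    N.outflow (fun e => x e + a * y e) v = N.outflow x v + a * N.outflow y v := by
  simp only [outflow, Finset.sum_add_distrib, Finset.mul_sum]

theorem value_add_mul_unitFlow (x : Fin m → ℝ) (a : ℝ) {p : List (Fin m)} (hp : N.IsPath p) :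
    N.value (fun e => x e + a * unitFlow p e) = N.value x + a := by
  have h := hp.balance N.t
  rw [if_neg N.s_ne_t, if_pos rfl] at h
  rw [value, value, inflow_add_mul, outflow_add_mul]
  linear_combination a * h

theorem IsFlow.add_mul_unitFlow {x : Fin m → ℝ} (hx : N.IsFlow x) {a : ℝ} {p : List (Fin m)}
    (hp : N.IsPath p) (h0 : ∀ e, 0 ≤ x e + a * unitFlow p e) :
    N.IsFlow fun e => x e + a * unitFlow p e := by
  refine ⟨h0, fun v hs ht => ?_⟩
  have h := hp.balance v
  rw [if_neg (Ne.symm hs), if_neg (Ne.symm ht)] at h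
  rw [inflow_add_mul, outflow_add_mul, hx.2 v hs ht]
  linear_combination a * h

theorem IsWalk.exists_prefix {p : List (Fin m)} {u v w : Fin n} (h : N.IsWalk u p v)
    (hw : w ∈ u :: p.map N.dst) : ∃ q, q <+: p ∧ N.IsWalk u q w := by
  induction p generalizing u with
  | nil =>
    simp only [List.map_nil, List.mem_singleton] at hw
    exact ⟨[], List.prefix_rfl, hw.symm⟩
  | cons e p ih =>
    rcases List.mem_cons.1 hw with rfl | hw
    · exact ⟨[], List.nil_prefix, rfl⟩
    · obtain ⟨q, hq, hqw⟩ := ih h.2 hw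
      exact ⟨e :: q, List.cons_prefix_cons.2 ⟨rfl, hq⟩, h.1, hqw⟩

/-- Cut argument: let `S` be the set of nodes that no simple walk of positive flow reaches from `s`.
No flow enters `S`, for such an edge would extend a walk; so the net inflow of `S`, which is the
value if `t` lies in `S`, would not be positive. -/
theorem IsFlow.exists_path {x : Fin m → ℝ} (hx : N.IsFlow x) (hv : 0 < N.value x) :
    ∃ p, N.IsPath p ∧ ∀ e ∈ p, 0 < x e := by
  classical
  by_contra hno
  let S : Finset (Fin n) := Finset.univ.filter fun v =>
    ¬ ∃ p, N.IsWalk N.s p v ∧ (N.s :: p.map N.dst).Nodup ∧ ∀ e ∈ p, 0 < x e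
  have ht : N.t ∈ S := by
    simp only [S, Finset.mem_filter, Finset.mem_univ, true_and]
    rintro ⟨p, h1, h2, h3⟩
    exact hno ⟨p, ⟨h1, h2⟩, h3⟩
  have hs : N.s ∉ S := by
    simp only [S, Finset.mem_filter, Finset.mem_univ, true_and, not_not]
    exact ⟨[], rfl, by simp, by simp⟩
  have h := hx.sum_balance ht hs
  have hle : ∑ v ∈ S, N.inflow x v ≤ ∑ v ∈ S, N.outflow x v := by
    rw [sum_inflow, sum_outflow, Finset.sum_filter, Finset.sum_filter]
    refine Finset.sum_le_sum fun e _ => ?_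
    by_cases hd : N.dst e ∈ S
    · rcases (hx.1 e).eq_or_lt with h0 | h0
      · simp [← h0]
      · rw [if_pos hd, if_pos]
        simp only [S, Finset.mem_filter, Finset.mem_univ, true_and] at hd ⊢
        rintro ⟨p, h1, h2, h3⟩
        -- If the walk already visits the head, its prefix up to there is a simple walk; otherwise
        -- append the edge.
        by_cases hmem : N.dst e ∈ N.s :: p.map N.dst
        · obtain ⟨q, hq, hqw⟩ := h1.exists_prefix hmem
          exact hd ⟨q, hqw, h2.sublist ((hq.sublist.map N.dst).cons_cons _),
            fun f hf => h3 f (hq.subset hf)⟩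
        · refine hd ⟨p ++ [e], IsWalk.append N h1 ⟨rfl, rfl⟩, ?_, ?_⟩
          · rw [List.map_append, ← List.cons_append]
            exact List.nodup_append.2 ⟨h2, by simp, by
              rintro a ha b hb rfl
              simp only [List.map_cons, List.map_nil, List.mem_singleton] at hb
              exact hmem (hb ▸ ha)⟩
          · intro f hf
            rcases List.mem_append.1 hf with hf | hf
            · exact h3 f hf
            · rw [List.mem_singleton.1 hf]; exact h0
    · rw [if_neg hd]
      split_ifs
      exacts [hx.1 e, le_rfl]
  linarith

theorem IsPath.ne_nil {p : List (Fin m)} (h : N.IsPath p) : p ≠ [] := by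
  rintro rfl
  exact N.s_ne_t h.1

/-- Induction on the size of the support. The amount is also capped by the value, so that the
remaining value stays non-negative; if that cap is attained the remainder is a circulation and the
induction ends, otherwise an edge of minimal flow on the path drops out of the support. -/
theorem IsFlow.exists_decomposition {x : Fin m → ℝ} (hx : N.IsFlow x) (hv : 0 ≤ N.value x) :
    ∃ (L : List (List (Fin m) × ℝ)) (z : Fin m → ℝ),
      L.length ≤ (Finset.univ.filter fun e => x e ≠ 0).card ∧
      (∀ q ∈ L, N.IsPath q.1 ∧ 0 ≤ q.2) ∧ (∀ e, 0 ≤ z e) ∧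
      (∀ v, N.inflow z v = N.outflow z v) ∧
      (∀ e, x e = (L.map fun q => q.2 * unitFlow q.1 e).sum + z e) ∧
      N.value x = (L.map Prod.snd).sum := by
  induction hK : (Finset.univ.filter fun e => x e ≠ 0).card using Nat.strong_induction_on
    generalizing x with
  | _ K ih =>
    rcases hv.eq_or_lt with h0 | h0
    · exact ⟨[], x, by simp, by simp, hx.1, hx.conserved h0.symm, by simp, by simp [← h0]⟩
    obtain ⟨p, hp, hpos⟩ := hx.exists_path h0
    obtain ⟨f, hf, hmin⟩ := Finset.exists_min_image p.toFinset x
      (by simpa using hp.ne_nil)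
    simp only [List.mem_toFinset] at hf hmin
    obtain ⟨a, ha⟩ : ∃ a, a = min (x f) (N.value x) := ⟨_, rfl⟩
    have ha0 : 0 < a := by rw [ha]; exact lt_min (hpos f hf) h0
    have hax : ∀ e ∈ p, a ≤ x e := fun e he => by
      rw [ha]; exact (min_le_left _ _).trans (hmin e he)
    have hnn : ∀ e, 0 ≤ x e + -a * unitFlow p e := by
      intro e
      by_cases he : e ∈ p
      · have := hax e he
        simp only [unitFlow, he, if_true]; linarith
      · simpa [unitFlow, he] using hx.1 e
    have hx' := hx.add_mul_unitFlow hp hnn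
    have hv' := value_add_mul_unitFlow x (-a) hp
    set y : Fin m → ℝ := fun e => x e + -a * unitFlow p e with hy
    have hxy : ∀ e, x e = a * unitFlow p e + y e := fun e => by simp only [hy]; ring
    by_cases hav : a = N.value x
    · refine ⟨[(p, a)], y, ?_, ?_, hx'.1, hx'.conserved (by rw [hv', hav]; ring), ?_, by simp [hav]⟩
      · rw [← hK]
        exact Finset.card_pos.2 ⟨f, by simpa using (hpos f hf).ne'⟩
      · simpa using ⟨hp, ha0.le⟩
      · simpa using hxy
    · have haf : a = x f := by
        rcases min_choice (x f) (N.value x) with h | h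
        · rw [ha, h]
        · exact absurd (ha.trans h) hav
      have hsub : (Finset.univ.filter fun e => y e ≠ 0) ⊂ Finset.univ.filter fun e => x e ≠ 0 := by
        refine Finset.ssubset_iff_of_subset (fun e he => ?_) |>.2 ⟨f, ?_, ?_⟩
        · simp only [Finset.mem_filter, Finset.mem_univ, true_and] at he ⊢
          intro h
          by_cases hep : e ∈ p
          · exact (hpos e hep).ne' h
          · exact he (by simp [hy, h, unitFlow, hep])
        · simpa using (hpos f hf).ne'
        · simp [hy, unitFlow, hf, haf]
      have hle : 0 ≤ N.value y := by
        rw [hv']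
        have : a ≤ N.value x := by rw [ha]; exact min_le_right _ _
        linarith
      obtain ⟨L, z, h1, h2, h3, h4, h5, h6⟩ := ih _ (hK ▸ Finset.card_lt_card hsub) hx' hle rfl
      refine ⟨(p, a) :: L, z, ?_, ?_, h3, h4, fun e => ?_, ?_⟩
      · rw [List.length_cons, ← hK]
        exact h1.trans_lt (Finset.card_lt_card hsub)
      · rintro q hq
        rcases List.mem_cons.1 hq with rfl | hq
        · exact ⟨hp, ha0.le⟩
        · exact h2 q hq
      · rw [hxy e, h5 e]; simp [add_assoc]
      · rw [List.map_cons, List.sum_cons, ← h6, hv']; ring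

end Network

theorem flowsDecompose : FlowsDecompose := by
  intro n m k P x hx hv
  obtain ⟨L, z, h1, h2, h3, h4, h5, h6⟩ := hx.1.exists_decomposition hv
  refine ⟨L.length, fun l => (L.get l).1, fun l => (L.get l).2, z,
    h1.trans ((Finset.card_filter_le _ _).trans (by simp)), fun l => (h2 _ (L.get_mem l)).1,
    fun l => (h2 _ (L.get_mem l)).2, h3, h4, fun e => ?_, ?_⟩
  · rw [h5 e, ← List.sum_ofFn]
    congr 2
    conv_lhs => rw [← List.ofFn_get L, List.map_ofFn]
    rfl
  · rw [h6, ← List.sum_ofFn]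
    congr 1
    conv_lhs => rw [← List.ofFn_get L, List.map_ofFn]
    rfl

/-! ## Multiplicative weights for packing problems -/

/-- If every `s`-`t`-path has length at least `M`, a flow of value `v` has cost at least `M * v`. -/
theorem Network.IsFlow.mul_value_le {n m : ℕ} {N : Network n m} {x d : Fin m → ℝ} {M : ℝ}
    (hx : N.IsFlow x) (hv : 0 ≤ N.value x) (hd : ∀ e, 0 ≤ d e)
    (hM : ∀ p, N.IsPath p → M ≤ (p.map d).sum) : M * N.value x ≤ ∑ e, d e * x e := by
  obtain ⟨L, z, -, h2, h3, -, h5, h6⟩ := hx.exists_decomposition hv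
  have e1 : ∑ e, d e * x e = (L.map fun q => q.2 * (q.1.map d).sum).sum + ∑ e, d e * z e := by
    simp only [h5, mul_add, Finset.sum_add_distrib]
    congr 1
    clear h5 h6
    induction L with
    | nil => simp
    | cons q L ih =>
      simp only [List.map_cons, List.sum_cons, mul_add, Finset.sum_add_distrib]
      rw [ih fun q' hq' => h2 q' (by simp [hq'])]
      congr 1
      rw [← sum_mul_unitFlow (h2 q (by simp)).1.edges_nodup, Finset.mul_sum]
      exact Finset.sum_congr rfl fun e _ => by ring
  have e2 : M * N.value x ≤ (L.map fun q => q.2 * (q.1.map d).sum).sum := by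
    rw [h6]
    clear h5 h6 e1
    induction L with
    | nil => simp
    | cons q L ih =>
      simp only [List.map_cons, List.sum_cons, mul_add]
      have h := h2 q (by simp)
      have := mul_le_mul_of_nonneg_left (hM q.1 h.1) h.2
      have := ih fun q' hq' => h2 q' (by simp [hq'])
      linarith
  have e3 : 0 ≤ ∑ e, d e * z e := Finset.sum_nonneg fun e _ => mul_nonneg (hd e) (h3 e)
  linarith

/-! ### The packing formulation: capacities and budgets as rows, paths as columns. -/

namespace Problem

variable {n m k : ℕ} (P : Problem n m k)

/-- Coefficients of the packing constraints: row `i < m` is the capacity constraint of the edge `i`,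
row `m + j` is the budget constraint `j`. -/
def row (i : ℕ) (e : Fin m) : ℕ :=
  if i < m then if i = e then 1 else 0 else if h : i - m < k then P.cost ⟨i - m, h⟩ e else 0

/-- Right-hand sides of the packing constraints. -/
def bound (i : ℕ) : ℕ :=
  if h : i < m then P.cap ⟨i, h⟩ else if h : i - m < k then P.budget ⟨i - m, h⟩ else 0

/-- The length of an edge for weights `y` of the packing constraints. -/
def rowLength {K : Type*} [Field K] (y : ℕ → K) (e : Fin m) : K :=
  ∑ i ∈ Finset.range (m + k), y i * P.row i e / P.bound i

/-- The left-hand side of the packing constraint `i` for a path. -/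
def load (p : List (Fin m)) (i : ℕ) : ℕ := (p.map (P.row i)).sum

/-- An edge that can carry a positive amount of flow. -/
def Usable (e : Fin m) : Prop := ∀ i < m + k, P.row i e ≠ 0 → P.bound i ≠ 0

open Classical in
/-- Lengths that exclude unusable edges from shortest paths as long as there is another path. -/
noncomputable def guardedLength (y : ℕ → ℚ) (e : Fin m) : ℚ :=
  if P.Usable e then P.rowLength y e else 1 + ∑ f, P.rowLength y f

variable {P}

theorem row_edge (e f : Fin m) : P.row e f = if e = f then 1 else 0 := by
  simp [row, Fin.val_inj]

theorem row_budget (j : Fin k) (e : Fin m) : P.row (m + j) e = P.cost j e := by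
  simp [row]

theorem bound_edge (e : Fin m) : P.bound e = P.cap e := by simp [bound]

theorem bound_budget (j : Fin k) : P.bound (m + j) = P.budget j := by simp [bound]

theorem row_cases {i : ℕ} (hi : i < m + k) : (∃ e : Fin m, i = e) ∨ ∃ j : Fin k, i = m + j := by
  by_cases h : i < m
  · exact .inl ⟨⟨i, h⟩, rfl⟩
  · exact .inr ⟨⟨i - m, by omega⟩, by simp; omega⟩

theorem load_edge {p : List (Fin m)} (hp : p.Nodup) (e : Fin m) :
    P.load p e = unitFlow p e := by
  rw [load, ← sum_mul_unitFlow hp]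
  simp [row_edge]

theorem feasible_iff {x : Fin m → ℝ} : P.Feasible x ↔
    P.IsFlow x ∧ ∀ i < m + k, ∑ e, (P.row i e : ℝ) * x e ≤ P.bound i := by
  refine and_congr_right fun _ => ⟨fun h i hi => ?_, fun h => ⟨fun e => ?_, fun j => ?_⟩⟩
  · rcases row_cases hi with ⟨e, rfl⟩ | ⟨j, rfl⟩
    · simpa [row_edge, bound_edge] using h.1 e
    · simpa only [row_budget, bound_budget] using h.2 j
  · simpa [row_edge, bound_edge] using h e (by omega)
  · simpa only [row_budget, bound_budget] using h (m + j) (by omega)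

theorem rowLength_nonneg {K : Type*} [Field K] [LinearOrder K] [IsStrictOrderedRing K] {y : ℕ → K}
    (hy : ∀ i < m + k, 0 ≤ y i) (e : Fin m) : 0 ≤ P.rowLength y e :=
  Finset.sum_nonneg fun i hi =>
    div_nonneg (mul_nonneg (hy i (Finset.mem_range.1 hi)) (Nat.cast_nonneg _)) (Nat.cast_nonneg _)

theorem guardedLength_nonneg {y : ℕ → ℚ} (hy : ∀ i < m + k, 0 ≤ y i) (e : Fin m) :
    0 ≤ P.guardedLength y e := by
  unfold guardedLength
  have := Finset.sum_nonneg fun f (_ : f ∈ Finset.univ) => rowLength_nonneg (P := P) hy f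
  split_ifs
  · exact rowLength_nonneg hy e
  · linarith

theorem sum_rowLength (y : ℕ → ℚ) (p : List (Fin m)) :
    (p.map (P.rowLength y)).sum = ∑ i ∈ Finset.range (m + k), y i * P.load p i / P.bound i := by
  induction p with
  | nil => simp [load]
  | cons e p ih =>
    rw [List.map_cons, List.sum_cons, ih, rowLength, ← Finset.sum_add_distrib]
    refine Finset.sum_congr rfl fun i _ => ?_
    simp only [load, List.map_cons, List.sum_cons]
    push_cast
    ring

/-- An unusable edge has a positive coefficient in a row with right-hand side zero, which forces
zero flow. In such a row the division by zero in `rowLength` would make the edge look too short,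
hence the guard. -/
theorem Feasible.usable {x : Fin m → ℝ} (hx : P.Feasible x) {e : Fin m} (he : 0 < x e) :
    P.Usable e := by
  intro i hi hr hb
  have h := (feasible_iff.1 hx).2 i hi
  rw [hb, Nat.cast_zero] at h
  have h1 : (P.row i e : ℝ) * x e ≤ ∑ e, (P.row i e : ℝ) * x e :=
    Finset.single_le_sum (f := fun e => (P.row i e : ℝ) * x e)
      (fun e _ => mul_nonneg (Nat.cast_nonneg _) (hx.1.1 e)) (Finset.mem_univ e)
  have h2 : (0 : ℝ) < P.row i e := by exact_mod_cast Nat.pos_of_ne_zero hr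
  have := mul_pos h2 he
  linarith

/-- Weak duality: exchange the sums and use each row divided by its right-hand side. -/
theorem Feasible.sum_rowLength_le {x : Fin m → ℝ} (hx : P.Feasible x) {y : ℕ → ℚ}
    (hy : ∀ i < m + k, 0 ≤ y i) :
    ∑ e, ((P.rowLength y e : ℚ) : ℝ) * x e ≤ ∑ i ∈ Finset.range (m + k), (y i : ℝ) := by
  have h : ∑ e, ((P.rowLength y e : ℚ) : ℝ) * x e =
      ∑ i ∈ Finset.range (m + k), (y i : ℝ) * ((∑ e, (P.row i e : ℝ) * x e) / P.bound i) := by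
    simp only [rowLength, Rat.cast_sum, Finset.sum_mul, Finset.mul_sum, Finset.sum_div]
    rw [Finset.sum_comm]
    refine Finset.sum_congr rfl fun i _ => Finset.sum_congr rfl fun e _ => ?_
    push_cast
    ring
  rw [h]
  refine Finset.sum_le_sum fun i hi => ?_
  rw [Finset.mem_range] at hi
  refine mul_le_of_le_one_right (by exact_mod_cast hy i hi) ?_
  exact div_le_one_of_le₀ ((feasible_iff.1 hx).2 i hi) (Nat.cast_nonneg _)

/-- A path that is shortest for the guarded lengths is usable if there is a feasible flow of
positive value, and its length times the flow value is at most the total weight. -/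
theorem Feasible.shortest {x : Fin m → ℝ} (hx : P.Feasible x) (hv : 0 < P.value x) {y : ℕ → ℚ}
    (hy : ∀ i < m + k, 0 ≤ y i) {p : List (Fin m)}
    (hmin : ∀ q, P.IsPath q → (p.map (P.guardedLength y)).sum ≤ (q.map (P.guardedLength y)).sum) :
    (∀ e ∈ p, P.Usable e) ∧
      ((p.map (P.rowLength y)).sum : ℚ) * P.value x ≤ ∑ i ∈ Finset.range (m + k), (y i : ℝ) := by
  obtain ⟨q, hq, hqpos⟩ := hx.1.exists_path hv
  have hg : ∀ q : List (Fin m), (∀ e ∈ q, P.Usable e) →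
      (q.map (P.guardedLength y)).sum = (q.map (P.rowLength y)).sum := fun q hq => by
    congr 1
    exact List.map_congr_left fun e he => by rw [guardedLength, if_pos (hq e he)]
  -- The support of `x` contains a path of usable edges, whose length is at most the sum of all
  -- lengths; an unusable edge alone is longer than that.
  have hp : ∀ e ∈ p, P.Usable e := by
    by_contra! hex
    obtain ⟨e, he, heu⟩ := hex
    have h1 := hmin q hq
    rw [hg q fun e he => hx.usable (hqpos e he), ← List.sum_toFinset _ hq.edges_nodup] at h1
    have h2 : ∑ e ∈ q.toFinset, P.rowLength y e ≤ ∑ e, P.rowLength y e :=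
      Finset.sum_le_sum_of_subset_of_nonneg (Finset.subset_univ _) fun e _ _ =>
        rowLength_nonneg hy e
    have h3 : P.guardedLength y e ≤ (p.map (P.guardedLength y)).sum :=
      List.single_le_sum (by
        simp only [List.mem_map, forall_exists_index, and_imp, forall_apply_eq_imp_iff₂]
        exact fun f _ => guardedLength_nonneg hy f) _ (List.mem_map_of_mem he)
    rw [guardedLength, if_neg heu] at h3
    linarith
  refine ⟨hp, ?_⟩
  rw [← hg p hp]
  have h := hx.1.mul_value_le hv.le (d := fun e => (P.guardedLength y e : ℝ))
    (M := ((p.map (P.guardedLength y)).sum : ℚ))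
    (fun e => by exact_mod_cast guardedLength_nonneg hy e) (fun q hq => by
      have := hmin q hq
      have e1 : (q.map fun e => (P.guardedLength y e : ℝ)).sum =
          ((q.map (P.guardedLength y)).sum : ℚ) := by
        rw [Rat.cast_list_sum, List.map_map]; rfl
      rw [e1]
      exact_mod_cast this)
  refine (h.trans (le_of_eq ?_)).trans (hx.sum_rowLength_le hy)
  refine Finset.sum_congr rfl fun e _ => ?_
  rcases (hx.1.1 e).eq_or_lt with h0 | h0
  · rw [← h0, mul_zero, mul_zero]
  · rw [guardedLength, if_pos (hx.usable h0)]

/-- The invariant of the multiplicative weights algorithm after `t` iterations: `y` are the weights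
and `c` the congestions of the packing constraints. -/
structure Progress (P : Problem n m k) (ε : ℚ) (t : ℕ) (y c : ℕ → ℚ) (X : ℚ) : Prop where
  nonneg : ∀ i < m + k, 0 ≤ c i
  weight : ∀ i < m + k, (1 + ε : ℝ) ^ (c i : ℝ) ≤ y i
  flow : P.IsFlow fun e => (P.bound e * c e : ℚ)
  value : P.value (fun e => ((P.bound e * c e : ℚ) : ℝ)) = X
  value_nonneg : 0 ≤ X
  rows : ∀ i < m + k, ∑ e : Fin m, (P.row i e : ℚ) * (P.bound e * c e) = P.bound i * c i
  total : ∀ f, P.Feasible f → 0 < P.value f →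
    (∑ i ∈ Finset.range (m + k), (y i : ℝ)) ≤ (m + k) * Real.exp (ε * X / P.value f) ∧
      (t : ℚ) ≤ ∑ i ∈ Finset.range (m + k), c i

theorem Progress.init {ε : ℚ} : P.Progress ε 0 (fun _ => 1) (fun _ => 0) 0 where
  nonneg := by simp
  weight := by simp
  flow := by
    refine ⟨by simp, fun v _ _ => ?_⟩
    simp [Network.inflow, Network.outflow]
  value := by simp [Network.value, Network.inflow, Network.outflow]
  value_nonneg := le_rfl
  rows := by simp
  total := by simp

theorem Progress.weight_pos {ε : ℚ} {t : ℕ} {y c : ℕ → ℚ} {X : ℚ} (h : P.Progress ε t y c X)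
    (hε : 0 < ε) {i : ℕ} (hi : i < m + k) : 0 < y i := by
  have h1 : (0 : ℝ) < ε := by exact_mod_cast hε
  have h2 := Real.rpow_pos_of_pos (show (0 : ℝ) < 1 + ε by linarith) (c i)
  exact_mod_cast h2.trans_le (h.weight i hi)

/-- The congestion of row `e` times the capacity of `e` is the flow on `e`, so no separate flow has
to be kept. The number `T` is only the starting value of the minimum that defines the step size `a`.
Without a path `p` is empty and nothing changes. -/
theorem Progress.step {ε : ℚ} (hε : 0 < ε) {t : ℕ} {y c : ℕ → ℚ} {X : ℚ}
    (h : P.Progress ε t y c X) {p : List (Fin m)} {a T : ℚ} (hT : ∀ e, (P.cap e : ℚ) ≤ T)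
    (hmin : (∃ q, P.IsPath q) → P.IsPath p ∧ ∀ q, P.IsPath q →
      (p.map (P.guardedLength y)).sum ≤ (q.map (P.guardedLength y)).sum)
    (hno : (¬ ∃ q, P.IsPath q) → p = []) (ha0 : 0 ≤ a)
    (ha : ∀ i < m + k, P.load p i ≠ 0 → a ≤ P.bound i / P.load p i)
    (ha' : a = T ∨ ∃ i < m + k, P.load p i ≠ 0 ∧ a = P.bound i / P.load p i) :
    ∃ X', P.Progress ε (t + 1) (fun i => y i * (1 + ε * (a * P.load p i / P.bound i)))
      (fun i => c i + a * P.load p i / P.bound i) X' := by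
  have hle : ∀ i < m + k, a * P.load p i ≤ P.bound i := by
    intro i hi
    by_cases h0 : P.load p i = 0
    · simp [h0]
    · have : (0 : ℚ) < P.load p i := by exact_mod_cast Nat.pos_of_ne_zero h0
      exact (le_div_iff₀ this).1 (ha i hi h0)
  have hinc0 : ∀ i, 0 ≤ a * P.load p i / P.bound i := fun i =>
    div_nonneg (mul_nonneg ha0 (Nat.cast_nonneg _)) (Nat.cast_nonneg _)
  have hinc1 : ∀ i < m + k, a * P.load p i / P.bound i ≤ 1 := fun i hi =>
    div_le_one_of_le₀ (hle i hi) (Nat.cast_nonneg _)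
  have hmul : ∀ i < m + k, (P.bound i : ℚ) * (a * P.load p i / P.bound i) = a * P.load p i := by
    intro i hi
    -- For a zero right-hand side the step size forces `a * load = 0`, so the junk value of the
    -- quotient is harmless.
    by_cases h0 : P.bound i = 0
    · have h1 := hle i hi
      rw [h0, Nat.cast_zero] at h1
      have := mul_nonneg ha0 (Nat.cast_nonneg (α := ℚ) (P.load p i))
      simp [h0]
      have h2 : a * P.load p i = 0 := le_antisymm h1 this
      simpa using h2
    · have : (P.bound i : ℚ) ≠ 0 := by exact_mod_cast h0
      field_simp
  have hp : P.IsPath p ∨ p = [] ∧ ¬ ∃ q, P.IsPath q := by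
    by_cases hex : ∃ q, P.IsPath q
    · exact .inl (hmin hex).1
    · exact .inr ⟨hno hex, hex⟩
  have hnd : p.Nodup := by
    rcases hp with hp | ⟨rfl, -⟩
    · exact hp.edges_nodup
    · exact List.nodup_nil
  have hedge : ∀ e : Fin m, (P.bound e : ℚ) * (c e + a * P.load p e / P.bound e) =
      P.bound e * c e + a * unitFlow p e := by
    intro e
    rw [mul_add, hmul e (by omega), load_edge hnd]
    simp [unitFlow]
  have hedge' : (fun e : Fin m => ((P.bound e * (c e + a * P.load p e / P.bound e) : ℚ) : ℝ)) =
      fun e : Fin m => ((P.bound e * c e : ℚ) : ℝ) + (a : ℝ) * unitFlow p e := by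
    funext e
    rw [hedge e]
    simp only [unitFlow]
    split_ifs <;> simp
  have ha0' : (0 : ℝ) ≤ a := by exact_mod_cast ha0
  have hnn : ∀ e : Fin m, 0 ≤ ((P.bound e * c e : ℚ) : ℝ) + (a : ℝ) * unitFlow p e := fun e =>
    add_nonneg (h.flow.1 e) (mul_nonneg ha0' (by unfold unitFlow; split_ifs <;> norm_num))
  have hε' : (0 : ℝ) < ε := by exact_mod_cast hε
  refine ⟨X + if p = [] then 0 else a, ?_, ?_, ?_, ?_, ?_, ?_, ?_⟩
  · exact fun i hi => add_nonneg (h.nonneg i hi) (hinc0 i)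
  · intro i hi
    have h0 : (0 : ℝ) ≤ ((a * P.load p i / P.bound i : ℚ) : ℝ) := by exact_mod_cast hinc0 i
    have h1 : ((a * P.load p i / P.bound i : ℚ) : ℝ) ≤ 1 := by exact_mod_cast hinc1 i hi
    rw [Rat.cast_add, Real.rpow_add (by linarith), Rat.cast_mul]
    refine mul_le_mul (h.weight i hi) ?_ (Real.rpow_nonneg (by linarith) _)
      (by exact_mod_cast (h.weight_pos hε hi).le)
    -- Bernoulli's inequality for exponents in `[0, 1]`; this is where the step size must not exceed
    -- any right-hand side.
    have := rpow_one_add_le_one_add_mul_self (s := (ε : ℝ)) (by linarith) h0 h1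
    refine this.trans (le_of_eq ?_)
    push_cast
    ring
  · rw [hedge']
    rcases hp with hp | ⟨rfl, -⟩
    · exact h.flow.add_mul_unitFlow hp hnn
    · simpa [unitFlow] using h.flow
  · rw [hedge']
    rcases hp with hp | ⟨rfl, -⟩
    · rw [Network.value_add_mul_unitFlow _ _ hp, h.value, if_neg hp.ne_nil, Rat.cast_add]
    · simpa [unitFlow] using h.value
  · have := h.value_nonneg
    split_ifs <;> linarith
  · intro i hi
    simp only [hedge, mul_add, Finset.sum_add_distrib]
    rw [h.rows i hi, hmul i hi, load, ← sum_mul_unitFlow hnd]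
    push_cast
    rw [Finset.mul_sum]
    congr 1
    refine Finset.sum_congr rfl fun e _ => ?_
    simp only [unitFlow, Nat.cast_ite, Nat.cast_one, Nat.cast_zero]
    ring
  · intro f hf hv
    obtain ⟨q, hq, -⟩ := hf.1.exists_path hv
    obtain ⟨hp, hmin⟩ := hmin ⟨q, hq⟩
    obtain ⟨hus, hlen⟩ := hf.shortest hv (fun i hi => (h.weight_pos hε hi).le) hmin
    obtain ⟨h1, h2⟩ := h.total f hf hv
    have hub : ∀ i < m + k, P.load p i ≠ 0 → P.bound i ≠ 0 := by
      intro i hi h0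
      obtain ⟨e, he, h'⟩ : ∃ e ∈ p, P.row i e ≠ 0 := by
        by_contra! hall
        refine h0 (List.sum_eq_zero fun x hx => ?_)
        obtain ⟨e, he, rfl⟩ := List.mem_map.1 hx
        exact hall e he
      exact hus e he i hi h'
    rw [if_neg hp.ne_nil]
    constructor
    · have e1 : ∑ i ∈ Finset.range (m + k),
          ((y i * (1 + ε * (a * P.load p i / P.bound i)) : ℚ) : ℝ) =
          (∑ i ∈ Finset.range (m + k), (y i : ℝ)) +
            ε * a * ((p.map (P.rowLength y)).sum : ℚ) := by
        rw [sum_rowLength, Rat.cast_sum, Finset.mul_sum, ← Finset.sum_add_distrib]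
        refine Finset.sum_congr rfl fun i _ => ?_
        push_cast
        ring
      rw [e1]
      set D := ∑ i ∈ Finset.range (m + k), (y i : ℝ)
      -- The shortest length is at most `D / val f`, so the total weight grows by a factor of at
      -- most `1 + ε * a / val f`, which is bounded by the exponential.
      have h3 : ((p.map (P.rowLength y)).sum : ℚ) ≤ D / P.value f := (le_div_iff₀ hv).2 hlen
      have h4 : D + ε * a * ((p.map (P.rowLength y)).sum : ℚ) ≤ D * (ε * a / P.value f + 1) := by
        have := mul_le_mul_of_nonneg_left h3 (mul_nonneg hε'.le ha0')
        have e2 : D * (ε * a / P.value f + 1) = D + ε * a * (D / P.value f) := by ring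
        linarith
      have hD : 0 ≤ D := Finset.sum_nonneg fun i hi => by
        exact_mod_cast (h.weight_pos hε (Finset.mem_range.1 hi)).le
      have h5 := mul_le_mul_of_nonneg_left (Real.add_one_le_exp (ε * a / P.value f)) hD
      have h6 := mul_le_mul_of_nonneg_right h1 (Real.exp_pos (ε * a / P.value f)).le
      refine (h4.trans h5).trans (h6.trans (le_of_eq ?_))
      rw [mul_assoc, ← Real.exp_add, Rat.cast_add]
      congr 2
      ring
    · obtain ⟨i, hi, hl, hai⟩ : ∃ i < m + k, P.load p i ≠ 0 ∧ a = P.bound i / P.load p i := by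
        -- If the initial value `T` was never lowered, `T` equals the capacity of an edge of the
        -- path, since it is at least and at most that capacity; so some row is saturated in any
        -- case.
        rcases ha' with hT' | h'
        · obtain ⟨e, he⟩ := List.exists_mem_of_ne_nil p hp.ne_nil
          have hl : P.load p e = 1 := by rw [load_edge hnd]; simp [unitFlow, he]
          refine ⟨e, by omega, by omega, le_antisymm (ha e (by omega) (by omega)) ?_⟩
          rw [hl, bound_edge, hT']
          simpa using hT e
        · exact h'
      have hone : a * P.load p i / P.bound i = 1 := by
        have hb : (P.bound i : ℚ) ≠ 0 := by exact_mod_cast hub i hi hl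
        have hl' : (P.load p i : ℚ) ≠ 0 := by exact_mod_cast hl
        rw [hai]
        field_simp
      rw [Finset.sum_add_distrib]
      have := Finset.single_le_sum (f := fun i => a * P.load p i / P.bound i)
        (fun i _ => hinc0 i) (Finset.mem_range.2 hi)
      simp only [hone] at this
      push_cast
      linarith

/-- Feasibility holds unconditionally, also for `l = 0`, where the output is zero by the convention
on division; the approximation guarantee is needed only against flows of positive value, and these
force `l` to be positive. -/
theorem Progress.isApprox {ε : ℚ} (hε : 0 < ε) (hε1 : ε < 1) {T : ℕ} {y c : ℕ → ℚ} {X : ℚ}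
    (h : P.Progress ε T y c X) {l : ℚ} (hl0 : 0 ≤ l) (hl : ∀ i < m + k, c i ≤ l)
    (hl' : l = 0 ∨ ∃ i < m + k, l = c i) (hT : 2 * (m + k) * (m + k).size / ε ^ 2 ≤ T) :
    P.IsApprox ε fun e => ((P.bound e * c e / l : ℚ) : ℝ) := by
  have hm := P.one_le_edges
  have hε' : (0 : ℝ) < ε := by exact_mod_cast hε
  have hε1' : (ε : ℝ) < 1 := by exact_mod_cast hε1
  have hl0' : (0 : ℝ) ≤ l := by exact_mod_cast hl0
  have hval : ∀ v, P.inflow (fun e => ((P.bound e * c e / l : ℚ) : ℝ)) v =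
      P.inflow (fun e => ((P.bound e * c e : ℚ) : ℝ)) v / l := fun v => by
    simp only [Network.inflow, Finset.sum_div, Rat.cast_div]
  have hval' : ∀ v, P.outflow (fun e => ((P.bound e * c e / l : ℚ) : ℝ)) v =
      P.outflow (fun e => ((P.bound e * c e : ℚ) : ℝ)) v / l := fun v => by
    simp only [Network.outflow, Finset.sum_div, Rat.cast_div]
  have hX : P.value (fun e => ((P.bound e * c e / l : ℚ) : ℝ)) = X / l := by
    rw [Network.value, hval, hval', ← sub_div, ← h.value]
    rfl
  have hX0 : (0 : ℝ) ≤ X := by exact_mod_cast h.value_nonneg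
  refine ⟨feasible_iff.2 ⟨⟨fun e => ?_, fun v hs ht => ?_⟩, fun i hi => ?_⟩, fun f hf => ?_⟩
  · have := h.flow.1 e
    simp only [Rat.cast_div]
    exact div_nonneg this hl0'
  · rw [hval, hval', h.flow.2 v hs ht]
  · have e1 : ∑ e, (P.row i e : ℝ) * ((P.bound e * c e / l : ℚ) : ℝ) =
        ((P.bound i * (c i / l) : ℚ) : ℝ) := by
      rw [← mul_div_assoc, ← h.rows i hi, Finset.sum_div, Rat.cast_sum]
      refine Finset.sum_congr rfl fun e _ => ?_
      push_cast
      ring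
    rw [e1]
    have : (P.bound i * (c i / l) : ℚ) ≤ P.bound i :=
      mul_le_of_le_one_right (Nat.cast_nonneg _) (div_le_one_of_le₀ (hl i hi) hl0)
    exact_mod_cast this
  · rw [hX]
    rcases le_or_gt (P.value f) 0 with hv | hv
    · have h1 : (1 - (ε : ℝ)) * P.value f ≤ 0 :=
        mul_nonpos_of_nonneg_of_nonpos (by linarith) hv
      exact h1.trans (div_nonneg hX0 hl0')
    obtain ⟨h1, h2⟩ := h.total f hf hv
    have hR : (0 : ℝ) < (m : ℝ) + k := by
      have : (1 : ℝ) ≤ m := by exact_mod_cast hm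
      positivity
    have hRq : (0 : ℚ) < (m : ℚ) + k := by exact_mod_cast hR
    -- The maximum congestion is at least the average, and the total is at least the number of
    -- iterations.
    have hlow : 2 * ((m + k).size : ℝ) / ε ^ 2 ≤ l := by
      have h3 : ∑ i ∈ Finset.range (m + k), c i ≤ (m + k) * l := by
        refine (Finset.sum_le_sum fun i hi => hl i (Finset.mem_range.1 hi)).trans (le_of_eq ?_)
        simp
      have h4 : (m + k : ℚ) * (2 * (m + k).size / ε ^ 2) ≤ (m + k) * l := by
        refine le_trans (le_of_eq ?_) (hT.trans (h2.trans h3))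
        ring
      exact_mod_cast le_of_mul_le_mul_left h4 hRq
    have hs : Real.log (m + k) ≤ (m + k).size := by
      have h5 : (m + k : ℝ) ≤ Real.exp (m + k).size := by
        have h6 : m + k ≤ 2 ^ (m + k).size := (Nat.lt_size_self _).le
        have h7 : (2 : ℝ) ≤ Real.exp 1 := by have := Real.add_one_le_exp (1 : ℝ); linarith
        calc (m + k : ℝ) ≤ 2 ^ (m + k).size := by exact_mod_cast h6
          _ ≤ Real.exp 1 ^ (m + k).size := pow_le_pow_left₀ (by norm_num) h7 _
          _ = Real.exp (m + k).size := by rw [← Real.exp_nat_mul, mul_one]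
      exact (Real.log_le_iff_le_exp hR).2 h5
    have hs1 : (1 : ℝ) ≤ (m + k).size := by
      exact_mod_cast Nat.size_pos.2 (show 0 < m + k by omega)
    have hlpos : (0 : ℝ) < l := lt_of_lt_of_le (by positivity) hlow
    obtain ⟨i, hi, rfl⟩ : ∃ i < m + k, l = c i := by
      rcases hl' with rfl | h'
      · simp at hlpos
      · exact h'
    have h3 : (1 + ε : ℝ) ^ (c i : ℝ) ≤ (m + k) * Real.exp (ε * X / P.value f) := by
      refine (h.weight i hi).trans (le_trans ?_ h1)
      exact Finset.single_le_sum (f := fun i => (y i : ℝ)) (fun j hj => by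
        exact_mod_cast (h.weight_pos hε (Finset.mem_range.1 hj)).le) (Finset.mem_range.2 hi)
    have h4 : (c i : ℝ) * Real.log (1 + ε) ≤ Real.log (m + k) + ε * X / P.value f := by
      rw [← Real.log_rpow (by linarith), ← Real.log_exp (ε * X / P.value f),
        ← Real.log_mul hR.ne' (Real.exp_pos _).ne']
      exact Real.log_le_log (Real.rpow_pos_of_pos (by linarith) _) h3
    have h5 := Real.le_log_one_add_of_nonneg hε'.le
    -- One half of the loss `ε` comes from this estimate of the logarithm, the other half from
    -- absorbing `log (m + k)` by `h7`.
    have h6 : (ε : ℝ) * (1 - ε / 2) ≤ Real.log (1 + ε) := by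
      refine le_trans ?_ h5
      rw [le_div_iff₀ (by linarith)]
      nlinarith [mul_pos hε' (mul_pos hε' hε')]
    have h7 : 2 * Real.log (m + k) ≤ c i * ε ^ 2 := by
      have := (div_le_iff₀ (by positivity)).1 hlow
      linarith
    rw [le_div_iff₀ hlpos]
    have h8 : (c i : ℝ) * (ε * (1 - ε / 2)) ≤ c i * Real.log (1 + ε) :=
      mul_le_mul_of_nonneg_left h6 hlpos.le
    have h9 : (ε : ℝ) * (c i * (1 - ε)) ≤ ε * (X / P.value f) := by
      rw [← mul_div_assoc]
      nlinarith
    have h10 := le_of_mul_le_mul_left h9 hε'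
    rw [le_div_iff₀ hv] at h10
    linarith

end Problem

/-! ## The approximation scheme: lengths and loads -/

theorem BitBound.bits_le_of_le {b B ℓ : ℕ} {q : ℚ} (h : BitBound b q) (hb : b ≤ B)
    (hℓ : 2 * B + 3 ≤ ℓ) : bits q ≤ ℓ :=
  (h.mono hb).bits_le.trans hℓ

theorem BitBound.zero (b : ℕ) : BitBound b 0 := by
  simpa using BitBound.natCast (b := b) (k := 0) (by simp)

theorem BitBound.one (b : ℕ) : BitBound b 1 := by
  simpa using BitBound.natCast (b := b) (k := 1) (by simpa using Nat.one_le_two_pow)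

theorem BitBound.finset_sum_range {b : ℕ} {f : ℕ → ℚ} {r : ℕ} (h : ∀ i < r, BitBound b (f i)) :
    BitBound (r * (b + 1)) (∑ i ∈ Finset.range r, f i) := by
  rw [Finset.sum_range, ← List.sum_ofFn, List.ofFn_eq_map]
  simpa using BitBound.list_sum (l := List.finRange r) (f := fun i : Fin r => f i) fun i _ => h i i.isLt

namespace Problem

variable {n m k : ℕ} {P : Problem n m k}

/-- Among the capacity rows only that of `e` meets `e`, so a length is computed with `O(k)`
operations by an expression of fixed size. `usable_iff` does the same for usability. -/
theorem rowLength_eq {K : Type*} [Field K] (y : ℕ → K) (e : Fin m) :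
    P.rowLength y e = y e / P.bound e +
      ∑ j ∈ Finset.range k, y (m + j) * P.row (m + j) e / P.bound (m + j) := by
  rw [rowLength, Finset.sum_range_add, Finset.sum_eq_single_of_mem (e : ℕ) (by simp)]
  · simp [row_edge]
  · intro i hi hie
    rw [Finset.mem_range] at hi
    simp [row, hi, hie]

theorem usable_iff {e : Fin m} : P.Usable e ↔
    P.bound e ≠ 0 ∧ ∀ j < k, ¬ (P.bound (m + j) = 0 ∧ P.row (m + j) e ≠ 0) := by
  constructor
  · exact fun h => ⟨h e (by omega) (by simp [row_edge]), fun j hj h' => h (m + j) (by omega) h'.2 h'.1⟩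
  · rintro ⟨h1, h2⟩ i hi hr
    rcases row_cases hi with ⟨f, rfl⟩ | ⟨j, rfl⟩
    · rw [row_edge] at hr
      obtain rfl : f = e := by by_contra h; simp [h] at hr
      exact h1
    · exact fun hb => h2 j j.isLt ⟨hb, hr⟩

theorem load_eq_sum {p : List (Fin m)} (hp : p.Nodup) (i : ℕ) :
    P.load p i = ∑ e, P.row i e * unitFlow p e := (sum_mul_unitFlow hp (P.row i)).symm

end Problem

/-- The memory holds the data of `P` and `ε`, and in the array `k + 4` the right-hand sides of the
packing constraints. -/
structure State.Stores {n m k : ℕ} (σ : State) (P : Problem n m k) (ε : ℚ) : Prop where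
  holds : σ.Holds P.toNetwork
  eps : σ.num 0 0 = ε
  cost : ∀ j < k, ∀ e : Fin m, σ.num (j + 4) e = P.row (m + j) e
  bound : ∀ i < m + k, σ.num (k + 4) i = P.bound i

/-- The budget coefficients occupy number arrays 4 to `k + 3`. The following arrays hold right-hand
sides (`k + 4`), loads (`k + 5`), weights (`k + 6`), congestions (`k + 7`), step size (`k + 8`),
maximum congestion (`k + 9`) and the sum of the capacities (`k + 10`). -/
theorem State.Stores.frame {n m k : ℕ} {P : Problem n m k} {ε : ℚ} {σ τ : State}
    (h : σ.Stores P ε) {S S' : List ℕ} (hF : Frame S σ.idx τ.idx) (hFn : Frame S' σ.num τ.num)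
    (h0 : 0 ∉ S) (h1 : 1 ∉ S) (h2 : 2 ∉ S) (h0' : 0 ∉ S') (h' : ∀ j ≤ k, j + 4 ∉ S') :
    τ.Stores P ε where
  holds := h.holds.frame hF h0 h1 h2
  eps := by rw [hFn 0 h0', h.eps]
  cost j hj := by rw [hFn _ (h' j hj.le)]; exact h.cost j hj
  bound := by rw [hFn _ (h' k le_rfl)]; exact h.bound

/-- The index of the `j`-th budget constraint. -/
def budgetRow (j : ℕ) : IdxExpr := .add (.read 0 (.lit 1)) (.lit j)

/-- The length of the edge in variable `36`, for the first `j` of the `k` budget constraints. -/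
def lengthExpr (k : ℕ) : ℕ → NumExpr
  | 0 => .div (.read (k + 6) (var 36)) (.read (k + 4) (var 36))
  | j + 1 => .add (lengthExpr k j) (.div
      (.mul (.read (k + 6) (budgetRow j)) (.read (j + 4) (var 36))) (.read (k + 4) (budgetRow j)))

/-- The edge in variable `36` is usable with respect to the first `j` budget constraints. -/
def usableTest (k : ℕ) : ℕ → Test
  | 0 => .not (.numEq (.read (k + 4) (var 36)) (.lit 0))
  | j + 1 => .and (usableTest k j) (.not (.and (.numEq (.read (k + 4) (budgetRow j)) (.lit 0))
      (.not (.numEq (.read (j + 4) (var 36)) (.lit 0)))))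

section

variable {n m k : ℕ} {P : Problem n m k} {ε : ℚ} {σ : State}

theorem State.Stores.lengthExpr_eval (h : σ.Stores P ε) {e : Fin m} (he : σ.idx 36 0 = e) :
    (lengthExpr k k).eval σ = P.rowLength (σ.num (k + 6)) e := by
  have key : ∀ j ≤ k, (lengthExpr k j).eval σ = σ.num (k + 6) e / P.bound e +
      ∑ j ∈ Finset.range j, σ.num (k + 6) (m + j) * P.row (m + j) e / P.bound (m + j) := by
    intro j hj
    induction j with
    | zero => simp [lengthExpr, NumExpr.eval, he, h.bound e (by omega)]
    | succ j ih =>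
      rw [Finset.sum_range_succ, ← add_assoc, ← ih (by omega)]
      simp only [lengthExpr, NumExpr.eval, budgetRow, IdxExpr.eval, var_eval, he, h.holds.edges,
        h.cost j hj, h.bound (m + j) (by omega)]
  rw [key k le_rfl, Problem.rowLength_eq]

theorem State.Stores.usableTest_holds (h : σ.Stores P ε) {e : Fin m} (he : σ.idx 36 0 = e) :
    (usableTest k k).Holds σ ↔ P.Usable e := by
  have key : ∀ j ≤ k, (usableTest k j).Holds σ ↔ P.bound e ≠ 0 ∧
      ∀ i < j, ¬ (P.bound (m + i) = 0 ∧ P.row (m + i) e ≠ 0) := by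
    intro j hj
    induction j with
    | zero => simp [usableTest, Test.Holds, NumExpr.eval, he, h.bound e (by omega)]
    | succ j ih =>
      simp only [usableTest, Test.Holds, ih (by omega), NumExpr.eval, budgetRow, IdxExpr.eval,
        var_eval, he, h.holds.edges, h.cost j hj, h.bound (m + j) (by omega), Nat.cast_eq_zero,
        Nat.lt_succ_iff_lt_or_eq, or_imp, forall_and, forall_eq, and_assoc, ne_eq]
  rw [key k le_rfl, Problem.usable_iff]

/-- Compute the guarded edge lengths for the current weights. -/
def lengthProgram (k : ℕ) : Program := block [
  forLoop 36 (.read 0 (.lit 1)) (.setNum 1 (var 36) (lengthExpr k k)),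
  boundProgram,
  forLoop 36 (.read 0 (.lit 1))
    (.branch (usableTest k k) .skip (.setNum 1 (var 36) (.read 3 (var 0))))]

/-- The guard value, one plus the sum of all lengths, is what `boundProgram` computes, so it is
reused before the lengths of unusable edges are overwritten. -/
theorem wp_lengthProgram {w ℓ b c : ℕ} {Q : State → ℕ → Prop} (h : σ.Stores P ε) (hw : m ≤ w)
    (hb : ∀ e, BitBound b (P.rowLength (σ.num (k + 6)) e)) (hℓ : 2 * (m * (b + 1) + b + 2) + 3 ≤ ℓ)
    (hc : 10 * m + 10 ≤ c)
    (hQ : ∀ (τ : State) (c' : ℕ), Frame [21, 36] σ.idx τ.idx → Frame [1, 3] σ.num τ.num →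
      (∀ e : Fin m, τ.num 1 e = P.guardedLength (σ.num (k + 6)) e) → c ≤ c' + (10 * m + 10) →
      Q τ c') :
    wp w ℓ (lengthProgram k) Q σ c := by
  have hbnd : ∀ p : List (Fin m), p.Nodup →
      BitBound (m * (b + 1) + 1) (1 + (p.map (P.rowLength (σ.num (k + 6)))).sum) := fun p hp => by
    have hl : p.length ≤ m := by simpa using hp.length_le_card
    exact ((BitBound.one 0).add (BitBound.list_sum fun e _ => hb e)).mono
      (by have := Nat.mul_le_mul_right (b + 1) hl; omega)
  simp only [lengthProgram, wp_cons]
  refine wp_forLoop (K := 1) (M := m) (fun i τ => Frame [21, 36] σ.idx τ.idx ∧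
    Frame [1, 3] σ.num τ.num ∧ ∀ e : Fin m, (e : ℕ) < i →
      τ.num 1 e = P.rowLength (σ.num (k + 6)) e) (by omega) (by omega) ?_ ?_ ?_ ?_
  · exact ⟨(Frame.refl _ _).write (by simp) _ _, Frame.refl _ _, by simp⟩
  · rintro i ρ ⟨hF, -⟩
    simp [IdxExpr.eval, hF 0 (by simp), h.holds.edges]
  · rintro i ρ c' hi h36 ⟨hF, hFn, h1⟩ hc'
    have hS := h.frame hF hFn (by simp) (by simp) (by simp) (by simp) (by simp)
    have h6 : ρ.num (k + 6) = σ.num (k + 6) := hFn _ (by simp)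
    rw [wp_setNum, hS.lengthExpr_eval (e := ⟨i, hi⟩) h36, h6]
    refine ⟨by omega, (hb _).bits_le_of_le (by omega) hℓ, by omega, h36, hF.write (by simp) _ _,
      hFn.write (by simp) _ _, ?_⟩
    intro e he
    simp only [State.setVar, write_same, var_eval, h36, Function.update_apply]
    split_ifs with hei
    · congr 1; exact Fin.ext hei.symm
    · exact h1 e (by omega)
  rintro τ1 c1 ⟨hF1, hFn1, h1⟩ hc1
  have hS1 := h.frame hF1 hFn1 (by simp) (by simp) (by simp) (by simp) (by simp)
  rw [wp_cons]
  refine wp_boundProgram (d := P.rowLength (σ.num (k + 6))) hw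
    (fun p hp => (hbnd p hp).bits_le_of_le (by omega) hℓ) hS1.holds.nodes hS1.holds.edges
    (fun e => h1 e e.isLt) (by omega) ?_
  intro τ2 c2 hF2 hFn2 h3 hc2
  have hS2 := hS1.frame hF2 hFn2 (by simp) (by simp) (by simp) (by simp) (by simp)
  have hF2' := hF1.trans hF2 (by simp)
  have hFn2' := hFn1.trans hFn2 (by simp)
  have h12 : τ2.num 1 = τ1.num 1 := hFn2 1 (by simp)
  have hlb : lengthBound (P.rowLength (σ.num (k + 6))) =
      1 + ∑ f, P.rowLength (σ.num (k + 6)) f := by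
    rw [lengthBound, ← List.ofFn_eq_map, List.sum_ofFn]
  rw [wp_cons]
  refine wp_forLoop (K := 2) (M := m) (fun i τ => Frame [21, 36] τ2.idx τ.idx ∧
    Frame [1] τ2.num τ.num ∧ (∀ e : Fin m, (e : ℕ) < i →
      τ.num 1 e = P.guardedLength (σ.num (k + 6)) e) ∧ ∀ e : Fin m, i ≤ e →
      τ.num 1 e = P.rowLength (σ.num (k + 6)) e) (by omega) (by omega) ?_ ?_ ?_ ?_
  · exact ⟨(Frame.refl _ _).write (by simp) _ _, Frame.refl _ _, by simp,
      fun e _ => by simp only [State.setVar, h12]; exact h1 e e.isLt⟩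
  · rintro i ρ ⟨hF, -⟩
    simp [IdxExpr.eval, hF 0 (by simp), hS2.holds.edges]
  · rintro i ρ c' hi h36 ⟨hF, hFn, hlt, hge⟩ hc'
    have hS := hS2.frame hF hFn (by simp) (by simp) (by simp) (by simp) (by simp)
    rw [wp_branch, hS.usableTest_holds (e := ⟨i, hi⟩) h36]
    refine ⟨by omega, fun hu => ?_, fun hu => ?_⟩
    · rw [wp_skip]
      refine ⟨by omega, by omega, h36, hF.write (by simp) _ _, hFn, fun e he => ?_,
        fun e he => hge e (by omega)⟩
      by_cases hei : (e : ℕ) = i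
      · obtain rfl : e = ⟨i, hi⟩ := Fin.ext hei
        rw [Problem.guardedLength, if_pos hu]
        exact hge _ le_rfl
      · exact hlt e (by omega)
    · have hv : ρ.num 3 (ρ.idx 0 0) = 1 + ∑ f, P.rowLength (σ.num (k + 6)) f := by
        rw [hS.holds.nodes, hFn 3 (by simp), h3, hlb]
      rw [wp_setNum]
      simp only [NumExpr.eval, var_eval, hv, h36]
      refine ⟨by omega, ?_, by omega, trivial, hF.write (by simp) _ _, hFn.write (by simp) _ _,
        fun e he => ?_, fun e he => ?_⟩
      · rw [← hlb]
        exact (hbnd _ (List.nodup_finRange m)).bits_le_of_le (by omega) hℓ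
      · simp only [State.setVar, write_same, Function.update_apply]
        split_ifs with hei
        · rw [Problem.guardedLength, if_neg]
          rwa [show e = ⟨i, hi⟩ from Fin.ext hei]
        · exact hlt e (by omega)
      · simp only [State.setVar, write_same]
        rw [Function.update_of_ne (by omega)]
        exact hge e (by omega)
  · rintro τ3 c3 ⟨hF3, hFn3, hlt, -⟩ hc3
    rw [wp_nil]
    exact ⟨by omega, hQ _ _ (hF2'.trans hF3 (by simp)) (hFn2'.trans hFn3 (by simp))
      (fun e => hlt e e.isLt) (by omega)⟩

/-- Compute the loads of the first `j` of the `k` budget constraints. -/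
def budgetLoadProgram (k : ℕ) : ℕ → Program
  | 0 => .skip
  | j + 1 => block [
      budgetLoadProgram k j,
      .setNum (k + 5) (budgetRow j) (.lit 0),
      forLoop 36 (.read 0 (.lit 1)) (.setNum (k + 5) (budgetRow j) (.add
        (.read (k + 5) (budgetRow j)) (.mul (.read (j + 4) (var 36)) (.read 3 (var 36)))))]

/-- Compute the loads of the packing constraints for the path in the array `3`. -/
def loadProgram (k : ℕ) : Program := block [
  forLoop 36 (.read 0 (.lit 1)) (.setNum (k + 5) (var 36) (.read 3 (var 36))),
  budgetLoadProgram k k]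

/-- Array names are fixed in a program, so the loop over the budgets is unrolled by recursion on
`j`. All intermediate values are partial sums of a row and hence below `2 ^ G`. -/
theorem wp_budgetLoadProgram {w ℓ G c j : ℕ} {Q : State → ℕ → Prop} (h : σ.Stores P ε)
    (hw : m ≤ w) (hj : j ≤ k) {p : List (Fin m)} (hp : p.Nodup)
    (h3 : ∀ e : Fin m, σ.num 3 e = unitFlow p e)
    (hG : ∀ i < m + k, ∑ e, P.row i e ≤ 2 ^ G) (hℓ : 2 * G + 3 ≤ ℓ)
    (hc : j * (3 * m + 4) + 1 ≤ c)
    (hQ : ∀ (τ : State) (c' : ℕ), Frame [36] σ.idx τ.idx → Frame [k + 5] σ.num τ.num →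
      (∀ i < m, τ.num (k + 5) i = σ.num (k + 5) i) →
      (∀ i < j, τ.num (k + 5) (m + i) = P.load p (m + i)) → c ≤ c' + (j * (3 * m + 4) + 1) →
      Q τ c') :
    wp w ℓ (budgetLoadProgram k j) Q σ c := by
  induction j generalizing Q with
  | zero =>
    rw [budgetLoadProgram, wp_skip]
    exact ⟨by omega, hQ _ _ (Frame.refl _ _) (Frame.refl _ _) (by simp) (by simp) (by omega)⟩
  | succ j ih =>
    have e1 : (j + 1) * (3 * m + 4) = j * (3 * m + 4) + (3 * m + 4) := by ring
    rw [e1] at hc hQ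
    simp only [budgetLoadProgram, wp_cons]
    refine ih (by omega) (by omega) ?_
    intro τ1 c1 hF1 hFn1 hlo hl hc1
    have hS1 := h.frame hF1 hFn1 (by simp) (by simp) (by simp) (by simp)
      (fun i hi => by simp; omega)
    rw [wp_cons, wp_setNum, wp_cons]
    simp only [NumExpr.eval, budgetRow, IdxExpr.eval, hS1.holds.edges]
    refine ⟨by omega, (BitBound.zero G).bits_le_of_le le_rfl hℓ, ?_⟩
    refine wp_forLoop (K := 1) (M := m) (fun i τ => Frame [36] τ1.idx τ.idx ∧
      Frame [k + 5] τ1.num τ.num ∧ (∀ a, a ≠ m + j → τ.num (k + 5) a = τ1.num (k + 5) a) ∧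
      τ.num (k + 5) (m + j) = ((∑ e ∈ Finset.univ.filter (fun e : Fin m => (e : ℕ) < i), P.row (m + j) e * unitFlow p e : ℕ) : ℚ))
      (by omega) (by omega) ?_ ?_ ?_ ?_
    · refine ⟨(Frame.refl _ _).write (by simp) _ _, (Frame.refl _ _).write (by simp) _ _,
        fun a ha => ?_, ?_⟩
      · simp [State.setVar, Function.update_of_ne ha]
      · simp [State.setVar]
    · rintro i ρ ⟨hF, -⟩
      simp [IdxExpr.eval, hF 0 (by simp), hS1.holds.edges]
    · rintro i ρ c' hi h36 ⟨hF, hFn, ho, hs⟩ hc'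
      have hS := hS1.frame hF hFn (by simp) (by simp) (by simp) (by simp)
        (fun i hi => by simp; omega)
      have h3' : ρ.num 3 i = unitFlow p ⟨i, hi⟩ := by
        rw [hFn 3 (by simp), hFn1 3 (by simp)]
        exact h3 ⟨i, hi⟩
      have e2 : (Finset.univ.filter fun e : Fin m => (e : ℕ) < i + 1) =
          insert ⟨i, hi⟩ (Finset.univ.filter fun e : Fin m => (e : ℕ) < i) := by
        ext e
        simp [Fin.ext_iff]
        omega
      have e3 : ρ.num (k + 5) (m + j) + ρ.num (j + 4) i * ρ.num 3 i =
          ((∑ e ∈ Finset.univ.filter (fun e : Fin m => (e : ℕ) < i + 1), P.row (m + j) e * unitFlow p e : ℕ) : ℚ) := by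
        rw [e2, Finset.sum_insert (by simp), hs, h3', hS.cost j (by omega) ⟨i, hi⟩, add_comm]
        simp [unitFlow]
      rw [wp_setNum]
      simp only [NumExpr.eval, budgetRow, IdxExpr.eval, hS.holds.edges, var_eval, h36, e3]
      refine ⟨by omega, (BitBound.natCast ?_).bits_le_of_le le_rfl hℓ, by omega, trivial,
        hF.write (by simp) _ _, hFn.write (by simp) _ _, fun a ha => ?_, ?_⟩
      · refine le_trans ?_ (hG (m + j) (by omega))
        refine (Finset.sum_le_sum_of_subset (Finset.filter_subset _ _)).trans
          (Finset.sum_le_sum fun e _ => ?_)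
        unfold unitFlow
        split_ifs <;> simp
      · simp only [State.setVar, write_same, Function.update_of_ne ha]
        exact ho a ha
      · simp [State.setVar]
    · rintro τ2 c2 ⟨hF2, hFn2, ho, hs⟩ hc2
      rw [wp_nil]
      refine ⟨by omega, hQ _ _ (hF1.trans hF2 (by simp)) (hFn1.trans hFn2 (by simp))
        (fun i hi => ?_) (fun i hi => ?_) (by omega)⟩
      · rw [ho i (by omega), hlo i hi]
      · by_cases hij : i = j
        · rw [hij, hs, Problem.load_eq_sum hp, Finset.filter_true_of_mem fun e _ => e.isLt]
        · rw [ho _ (by omega), hl i (by omega)]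

theorem wp_loadProgram {w ℓ G c : ℕ} {Q : State → ℕ → Prop} (h : σ.Stores P ε)
    (hw : m ≤ w) {p : List (Fin m)} (hp : p.Nodup)
    (h3 : ∀ e : Fin m, σ.num 3 e = unitFlow p e)
    (hG : ∀ i < m + k, ∑ e, P.row i e ≤ 2 ^ G) (hℓ : 2 * G + 3 ≤ ℓ)
    (hc : 3 * m + k * (3 * m + 4) + 4 ≤ c)
    (hQ : ∀ (τ : State) (c' : ℕ), Frame [36] σ.idx τ.idx → Frame [k + 5] σ.num τ.num →
      (∀ i < m + k, τ.num (k + 5) i = P.load p i) → c ≤ c' + (3 * m + k * (3 * m + 4) + 4) →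
      Q τ c') :
    wp w ℓ (loadProgram k) Q σ c := by
  simp only [loadProgram, wp_cons]
  refine wp_forLoop (K := 1) (M := m) (fun i τ => Frame [36] σ.idx τ.idx ∧
    Frame [k + 5] σ.num τ.num ∧ ∀ e : Fin m, (e : ℕ) < i → τ.num (k + 5) e = unitFlow p e)
    (by omega) (by omega) ?_ ?_ ?_ ?_
  · exact ⟨(Frame.refl _ _).write (by simp) _ _, Frame.refl _ _, by simp⟩
  · rintro i ρ ⟨hF, -⟩
    simp [IdxExpr.eval, hF 0 (by simp), h.holds.edges]
  · rintro i ρ c' hi h36 ⟨hF, hFn, h1⟩ hc'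
    have h3' : ρ.num 3 i = unitFlow p ⟨i, hi⟩ := by
      rw [hFn 3 (by simp)]
      exact h3 ⟨i, hi⟩
    rw [wp_setNum]
    simp only [NumExpr.eval, var_eval, h36, h3']
    refine ⟨by omega, ?_, by omega, trivial, hF.write (by simp) _ _, hFn.write (by simp) _ _,
      fun e he => ?_⟩
    · unfold unitFlow
      split_ifs
      exacts [(BitBound.one G).bits_le_of_le le_rfl hℓ, (BitBound.zero G).bits_le_of_le le_rfl hℓ]
    · simp only [State.setVar, write_same, Function.update_apply]
      split_ifs with hei
      · congr 1; exact Fin.ext hei.symm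
      · exact h1 e (by omega)
  · rintro τ1 c1 ⟨hF1, hFn1, h1⟩ hc1
    have hS1 := h.frame hF1 hFn1 (by simp) (by simp) (by simp) (by simp)
      (fun i hi => by simp; omega)
    rw [wp_cons]
    refine wp_budgetLoadProgram hS1 hw le_rfl hp (by rw [hFn1 3 (by simp)]; exact h3) hG hℓ
      (by omega) ?_
    intro τ2 c2 hF2 hFn2 hlo hl hc2
    rw [wp_nil]
    refine ⟨by omega, hQ _ _ (hF1.trans hF2 (by simp)) (hFn1.trans hFn2 (by simp))
      (fun i hi => ?_) (by omega)⟩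
    rcases Problem.row_cases hi with ⟨e, rfl⟩ | ⟨j, rfl⟩
    · rw [hlo e e.isLt, h1 e e.isLt, Problem.load_edge hp]
      simp [unitFlow]
    · exact hl j j.isLt

end

/-! ## The approximation scheme: weights, congestions and initialization -/

/-- The number of packing constraints. -/
def rowCount (k : ℕ) : IdxExpr := .add (.read 0 (.lit 1)) (.lit k)

/-- Store the largest possible amount of flow on the current path, at most the number in array
`k + 10`, in array `k + 8`. -/
def stepSizeProgram (k : ℕ) : Program := block [
  .setNum (k + 8) (.lit 0) (.read (k + 10) (.lit 0)),
  forLoop 36 (rowCount k) (.branch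
    (.and (.not (.numEq (.read (k + 5) (var 36)) (.lit 0)))
      (.numLt (.div (.read (k + 4) (var 36)) (.read (k + 5) (var 36))) (.read (k + 8) (.lit 0))))
    (.setNum (k + 8) (.lit 0) (.div (.read (k + 4) (var 36)) (.read (k + 5) (var 36))))
    .skip)]

/-- Update the congestions in array `k + 7` and the weights in array `k + 6`. -/
def updateProgram (k : ℕ) : Program :=
  forLoop 36 (rowCount k) (block [
    .setNum (k + 7) (var 36) (.add (.read (k + 7) (var 36)) (.div
      (.mul (.read (k + 8) (.lit 0)) (.read (k + 5) (var 36))) (.read (k + 4) (var 36)))),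
    .setNum (k + 6) (var 36) (.mul (.read (k + 6) (var 36)) (.add (.lit 1)
      (.mul (.read 0 (.lit 0)) (.div (.mul (.read (k + 8) (.lit 0)) (.read (k + 5) (var 36)))
        (.read (k + 4) (var 36))))))])

/-- Scale the flow by the maximum congestion, and write it to array `3`. -/
def scaleProgram (k : ℕ) : Program := block [
  .setNum (k + 9) (.lit 0) (.lit 0),
  forLoop 36 (rowCount k) (.branch
    (.numLt (.read (k + 9) (.lit 0)) (.read (k + 7) (var 36)))
    (.setNum (k + 9) (.lit 0) (.read (k + 7) (var 36))) .skip),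
  forLoop 36 (.read 0 (.lit 1)) (.setNum 3 (var 36) (.div
    (.mul (.read (k + 4) (var 36)) (.read (k + 7) (var 36))) (.read (k + 9) (.lit 0))))]

/-- Store `⌈1 / ε⌉` in variable `32`. -/
def ceilProgram : Program := block [
  .setIdx 32 (.lit 0) (.lit 0),
  .loop (.numLt (.mul (.ofIdx (var 32)) (.read 0 (.lit 0))) (.lit 1))
    (.setIdx 32 (.lit 0) (.add (var 32) (.lit 1)))]

/-- Store the length of the binary representation of `m + k` in variable `33`. -/
def sizeProgram (k : ℕ) : Program := block [
  .setIdx 33 (.lit 0) (.lit 0),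
  .setIdx 34 (.lit 0) (rowCount k),
  .loop (.not (.idxEq (var 34) (.lit 0))) (block [
    .setIdx 34 (.lit 0) (.div (var 34) (.lit 2)),
    .setIdx 33 (.lit 0) (.add (var 33) (.lit 1))])]

/-- Copy the right-hand sides to array `k + 4`, store the sum of the capacities in array `k + 10`,
and initialize the weights and congestions. -/
def copyProgram (k : ℕ) : Program := block [
  .setNum (k + 10) (.lit 0) (.lit 0),
  forLoop 36 (.read 0 (.lit 1)) (block [
    .setNum (k + 4) (var 36) (.read 1 (var 36)),
    .setNum (k + 10) (.lit 0) (.add (.read (k + 10) (.lit 0)) (.read 1 (var 36)))]),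
  forLoop 36 (.lit k) (.setNum (k + 4) (.add (.read 0 (.lit 1)) (var 36)) (.read 2 (var 36))),
  forLoop 36 (rowCount k) (block [
    .setNum (k + 6) (var 36) (.lit 1),
    .setNum (k + 7) (var 36) (.lit 0)])]

section

variable {n m k w ℓ G c : ℕ} {P : Problem n m k} {ε : ℚ} {σ : State} {Q : State → ℕ → Prop}

theorem wp_stepSizeProgram (h : σ.Stores P ε) (hw : m + k ≤ w) {p : List (Fin m)} {T : ℚ}
    (hA : ∀ i < m + k, σ.num (k + 5) i = P.load p i) (hT : σ.num (k + 10) 0 = T) (hT0 : 0 ≤ T)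
    (hTb : BitBound (2 * G) T) (hG : ∀ i < m + k, P.bound i ≤ 2 ^ G)
    (hG' : ∀ i < m + k, P.load p i ≤ 2 ^ G) (hℓ : 2 * (2 * G) + 3 ≤ ℓ) (hc : 4 * (m + k) + 4 ≤ c)
    (hQ : ∀ (τ : State) (c' : ℕ), Frame [36] σ.idx τ.idx → Frame [k + 8] σ.num τ.num →
      0 ≤ τ.num (k + 8) 0 → BitBound (2 * G) (τ.num (k + 8) 0) →
      (∀ i < m + k, P.load p i ≠ 0 → τ.num (k + 8) 0 ≤ P.bound i / P.load p i) →
      (τ.num (k + 8) 0 = T ∨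
        ∃ i < m + k, P.load p i ≠ 0 ∧ τ.num (k + 8) 0 = P.bound i / P.load p i) →
      c ≤ c' + (4 * (m + k) + 4) → Q τ c') :
    wp w ℓ (stepSizeProgram k) Q σ c := by
  simp only [stepSizeProgram, wp_cons, wp_setNum, NumExpr.eval, IdxExpr.eval, hT]
  refine ⟨by omega, hTb.bits_le_of_le le_rfl hℓ, ?_⟩
  refine wp_forLoop (K := 2) (M := m + k) (fun r τ => Frame [36] σ.idx τ.idx ∧
    Frame [k + 8] σ.num τ.num ∧ 0 ≤ τ.num (k + 8) 0 ∧ BitBound (2 * G) (τ.num (k + 8) 0) ∧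
    (∀ i < r, P.load p i ≠ 0 → τ.num (k + 8) 0 ≤ P.bound i / P.load p i) ∧
    (τ.num (k + 8) 0 = T ∨
      ∃ i < m + k, P.load p i ≠ 0 ∧ τ.num (k + 8) 0 = P.bound i / P.load p i))
    hw (by omega) ?_ ?_ ?_ ?_
  · refine ⟨(Frame.refl _ _).write (by simp) _ _, (Frame.refl _ _).write (by simp) _ _, ?_, ?_,
      by simp, ?_⟩ <;> simp [State.setVar, hT0, hTb]
  · rintro i ρ ⟨hF, -⟩
    simp [rowCount, IdxExpr.eval, hF 0 (by simp), h.holds.edges]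
  · rintro r ρ c' hr h36 ⟨hF, hFn, h0, hb, hle, hor⟩ hc'
    have hS := h.frame hF hFn (by simp) (by simp) (by simp) (by simp) (fun i hi => by simp; omega)
    have hAr : ρ.num (k + 5) r = P.load p r := by rw [hFn _ (by simp)]; exact hA r hr
    simp only [wp_branch, Test.Holds, NumExpr.eval, IdxExpr.eval, var_eval, h36, hAr, hS.bound r hr,
      wp_setNum, wp_skip]
    have hbnew : BitBound (2 * G) ((P.bound r : ℚ) / P.load p r) :=
      ((BitBound.natCast (hG r hr)).div (BitBound.natCast (hG' r hr))).mono (by omega)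
    refine ⟨by omega, ?_, ?_⟩
    · rintro ⟨hne, hlt⟩
      refine ⟨by omega, hbnew.bits_le_of_le le_rfl hℓ, by omega, trivial, hF.write (by simp) _ _,
        hFn.write (by simp) _ _, ?_⟩
      simp only [State.setVar, write_same, Function.update_self]
      refine ⟨div_nonneg (Nat.cast_nonneg _) (Nat.cast_nonneg _), hbnew, fun i hi hl => ?_,
        .inr ⟨r, hr, by exact_mod_cast hne, rfl⟩⟩
      by_cases hir : i = r
      · rw [hir]
      · exact hlt.le.trans (hle i (by omega) hl)
    · intro hno
      refine ⟨by omega, by omega, trivial, hF.write (by simp) _ _, hFn, h0, hb, fun i hi hl => ?_,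
        hor⟩
      by_cases hir : i = r
      · subst hir
        by_contra hlt
        exact hno ⟨by exact_mod_cast hl, not_le.1 hlt⟩
      · exact hle i (by omega) hl
  · rintro τ c' ⟨hF, hFn, h0, hb, hle, hor⟩ hc'
    rw [wp_nil]
    exact ⟨by omega, hQ _ _ hF hFn h0 hb hle hor (by omega)⟩

theorem wp_updateProgram (h : σ.Stores P ε) (hw : m + k ≤ w) {p : List (Fin m)} {b : ℕ}
    (hA : ∀ i < m + k, σ.num (k + 5) i = P.load p i)
    (hbc : ∀ i < m + k, BitBound b (σ.num (k + 7) i + σ.num (k + 8) 0 * P.load p i / P.bound i))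
    (hby : ∀ i < m + k, BitBound b
      (σ.num (k + 6) i * (1 + ε * (σ.num (k + 8) 0 * P.load p i / P.bound i))))
    (hℓ : 2 * b + 3 ≤ ℓ) (hc : 5 * (m + k) + 2 ≤ c)
    (hQ : ∀ (τ : State) (c' : ℕ), Frame [36] σ.idx τ.idx → Frame [k + 6, k + 7] σ.num τ.num →
      (∀ i < m + k, τ.num (k + 7) i =
        σ.num (k + 7) i + σ.num (k + 8) 0 * P.load p i / P.bound i) →
      (∀ i < m + k, τ.num (k + 6) i =
        σ.num (k + 6) i * (1 + ε * (σ.num (k + 8) 0 * P.load p i / P.bound i))) →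
      c ≤ c' + (5 * (m + k) + 2) → Q τ c') :
    wp w ℓ (updateProgram k) Q σ c := by
  refine wp_forLoop (K := 3) (M := m + k) (fun r τ => Frame [36] σ.idx τ.idx ∧
    Frame [k + 6, k + 7] σ.num τ.num ∧
    (∀ i < r, τ.num (k + 7) i = σ.num (k + 7) i + σ.num (k + 8) 0 * P.load p i / P.bound i ∧
      τ.num (k + 6) i =
        σ.num (k + 6) i * (1 + ε * (σ.num (k + 8) 0 * P.load p i / P.bound i))) ∧
    ∀ i, r ≤ i → τ.num (k + 7) i = σ.num (k + 7) i ∧ τ.num (k + 6) i = σ.num (k + 6) i)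
    hw (by omega) ?_ ?_ ?_ ?_
  · exact ⟨(Frame.refl _ _).write (by simp) _ _, Frame.refl _ _, by simp, fun _ _ => ⟨rfl, rfl⟩⟩
  · rintro i ρ ⟨hF, -⟩
    simp [rowCount, IdxExpr.eval, hF 0 (by simp), h.holds.edges]
  · rintro r ρ c' hr h36 ⟨hF, hFn, hlt, hge⟩ hc'
    have hS := h.frame hF hFn (by simp) (by simp) (by simp) (by simp) (fun i hi => by simp; omega)
    have hAr : ρ.num (k + 5) r = P.load p r := by rw [hFn _ (by simp)]; exact hA r hr
    have h8 : ρ.num (k + 8) = σ.num (k + 8) := hFn _ (by simp)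
    have w6 : ∀ (i : ℕ) (v : ℚ), write ρ.num (k + 7) i v (k + 6) = ρ.num (k + 6) := fun i v =>
      write_ne _ _ _ (by omega)
    have w5 : ∀ (i : ℕ) (v : ℚ), write ρ.num (k + 7) i v (k + 5) = ρ.num (k + 5) := fun i v =>
      write_ne _ _ _ (by omega)
    have w4 : ∀ (i : ℕ) (v : ℚ), write ρ.num (k + 7) i v (k + 4) = ρ.num (k + 4) := fun i v =>
      write_ne _ _ _ (by omega)
    have w8 : ∀ (i : ℕ) (v : ℚ), write ρ.num (k + 7) i v (k + 8) = ρ.num (k + 8) := fun i v =>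
      write_ne _ _ _ (by omega)
    have w0 : ∀ (i : ℕ) (v : ℚ), write ρ.num (k + 7) i v 0 = ρ.num 0 := fun i v =>
      write_ne _ _ _ (by omega)
    simp only [wp_cons, wp_nil, wp_setNum, NumExpr.eval, IdxExpr.eval, var_eval, h36, w6, w5, w4, w8,
      w0, hAr, h8, hS.bound r hr, hS.eps, (hge r le_rfl).1, (hge r le_rfl).2]
    refine ⟨by omega, (hbc r hr).bits_le_of_le le_rfl hℓ, by omega,
      (hby r hr).bits_le_of_le le_rfl hℓ, by omega, by omega, trivial, hF.write (by simp) _ _,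
      (hFn.write (by simp) _ _).write (by simp) _ _, ?_⟩
    have w7 : ∀ (f : ℕ → ℕ → ℚ) (i : ℕ) (v : ℚ), write f (k + 6) i v (k + 7) = f (k + 7) :=
      fun f i v => write_ne _ _ _ (by omega)
    simp only [State.setVar, write_same, w7, w6]
    refine ⟨fun i hi => ?_, fun i hi => ?_⟩
    · by_cases hir : i = r
      · subst hir; simp
      · rw [Function.update_of_ne hir, Function.update_of_ne hir]
        exact hlt i (by omega)
    · rw [Function.update_of_ne (by omega), Function.update_of_ne (by omega)]
      exact hge i (by omega)
  · rintro τ c' ⟨hF, hFn, hlt, -⟩ hc'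
    exact hQ _ _ hF hFn (fun i hi => (hlt i hi).1) (fun i hi => (hlt i hi).2) hc'

/-- The maximum is taken starting from 0, which explains the alternative `l = 0` in the
postcondition. -/
theorem wp_scaleProgram (h : σ.Stores P ε) (hw : m + k ≤ w) {b : ℕ}
    (hb : ∀ i < m + k, BitBound b (σ.num (k + 7) i)) (hG : ∀ i < m + k, P.bound i ≤ 2 ^ G)
    (hℓ : 2 * (G + 2 * b) + 3 ≤ ℓ) (hc : 7 * (m + k) + 6 ≤ c)
    (hQ : ∀ (τ : State) (c' : ℕ) (l : ℚ), 0 ≤ l → (∀ i < m + k, σ.num (k + 7) i ≤ l) →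
      (l = 0 ∨ ∃ i < m + k, l = σ.num (k + 7) i) →
      (∀ e : Fin m, τ.num 3 e = P.bound e * σ.num (k + 7) e / l) →
      c ≤ c' + (7 * (m + k) + 6) → Q τ c') :
    wp w ℓ (scaleProgram k) Q σ c := by
  simp only [scaleProgram, wp_cons, wp_setNum, NumExpr.eval, IdxExpr.eval]
  refine ⟨by omega, (BitBound.zero 0).bits_le_of_le (by omega) hℓ, ?_⟩
  refine wp_forLoop (K := 2) (M := m + k) (fun r τ => Frame [36] σ.idx τ.idx ∧
    Frame [k + 9] σ.num τ.num ∧ 0 ≤ τ.num (k + 9) 0 ∧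
    (∀ i < r, σ.num (k + 7) i ≤ τ.num (k + 9) 0) ∧
    (τ.num (k + 9) 0 = 0 ∨ ∃ i < m + k, τ.num (k + 9) 0 = σ.num (k + 7) i))
    hw (by omega) ?_ ?_ ?_ ?_
  · refine ⟨(Frame.refl _ _).write (by simp) _ _, (Frame.refl _ _).write (by simp) _ _, ?_,
      by simp, ?_⟩ <;> simp [State.setVar]
  · rintro i ρ ⟨hF, -⟩
    simp [rowCount, IdxExpr.eval, hF 0 (by simp), h.holds.edges]
  · rintro r ρ c' hr h36 ⟨hF, hFn, h0, hle, hor⟩ hc'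
    have h7 : ρ.num (k + 7) = σ.num (k + 7) := hFn _ (by simp)
    simp only [wp_branch, Test.Holds, NumExpr.eval, IdxExpr.eval, var_eval, h36, h7, wp_setNum,
      wp_skip]
    refine ⟨by omega, fun hlt => ?_, fun hge => ?_⟩
    · refine ⟨by omega, (hb r hr).bits_le_of_le (by omega) hℓ, by omega, trivial,
        hF.write (by simp) _ _, hFn.write (by simp) _ _, ?_⟩
      simp only [State.setVar, write_same, Function.update_self]
      refine ⟨h0.trans hlt.le, fun i hi => ?_, .inr ⟨r, hr, rfl⟩⟩
      by_cases hir : i = r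
      · rw [hir]
      · exact (hle i (by omega)).trans hlt.le
    · refine ⟨by omega, by omega, trivial, hF.write (by simp) _ _, hFn, h0, fun i hi => ?_, hor⟩
      by_cases hir : i = r
      · rw [hir]; exact not_lt.1 hge
      · exact hle i (by omega)
  rintro τ1 c1 ⟨hF1, hFn1, h0, hle, hor⟩ hc1
  have hS1 := h.frame hF1 hFn1 (by simp) (by simp) (by simp) (by simp) (fun i hi => by simp; omega)
  have h71 : τ1.num (k + 7) = σ.num (k + 7) := hFn1 _ (by simp)
  have hlb : BitBound b (τ1.num (k + 9) 0) := by
    rcases hor with h' | ⟨i, hi, h'⟩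
    · rw [h']; exact BitBound.zero b
    · rw [h']; exact hb i hi
  rw [wp_cons]
  refine wp_forLoop (K := 1) (M := m) (fun r τ => Frame [36] τ1.idx τ.idx ∧
    Frame [3] τ1.num τ.num ∧ ∀ e : Fin m, (e : ℕ) < r →
      τ.num 3 e = P.bound e * σ.num (k + 7) e / τ1.num (k + 9) 0)
    (by omega) (by omega) ?_ ?_ ?_ ?_
  · exact ⟨(Frame.refl _ _).write (by simp) _ _, Frame.refl _ _, by simp⟩
  · rintro i ρ ⟨hF, -⟩
    simp [IdxExpr.eval, hF 0 (by simp), hS1.holds.edges]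
  · rintro r ρ c' hr h36 ⟨hF, hFn, h3⟩ hc'
    have hS := hS1.frame hF hFn (by simp) (by simp) (by simp) (by simp) (by simp)
    have h7 : ρ.num (k + 7) = σ.num (k + 7) := by rw [hFn _ (by simp), h71]
    have h9 : ρ.num (k + 9) = τ1.num (k + 9) := hFn _ (by simp)
    simp only [wp_setNum, NumExpr.eval, IdxExpr.eval, var_eval, h36, h7, h9, hS.bound r (by omega)]
    refine ⟨by omega, ?_, by omega, trivial, hF.write (by simp) _ _, hFn.write (by simp) _ _,
      fun e he => ?_⟩
    · exact (((BitBound.natCast (hG r (by omega))).mul (hb r (by omega))).div hlb).bits_le_of_le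
        (by omega) hℓ
    · simp only [State.setVar, write_same, Function.update_apply]
      split_ifs with her
      · rw [her]
      · exact h3 e (by omega)
  · rintro τ2 c2 ⟨hF2, hFn2, h3⟩ hc2
    rw [wp_nil]
    exact ⟨by omega, hQ _ _ _ h0 hle hor (fun e => h3 e e.isLt) (by omega)⟩

/-- Counting up by one suffices: the bounds on time and indices may depend polynomially on `1 / ε`.
The loop stops at the first `r` with `r * ε ≥ 1`. -/
theorem wp_ceilProgram (hε : 0 < ε) (h0 : σ.num 0 0 = ε) (hw : ⌈1 / ε⌉₊ ≤ w)
    (hc : 2 * ⌈1 / ε⌉₊ + 3 ≤ c)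
    (hQ : ∀ (τ : State) (c' : ℕ), Frame [32] σ.idx τ.idx → τ.num = σ.num →
      τ.idx 32 0 = ⌈1 / ε⌉₊ → c ≤ c' + (2 * ⌈1 / ε⌉₊ + 3) → Q τ c') :
    wp w ℓ ceilProgram Q σ c := by
  simp only [ceilProgram, wp_cons, wp_setIdx, IdxExpr.eval]
  refine ⟨by omega, by omega, ?_⟩
  refine wp_loop (fun τ c' => Frame [32] σ.idx τ.idx ∧ τ.num = σ.num ∧ τ.idx 32 0 ≤ ⌈1 / ε⌉₊ ∧
    c ≤ c' + 2 * τ.idx 32 0 + 1 ∧ 2 * (⌈1 / ε⌉₊ - τ.idx 32 0) + 2 ≤ c') ?_ ?_ ?_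
  · refine ⟨(Frame.refl _ _).write (by simp) _ _, rfl, ?_⟩
    simp only [write_same, Function.update_self]
    omega
  · rintro τ c' ⟨hF, hn, h32, hc1, hc2⟩ hb
    simp only [Test.Holds, NumExpr.eval, IdxExpr.eval, var_eval, hn, h0] at hb
    have hlt : τ.idx 32 0 < ⌈1 / ε⌉₊ := Nat.lt_ceil.2 ((lt_div_iff₀ hε).2 hb)
    simp only [wp_setIdx, IdxExpr.eval, var_eval]
    refine ⟨by omega, by omega, by omega, hF.write (by simp) _ _, hn, ?_⟩
    simp only [write_same, Function.update_self]
    omega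
  · rintro τ c' ⟨hF, hn, h32, hc1, hc2⟩ hb
    simp only [Test.Holds, NumExpr.eval, IdxExpr.eval, var_eval, hn, h0, not_lt] at hb
    have hle : ⌈1 / ε⌉₊ ≤ τ.idx 32 0 := Nat.ceil_le.2 ((div_le_iff₀ hε).2 hb)
    rw [wp_nil]
    exact ⟨by omega, by omega, hQ _ _ hF hn (by omega) (by omega)⟩

theorem wp_sizeProgram (hm : σ.idx 0 1 = m) (hw : m + k ≤ w)
    (hc : 4 * (m + k).size + 4 ≤ c)
    (hQ : ∀ (τ : State) (c' : ℕ), Frame [33, 34] σ.idx τ.idx → τ.num = σ.num →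
      τ.idx 33 0 = (m + k).size → c ≤ c' + (4 * (m + k).size + 4) → Q τ c') :
    wp w ℓ (sizeProgram k) Q σ c := by
  have hsize : (m + k).size ≤ m + k := Nat.size_le.2 (Nat.lt_two_pow_self)
  simp only [sizeProgram, rowCount, wp_cons, wp_setIdx, IdxExpr.eval, var_eval, write_ne, ne_eq,
    Nat.reduceEqDiff, not_false_eq_true, OfNat.zero_ne_ofNat, hm, Nat.sub_sub, Nat.reduceAdd]
  repeat refine And.intro (by omega) ?_
  refine wp_loop (fun τ c' => Frame [33, 34] σ.idx τ.idx ∧ τ.num = σ.num ∧ τ.idx 34 0 ≤ m + k ∧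
    τ.idx 33 0 + (τ.idx 34 0).size = (m + k).size ∧
    c + 4 * (τ.idx 34 0).size ≤ c' + (4 * (m + k).size + 2) ∧
    4 * (τ.idx 34 0).size + 2 ≤ c') ?_ ?_ ?_
  · refine ⟨((Frame.refl _ _).write (by simp) _ _).write (by simp) _ _, rfl, ?_, ?_, ?_, ?_⟩
    all_goals simp [write_ne]
    all_goals omega
  · rintro τ c' ⟨hF, hnum, h34, h33, hc1, hc2⟩ hb
    simp only [Test.Holds, IdxExpr.eval, var_eval] at hb
    have hs := size_div_two hb
    refine ⟨by omega, ?_⟩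
    simp only [wp_cons, wp_nil, wp_setIdx, IdxExpr.eval, var_eval, write_ne, write_same, ne_eq,
      Nat.reduceEqDiff, not_false_eq_true, Nat.sub_sub, Nat.reduceAdd, Function.update_self]
    repeat refine And.intro (by omega) ?_
    exact ⟨(hF.write (by simp) _ _).write (by simp) _ _, hnum, by omega, by omega, by omega,
      by omega⟩
  · rintro τ c' ⟨hF, hnum, h34, h33, hc1, hc2⟩ hb
    simp only [Test.Holds, IdxExpr.eval, var_eval, not_not] at hb
    simp only [hb, Nat.size_zero] at h33 hc1
    rw [wp_nil]
    exact ⟨by omega, by omega, hQ _ _ hF hnum (by omega) (by omega)⟩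

/-- The oracle expects edge lengths in number array 1, where the capacities arrive, so these have to
be moved before the first iteration. -/
theorem wp_copyProgram (hN : σ.Holds P.toNetwork) (hε : σ.num 0 0 = ε)
    (hcost : ∀ j < k, ∀ e : Fin m, σ.num (j + 4) e = P.row (m + j) e)
    (hcap : ∀ e : Fin m, σ.num 1 e = P.cap e) (hbud : ∀ j : Fin k, σ.num 2 j = P.budget j)
    (hw : m + k ≤ w) (hG : ∑ e, P.cap e ≤ 2 ^ G) (hG' : ∀ j, P.budget j ≤ 2 ^ G)
    (hℓ : 2 * G + 3 ≤ ℓ) (hc : 10 * (m + k) + 8 ≤ c)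
    (hQ : ∀ (τ : State) (c' : ℕ), Frame [36] σ.idx τ.idx →
      τ.Stores P ε → τ.num (k + 10) 0 = (∑ e, P.cap e : ℕ) →
      (∀ i < m + k, τ.num (k + 6) i = 1) → (∀ i < m + k, τ.num (k + 7) i = 0) →
      c ≤ c' + (10 * (m + k) + 8) → Q τ c') :
    wp w ℓ (copyProgram k) Q σ c := by
  have hcapG : ∀ e, P.cap e ≤ 2 ^ G := fun e =>
    (Finset.single_le_sum (fun _ _ => Nat.zero_le _) (Finset.mem_univ e)).trans hG
  simp only [copyProgram, wp_cons, wp_setNum, NumExpr.eval, IdxExpr.eval]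
  refine ⟨by omega, (BitBound.zero G).bits_le_of_le le_rfl hℓ, ?_⟩
  refine wp_forLoop (K := 3) (M := m) (fun r τ => Frame [36] σ.idx τ.idx ∧
    Frame [k + 4, k + 10] σ.num τ.num ∧ (∀ e : Fin m, (e : ℕ) < r → τ.num (k + 4) e = P.cap e) ∧
    τ.num (k + 10) 0 = (∑ e ∈ Finset.univ.filter (fun e : Fin m => (e : ℕ) < r), P.cap e : ℕ))
    (by omega) (by omega) ?_ ?_ ?_ ?_
  · refine ⟨(Frame.refl _ _).write (by simp) _ _, (Frame.refl _ _).write (by simp) _ _, by simp, ?_⟩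
    simp [State.setVar]
  · rintro i ρ ⟨hF, -⟩
    simp [IdxExpr.eval, hF 0 (by simp), hN.edges]
  · rintro r ρ c' hr h36 ⟨hF, hFn, h4, h10⟩ hc'
    have h1 : ρ.num 1 r = P.cap ⟨r, hr⟩ := by
      rw [hFn 1 (by simp)]
      exact hcap ⟨r, hr⟩
    have e2 : (Finset.univ.filter fun e : Fin m => (e : ℕ) < r + 1) =
        insert ⟨r, hr⟩ (Finset.univ.filter fun e : Fin m => (e : ℕ) < r) := by
      ext e
      simp [Fin.ext_iff]
      omega
    have e3 : ρ.num (k + 10) 0 + P.cap ⟨r, hr⟩ =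
        (∑ e ∈ Finset.univ.filter (fun e : Fin m => (e : ℕ) < r + 1), P.cap e : ℕ) := by
      rw [h10, e2, Finset.sum_insert (by simp)]
      push_cast
      ring
    have w10 : ∀ v : ℚ, write ρ.num (k + 4) r v (k + 10) = ρ.num (k + 10) := fun v =>
      write_ne _ _ _ (by omega)
    have w1 : ∀ v : ℚ, write ρ.num (k + 4) r v 1 = ρ.num 1 := fun v => write_ne _ _ _ (by omega)
    simp only [wp_cons, wp_nil, wp_setNum, NumExpr.eval, IdxExpr.eval, var_eval, h36, h1, w10, w1, e3]
    refine ⟨by omega, (BitBound.natCast (hcapG _)).bits_le_of_le le_rfl hℓ, by omega,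
      (BitBound.natCast ?_).bits_le_of_le le_rfl hℓ, by omega, by omega, trivial,
      hF.write (by simp) _ _, (hFn.write (by simp) _ _).write (by simp) _ _, fun e he => ?_, ?_⟩
    · exact (Finset.sum_le_sum_of_subset (Finset.filter_subset _ _)).trans hG
    · simp only [State.setVar]
      rw [write_ne _ _ _ (by omega), write_same, Function.update_apply]
      split_ifs with her
      · rw [show e = ⟨r, hr⟩ from Fin.ext her]
      · exact h4 e (by omega)
    · simp [State.setVar]
  rintro τ1 c1 ⟨hF1, hFn1, h41, h101⟩ hc1
  rw [Finset.filter_true_of_mem fun e _ => e.isLt] at h101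
  have hN1 := hN.frame hF1 (by simp) (by simp) (by simp)
  rw [wp_cons]
  refine wp_forLoop (K := 1) (M := k) (fun r τ => Frame [36] τ1.idx τ.idx ∧
    Frame [k + 4] τ1.num τ.num ∧ ∀ i < m + r, τ.num (k + 4) i = P.bound i)
    (by omega) (by omega) ?_ ?_ ?_ ?_
  · refine ⟨(Frame.refl _ _).write (by simp) _ _, Frame.refl _ _, fun i hi => ?_⟩
    simpa [Problem.bound, State.setVar, show i < m by omega] using h41 ⟨i, by omega⟩ (by simpa using hi)
  · rintro i ρ ⟨hF, -⟩
    simp [IdxExpr.eval]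
  · rintro r ρ c' hr h36 ⟨hF, hFn, h4⟩ hc'
    have h2 : ρ.num 2 r = P.budget ⟨r, hr⟩ := by
      rw [hFn 2 (by simp), hFn1 2 (by simp)]
      exact hbud ⟨r, hr⟩
    simp only [wp_setNum, NumExpr.eval, IdxExpr.eval, var_eval, h36, h2, hF 0 (by simp), hN1.edges]
    refine ⟨by omega, (BitBound.natCast (hG' _)).bits_le_of_le le_rfl hℓ, by omega, trivial,
      hF.write (by simp) _ _, hFn.write (by simp) _ _, fun i hi => ?_⟩
    simp only [State.setVar, write_same, Function.update_apply]
    split_ifs with hir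
    · rw [hir, ← Problem.bound_budget]
    · exact h4 i (by omega)
  rintro τ2 c2 ⟨hF2, hFn2, h42⟩ hc2
  have hN2 := hN1.frame hF2 (by simp) (by simp) (by simp)
  rw [wp_cons]
  refine wp_forLoop (K := 3) (M := m + k) (fun r τ => Frame [36] τ2.idx τ.idx ∧
    Frame [k + 6, k + 7] τ2.num τ.num ∧ ∀ i < r, τ.num (k + 6) i = 1 ∧ τ.num (k + 7) i = 0)
    hw (by omega) ?_ ?_ ?_ ?_
  · exact ⟨(Frame.refl _ _).write (by simp) _ _, Frame.refl _ _, by simp⟩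
  · rintro i ρ ⟨hF, -⟩
    simp [rowCount, IdxExpr.eval, hF 0 (by simp), hN2.edges]
  · rintro r ρ c' hr h36 ⟨hF, hFn, h⟩ hc'
    simp only [wp_cons, wp_nil, wp_setNum, NumExpr.eval, IdxExpr.eval, var_eval, h36]
    refine ⟨by omega, (BitBound.one G).bits_le_of_le le_rfl hℓ, by omega,
      (BitBound.zero G).bits_le_of_le le_rfl hℓ, by omega, by omega, trivial,
      hF.write (by simp) _ _, (hFn.write (by simp) _ _).write (by simp) _ _, fun i hi => ?_⟩
    simp only [State.setVar]
    rw [write_ne _ _ _ (by omega), write_same, write_same, write_ne _ _ _ (by omega),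
      Function.update_apply, Function.update_apply]
    split_ifs with hir
    · exact ⟨rfl, rfl⟩
    · exact h i (by omega)
  · rintro τ3 c3 ⟨hF3, hFn3, h⟩ hc3
    have hn : ∀ a, a ∉ [k + 4, k + 10, k + 6, k + 7] → τ3.num a = σ.num a := fun a ha => by
      simp only [List.mem_cons, List.not_mem_nil, or_false, not_or] at ha
      rw [hFn3 a (by simp; omega), hFn2 a (by simp; omega), hFn1 a (by simp; omega)]
    rw [wp_nil]
    refine ⟨by omega, hQ _ _ ((hF1.trans hF2 (by simp)).trans hF3 (by simp)) ⟨hN2.frame hF3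
      (by simp) (by simp) (by simp), ?_, fun j hj e => ?_, fun i hi => ?_⟩ ?_
      (fun i hi => (h i hi).1) (fun i hi => (h i hi).2) (by omega)⟩
    · rw [hn 0 (by simp), hε]
    · rw [hn _ (by simp; omega), hcost j hj]
    · rw [hFn3 _ (by simp), h42 i hi]
    · rw [hFn3 _ (by simp), hFn2 _ (by simp), h101]

end

/-! ## The approximation scheme: one iteration -/

namespace Problem

variable {n m k : ℕ} {P : Problem n m k}

theorem Progress.congr {ε : ℚ} {t : ℕ} {y y' c c' : ℕ → ℚ} {X : ℚ} (h : P.Progress ε t y c X)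
    (hy : ∀ i < m + k, y' i = y i) (hc : ∀ i < m + k, c' i = c i) : P.Progress ε t y' c' X := by
  have hflow : (fun e : Fin m => ((P.bound e * c' e : ℚ) : ℝ)) =
      fun e : Fin m => ((P.bound e * c e : ℚ) : ℝ) := by
    funext e
    rw [hc e (by omega)]
  refine ⟨fun i hi => ?_, fun i hi => ?_, ?_, ?_, h.value_nonneg, fun i hi => ?_, fun f hf hv => ?_⟩
  · rw [hc i hi]; exact h.nonneg i hi
  · rw [hc i hi, hy i hi]; exact h.weight i hi
  · rw [hflow]; exact h.flow
  · rw [hflow]; exact h.value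
  · rw [hc i hi, ← h.rows i hi]
    exact Finset.sum_congr rfl fun e _ => by rw [hc e (by omega)]
  · rw [Finset.sum_congr rfl fun i hi => by rw [hy i (Finset.mem_range.1 hi)],
      Finset.sum_congr rfl fun i hi => hc i (Finset.mem_range.1 hi)]
    exact h.total f hf hv

theorem load_le {p : List (Fin m)} (hp : p.Nodup) (i : ℕ) : P.load p i ≤ ∑ e, P.row i e := by
  rw [load_eq_sum hp]
  refine Finset.sum_le_sum fun e _ => ?_
  unfold unitFlow
  split_ifs <;> simp

/-- Each multiplication or division by an input number adds `G` bits, and by `rowLength_eq` only `k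
+ 1` terms are summed. -/
theorem bitBound_rowLength {G b : ℕ} {y : ℕ → ℚ} (hy : ∀ i < m + k, BitBound b (y i))
    (hrow : ∀ i < m + k, ∑ e, P.row i e ≤ 2 ^ G) (hbound : ∀ i < m + k, P.bound i ≤ 2 ^ G)
    (e : Fin m) : BitBound ((k + 1) * (b + 2 * G + 1)) (P.rowLength y e) := by
  have h1 : BitBound (b + G) (y e / P.bound e) :=
    (hy e (by omega)).div (BitBound.natCast (hbound e (by omega)))
  have h2 : ∀ j < k, BitBound (b + G + G) (y (m + j) * P.row (m + j) e / P.bound (m + j)) :=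
    fun j hj => ((hy _ (by omega)).mul (BitBound.natCast
      ((Finset.single_le_sum (fun _ _ => Nat.zero_le _) (Finset.mem_univ e)).trans
        (hrow (m + j) (by omega))))).div (BitBound.natCast (hbound _ (by omega)))
  rw [rowLength_eq]
  refine (h1.add (BitBound.finset_sum_range h2)).mono ?_
  ring_nf
  omega

theorem bitBound_guardedLength {b : ℕ} {y : ℕ → ℚ} (hy : ∀ e, BitBound b (P.rowLength y e))
    (e : Fin m) : BitBound (m * (b + 1) + b + 1) (P.guardedLength y e) := by
  unfold guardedLength
  split_ifs
  · exact (hy e).mono (by omega)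
  · refine ((BitBound.one 0).add (?_ : BitBound (m * (b + 1)) _)).mono (by omega)
    rw [← List.sum_ofFn, List.ofFn_eq_map]
    simpa using BitBound.list_sum (l := List.finRange m) fun e _ => hy e

end Problem

/-- Find a shortest path for the current weights, send as much flow as possible along it, and
update congestions and weights. -/
def iterationProgram (k : ℕ) : Program := block [
  lengthProgram k, oracleProgram, loadProgram k, stepSizeProgram k, updateProgram k]

def iterationCost (n m k : ℕ) : ℕ := oracleCost n m + 22 * m + 13 * k + k * (3 * m) + 25

section

variable {n m k w ℓ G c : ℕ} {P : Problem n m k} {ε : ℚ} {σ : State} {Q : State → ℕ → Prop}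

/-- Weights and congestions gain `5 * G + 1` bits: the step size needs `2 * G`, the increment of a
congestion `4 * G`, and multiplication by `ε` and addition of 1 the rest. The growth is additive and
hence polynomial over all iterations. -/
theorem wp_iterationProgram (hε : 0 < ε) (h : σ.Stores P ε) (hw : 4 * n + m + k + 2 ≤ w)
    (hT : σ.num (k + 10) 0 = (∑ e, P.cap e : ℕ)) {t b₀ b B : ℕ} {X : ℚ}
    (hprog : P.Progress ε t (σ.num (k + 6)) (σ.num (k + 7)) X)
    (hrow : ∀ i < m + k, ∑ e, P.row i e ≤ 2 ^ G) (hbound : ∀ i < m + k, P.bound i ≤ 2 ^ G)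
    (hcap : ∑ e, P.cap e ≤ 2 ^ G) (hεG : BitBound G ε)
    (hy : ∀ i < m + k, BitBound b₀ (σ.num (k + 6) i))
    (hcong : ∀ i < m + k, BitBound b₀ (σ.num (k + 7) i))
    (hb : (k + 1) * (b₀ + 5 * G + 1) ≤ b) (hB : m * (b + 1) + b + 1 ≤ B)
    (hℓ : 2 * (B * (B + 1) + 1) + 3 ≤ ℓ) (hc : iterationCost n m k ≤ c)
    (hQ : ∀ (τ : State) (c' : ℕ) (X : ℚ),
      Frame [5, 6, 7, 8, 9, 10, 11, 12, 13, 14, 15, 20, 21, 22, 23, 24, 25, 26, 27, 28, 29, 30, 31, 36]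
        σ.idx τ.idx → τ.Stores P ε → τ.num (k + 10) 0 = (∑ e, P.cap e : ℕ) →
      P.Progress ε (t + 1) (τ.num (k + 6)) (τ.num (k + 7)) X →
      (∀ i < m + k, BitBound (b₀ + (5 * G + 1)) (τ.num (k + 6) i)) →
      (∀ i < m + k, BitBound (b₀ + (5 * G + 1)) (τ.num (k + 7) i)) →
      c ≤ c' + iterationCost n m k → Q τ c') :
    wp w ℓ (iterationProgram k) Q σ c := by
  have e1 : k * (3 * m + 4) = k * (3 * m) + 4 * k := by ring
  unfold iterationCost at hc hQ
  have hm1 := P.one_le_edges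
  have hbb : b₀ + 5 * G + 1 ≤ b := (Nat.le_mul_of_pos_left _ (Nat.succ_pos k)).trans hb
  have hmb : b ≤ m * (b + 1) := by nlinarith
  have hmB : m ≤ B := by nlinarith
  have hBB : B ≤ B * (B + 1) := Nat.le_mul_of_pos_right _ (Nat.succ_pos B)
  have hrl : ∀ e, BitBound b (P.rowLength (σ.num (k + 6)) e) := fun e =>
    (Problem.bitBound_rowLength hy hrow hbound e).mono
      ((Nat.mul_le_mul_left _ (by omega)).trans hb)
  have hgl : ∀ e, BitBound B (P.guardedLength (σ.num (k + 6)) e) := fun e =>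
    (Problem.bitBound_guardedLength hrl e).mono hB
  have hsum : ∀ p : List (Fin m), p.Nodup →
      BitBound (B * (B + 1)) (p.map (P.guardedLength (σ.num (k + 6)))).sum := fun p hp =>
    BitBound.nodup_sum hgl hmB le_rfl hp
  simp only [iterationProgram, wp_cons]
  refine wp_lengthProgram (b := b) h (by omega) hrl (by omega) (by omega) ?_
  intro τ1 c1 hF1 hn1 hd hc1
  have hS1 := h.frame hF1 hn1 (by simp) (by simp) (by simp) (by simp) (by simp)
  have hF1' : Frame [5, 6, 7, 8, 9, 10, 11, 12, 13, 14, 15, 20, 21, 22, 23, 24, 25, 26, 27, 28, 29, 30,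
    31, 36] σ.idx τ1.idx := (Frame.refl _ _).trans hF1 (by simp)
  rw [wp_cons]
  refine wp_oracleProgram
    (fun e => Problem.guardedLength_nonneg (fun i hi => (hprog.weight_pos hε hi).le) e) (by omega)
    (fun p hp => (hsum p hp).bits_le_of_le (Nat.le_succ _) hℓ)
    (fun p hp => ((BitBound.one 0).add (hsum p hp)).bits_le_of_le (by omega) hℓ)
    hS1.holds hd (by omega) ?_
  intro τ2 c2 p hF2 hn2 h3 hmin hno hc2
  have hS2 := hS1.frame hF2 hn2 (by simp) (by simp) (by simp) (by simp) (by simp)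
  have hF2' := hF1'.trans hF2 (by simp)
  have hnd : p.Nodup := by
    by_cases hex : ∃ q, P.IsPath q
    · exact (hmin hex).1.edges_nodup
    · rw [hno hex]; exact List.nodup_nil
  have hload : ∀ i < m + k, P.load p i ≤ 2 ^ G := fun i hi =>
    (Problem.load_le hnd i).trans (hrow i hi)
  rw [wp_cons]
  refine wp_loadProgram (G := G) hS2 (by omega) hnd h3 hrow (by omega) (by omega) ?_
  intro τ3 c3 hF3 hn3 hA3 hc3
  have hS3 := hS2.frame hF3 hn3 (by simp) (by simp) (by simp) (by simp) (fun i hi => by simp; omega)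
  have hF3' := hF2'.trans hF3 (by simp)
  have hn13 : ∀ a, 6 ≤ a → τ3.num (k + a) = σ.num (k + a) := fun a ha => by
    rw [hn3 _ (by simp; omega), hn2 _ (by simp; omega), hn1 _ (by simp; omega)]
  rw [wp_cons]
  refine wp_stepSizeProgram (G := G) hS3 (by omega) hA3 (T := ((∑ e, P.cap e : ℕ) : ℚ))
    (by rw [hn13 10 (by omega), hT]) (Nat.cast_nonneg _)
    (BitBound.natCast (hcap.trans (Nat.pow_le_pow_right two_pos (by omega)))) hbound hload
    (by omega) (by omega) ?_
  intro τ4 c4 hF4 hn4 ha0 hab hale haor hc4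
  have hS4 := hS3.frame hF4 hn4 (by simp) (by simp) (by simp) (by simp) (fun i hi => by simp; omega)
  have hF4' := hF3'.trans hF4 (by simp)
  have h64 : τ4.num (k + 6) = σ.num (k + 6) := by rw [hn4 _ (by simp), hn13 6 le_rfl]
  have h74 : τ4.num (k + 7) = σ.num (k + 7) := by rw [hn4 _ (by simp), hn13 7 (by omega)]
  have hA4 : ∀ i < m + k, τ4.num (k + 5) i = P.load p i := fun i hi => by
    rw [hn4 _ (by simp), hA3 i hi]
  obtain ⟨a, ha⟩ : ∃ a, a = τ4.num (k + 8) 0 := ⟨_, rfl⟩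
  rw [← ha] at ha0 hab hale haor
  have hinc : ∀ i < m + k, BitBound (4 * G) (a * P.load p i / P.bound i) := fun i hi =>
    ((hab.mul (BitBound.natCast (hload i hi))).div (BitBound.natCast (hbound i hi))).mono (by omega)
  have hbc : ∀ i < m + k, BitBound (b₀ + (5 * G + 1))
      (σ.num (k + 7) i + a * P.load p i / P.bound i) := fun i hi =>
    ((hcong i hi).add (hinc i hi)).mono (by omega)
  have hby : ∀ i < m + k, BitBound (b₀ + (5 * G + 1))
      (σ.num (k + 6) i * (1 + ε * (a * P.load p i / P.bound i))) := fun i hi =>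
    ((hy i hi).mul ((BitBound.one 0).add (hεG.mul (hinc i hi)))).mono (by omega)
  rw [wp_cons]
  refine wp_updateProgram (b := b₀ + (5 * G + 1)) hS4 (by omega) hA4
    (by rw [h74, ← ha]; exact hbc) (by rw [h64, ← ha]; exact hby) (by omega) (by omega) ?_
  intro τ5 c5 hF5 hn5 h7 h6 hc5
  rw [h74, ← ha] at h7
  rw [h64, ← ha] at h6
  have hS5 := hS4.frame hF5 hn5 (by simp) (by simp) (by simp) (by simp) (fun i hi => by simp; omega)
  have hcapT : ∀ e, (P.cap e : ℚ) ≤ ((∑ e, P.cap e : ℕ) : ℚ) := fun e => by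
    exact_mod_cast Finset.single_le_sum (f := P.cap) (fun _ _ => Nat.zero_le _) (Finset.mem_univ e)
  obtain ⟨X', hX'⟩ := hprog.step hε hcapT hmin hno ha0 hale haor
  rw [wp_nil]
  refine ⟨by omega, hQ _ _ X' (hF4'.trans hF5 (by simp)) hS5 ?_ (hX'.congr h6 h7)
    (fun i hi => ?_) (fun i hi => ?_) (by omega)⟩
  · rw [hn5 _ (by simp), hn4 _ (by simp), hn13 10 (by omega), hT]
  · rw [h6 i hi]; exact hby i hi
  · rw [h7 i hi]; exact hbc i hi

/-- The number of iterations, computed from the contents of the variables `32` and `33`. -/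
def iterationBound (k : ℕ) : IdxExpr :=
  .mul (.mul (.mul (.lit 2) (rowCount k)) (var 33)) (.mul (var 32) (var 32))

/-- The approximation scheme for `k` budget constraints. -/
def approxProgram (k : ℕ) : Program := block [
  copyProgram k, ceilProgram, sizeProgram k,
  forLoop 35 (iterationBound k) (iterationProgram k),
  scaleProgram k]

/-- An integer upper bound for `2 * (m + k) * log (m + k) / ε ^ 2`, with the binary length in place
of the logarithm and `E = ⌈1 / ε⌉`, so that index registers can compute it. -/
def iterations (m k E : ℕ) : ℕ := 2 * (m + k) * (m + k).size * (E * E)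

def approxCost (n m k E : ℕ) : ℕ :=
  (iterationCost n m k + 2) * iterations m k E + 17 * (m + k) + 4 * (m + k).size + 2 * E + 24

/-- A sum of `m` numbers of size `2 ^ S` is absorbed by doubling the exponent, as `m ≤ S ≤ 2 ^ S`;
hence `G = 2 * S` below. -/
theorem le_two_pow_two_mul {m S a : ℕ} (hm : m ≤ S) (ha : a ≤ m * 2 ^ S) : a ≤ 2 ^ (2 * S) := by
  refine ha.trans ?_
  rw [two_mul, pow_add]
  exact Nat.mul_le_mul_right _ (hm.trans S.lt_two_pow_self.le)

theorem wp_approxProgram (hε : 0 < ε) (hε1 : ε < 1) (hN : σ.Holds P.toNetwork) (h0 : σ.num 0 0 = ε)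
    (hcost : ∀ (j : Fin k) (e : Fin m), σ.num (j + 4) e = P.cost j e)
    (hcap : ∀ e : Fin m, σ.num 1 e = P.cap e) (hbud : ∀ j : Fin k, σ.num 2 j = P.budget j)
    {S T b B : ℕ} (hmS : m ≤ S) (hεS : BitBound S ε) (hcapS : ∀ e, P.cap e ≤ 2 ^ S)
    (hbudS : ∀ j, P.budget j ≤ 2 ^ S) (hcostS : ∀ j e, P.cost j e ≤ 2 ^ S)
    (hw : 4 * n + m + k + 2 ≤ w) (hwE : ⌈1 / ε⌉₊ ≤ w) (hwT : iterations m k ⌈1 / ε⌉₊ ≤ w)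
    (hT : iterations m k ⌈1 / ε⌉₊ ≤ T) (hb : (k + 1) * ((T + 1) * (10 * S + 1)) ≤ b)
    (hB : m * (b + 1) + b + 1 ≤ B) (hℓ : 2 * (B * (B + 1) + 1) + 3 ≤ ℓ)
    (hc : approxCost n m k ⌈1 / ε⌉₊ ≤ c) (hQ : ∀ (τ : State) (c' : ℕ),
      (P.IsApprox ε fun e => (τ.num 3 e : ℝ)) → Q τ c') :
    wp w ℓ (approxProgram k) Q σ c := by
  have hm1 := P.one_le_edges
  have hTb : (T + 1) * (10 * S + 1) ≤ b :=
    (Nat.le_mul_of_pos_left _ (Nat.succ_pos k)).trans hb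
  have hTb' : T * (10 * S + 1) + (10 * S + 1) ≤ b := by rwa [Nat.add_one_mul] at hTb
  have hBB : 2 * B ≤ B * (B + 1) := by
    rw [mul_comm 2]; exact Nat.mul_le_mul_left B (by omega)
  have hmb : b ≤ m * (b + 1) := by nlinarith
  have hrow : ∀ i < m + k, ∑ e, P.row i e ≤ 2 ^ (2 * S) := by
    intro i hi
    rcases Problem.row_cases hi with ⟨e, rfl⟩ | ⟨j, rfl⟩
    · simpa [Problem.row_edge] using Nat.one_le_two_pow
    · refine le_two_pow_two_mul hmS ((Finset.sum_le_card_nsmul _ _ (2 ^ S) fun e _ => ?_).trans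
        (by simp))
      rw [Problem.row_budget]
      exact hcostS j e
  have hSS : 2 ^ S ≤ 2 ^ (2 * S) := Nat.pow_le_pow_right two_pos (by omega)
  have hbound : ∀ i < m + k, P.bound i ≤ 2 ^ (2 * S) := by
    intro i hi
    rcases Problem.row_cases hi with ⟨e, rfl⟩ | ⟨j, rfl⟩
    · rw [Problem.bound_edge]; exact (hcapS e).trans hSS
    · rw [Problem.bound_budget]; exact (hbudS j).trans hSS
  have hcapsum : ∑ e, P.cap e ≤ 2 ^ (2 * S) :=
    le_two_pow_two_mul hmS ((Finset.sum_le_card_nsmul _ _ (2 ^ S) fun e _ => hcapS e).trans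
      (by simp))
  unfold approxCost at hc
  set E := ⌈1 / ε⌉₊ with hE
  simp only [approxProgram, wp_cons]
  refine wp_copyProgram (G := 2 * S) hN h0 (fun j hj e => ?_) hcap hbud (by omega) hcapsum
    (fun j => (hbudS j).trans hSS) (by omega) (by omega) ?_
  · rw [hcost ⟨j, hj⟩ e, ← Problem.row_budget]
  intro τ1 c1 hF1 hS1 hT1 h61 h71 hc1
  rw [wp_cons]
  refine wp_ceilProgram hε hS1.eps hwE (by omega) ?_
  intro τ2 c2 hF2 hn2 h32 hc2
  rw [wp_cons]
  refine wp_sizeProgram (m := m) (k := k) (by rw [hF2 0 (by simp), hS1.holds.edges]) (by omega)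
    (by omega) ?_
  intro τ3 c3 hF3 hn3 h33 hc3
  have hS3 : τ3.Stores P ε := hS1.frame (S := [32, 33, 34]) (S' := [])
    (((Frame.refl _ _).trans hF2 (by simp)).trans hF3 (by simp)) (by rw [hn3, hn2]; exact Frame.refl _ _)
    (by simp) (by simp) (by simp) (by simp) (by simp)
  have hn31 : τ3.num = τ1.num := by rw [hn3, hn2]
  rw [wp_cons]
  -- With `G = 2 * S` every iteration adds `10 * S + 1` bits, so the bound is linear in the number
  -- of iterations.
  refine wp_forLoop (K := iterationCost n m k) (M := iterations m k E) (fun t τ =>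
    (∃ X, P.Progress ε t (τ.num (k + 6)) (τ.num (k + 7)) X) ∧ τ.Stores P ε ∧
    τ.num (k + 10) 0 = (∑ e, P.cap e : ℕ) ∧ τ.idx 32 0 = E ∧ τ.idx 33 0 = (m + k).size ∧
    (∀ i < m + k, BitBound (t * (10 * S + 1)) (τ.num (k + 6) i)) ∧
    ∀ i < m + k, BitBound (t * (10 * S + 1)) (τ.num (k + 7) i)) hwT (by omega) ?_ ?_ ?_ ?_
  · simp only [State.setVar, hn31, write_ne, ne_eq, Nat.reduceEqDiff, not_false_eq_true]
    refine ⟨⟨0, Problem.Progress.init.congr h61 h71⟩, ?_, hT1, ?_, h33, fun i hi => ?_,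
      fun i hi => ?_⟩
    · exact hS3.frame (S := [35]) (S' := []) ((Frame.refl _ _).write (by simp) _ _)
        (by rw [hn31]; exact Frame.refl _ _) (by simp) (by simp) (by simp) (by simp) (by simp)
    · rw [hF3 32 (by simp), h32]
    · rw [h61 i hi]; exact BitBound.one _
    · rw [h71 i hi]; exact BitBound.zero _
  · rintro t ρ ⟨-, hS, -, h32, h33, -, -⟩
    simp [iterationBound, rowCount, IdxExpr.eval, hS.holds.edges, h32, h33, iterations]
  · rintro t ρ c' ht h35 ⟨⟨X, hX⟩, hS, hTρ, h32, h33, hy, hcg⟩ hc'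
    have htg : t * (10 * S + 1) + (10 * S + 1) ≤ (T + 1) * (10 * S + 1) := by
      rw [← Nat.add_one_mul]
      exact Nat.mul_le_mul_right _ (by omega)
    refine wp_iterationProgram (G := 2 * S) (b₀ := t * (10 * S + 1)) (b := b) (B := B) hε hS hw hTρ
      hX hrow hbound hcapsum (hεS.mono (by omega)) hy hcg
      ((Nat.mul_le_mul_left _ (by omega)).trans hb) hB hℓ hc' ?_
    intro τ c'' X' hF hS' hT' hX' hy' hc'' hcc
    refine ⟨hcc, by rw [hF 35 (by simp), h35], ⟨X', hX'⟩, ?_, hT', ?_, ?_, fun i hi => ?_,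
      fun i hi => ?_⟩
    · exact hS'.frame (S := [35]) (S' := []) ((Frame.refl _ _).write (by simp) _ _)
        (Frame.refl _ _) (by simp) (by simp) (by simp) (by simp) (by simp)
    · simp only [State.setVar]
      rw [write_ne _ _ _ (by omega), hF 32 (by simp), h32]
    · simp only [State.setVar]
      rw [write_ne _ _ _ (by omega), hF 33 (by simp), h33]
    · exact (hy' i hi).mono (by rw [Nat.add_one_mul t]; omega)
    · exact (hc'' i hi).mono (by rw [Nat.add_one_mul t]; omega)
  · rintro τ c' ⟨⟨X, hX⟩, hS, hTτ, h32, h33, hy, hcg⟩ hc'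
    have htg : iterations m k E * (10 * S + 1) ≤ T * (10 * S + 1) := Nat.mul_le_mul_right _ hT
    rw [wp_cons]
    refine wp_scaleProgram (G := 2 * S) hS (by omega) hcg hbound (by omega) (by omega) ?_
    intro τ' c'' l hl0 hl hl' h3 hcc
    rw [wp_nil]
    refine ⟨by omega, hQ _ _ ?_⟩
    simp only [h3]
    refine hX.isApprox hε hε1 hl0 hl hl' ?_
    have hEε : 1 / ε ≤ E := Nat.le_ceil _
    have h1 : 1 / ε ^ 2 ≤ (E : ℚ) * E := by
      rw [show 1 / ε ^ 2 = (1 / ε) * (1 / ε) by ring]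
      exact mul_le_mul hEε hEε (by positivity) (by positivity)
    rw [iterations, div_eq_mul_one_div]
    push_cast
    exact mul_le_mul_of_nonneg_left h1 (by positivity)

end

/-! ## The approximation scheme: running time and encoding lengths -/

theorem iterationCost_le {n m k : ℕ} (N : Network n m) :
    (iterationCost n m k + 2 : ℝ) ≤ (1549 + 16 * k) * (m + n * Real.log n) := by
  have h1 := oracleCost_le N
  have hm : (1 : ℝ) ≤ m := by exact_mod_cast N.one_le_edges
  have hn : (1 : ℝ) ≤ n := by have := N.two_le; exact_mod_cast (by omega : 1 ≤ n)
  have hlog : 0 ≤ n * Real.log n := mul_nonneg (by linarith) (Real.log_nonneg hn)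
  have hk : (0 : ℝ) ≤ k := Nat.cast_nonneg k
  have h2 : (k : ℝ) ≤ k * m := le_mul_of_one_le_right hk hm
  have h3 : 0 ≤ k * (n * Real.log n) := mul_nonneg hk hlog
  unfold iterationCost
  push_cast
  nlinarith

theorem approxCost_le {n m k : ℕ} (N : Network n m) {ε : ℚ} (hε : 0 < ε) (hε1 : ε < 1) :
    (approxCost n m k ⌈1 / ε⌉₊ : ℝ) ≤ (32 * (k + 1) ^ 2 * (1549 + 16 * k) + 50 * (k + 1) + 60) *
      (1 / (ε : ℝ) ^ 2 * (m * Real.log (m + 1)) * (m + n * Real.log n)) := by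
  have h1 := iterationCost_le (k := k) N
  have hm : (1 : ℝ) ≤ m := by exact_mod_cast N.one_le_edges
  have hn : (1 : ℝ) ≤ n := by have := N.two_le; exact_mod_cast (by omega : 1 ≤ n)
  have hlog : 0 ≤ n * Real.log n := mul_nonneg (by linarith) (Real.log_nonneg hn)
  have hk : (0 : ℝ) ≤ k := Nat.cast_nonneg k
  obtain ⟨M, hM⟩ : ∃ M : ℝ, M = m + n * Real.log n := ⟨_, rfl⟩
  have hM1 : 1 ≤ M := by linarith
  obtain ⟨L, hL⟩ : ∃ L : ℝ, L = Real.log (m + 1) := ⟨_, rfl⟩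
  have hL2 : 1 / 2 ≤ L := by
    have h2 := Real.log_two_gt_d9
    have h3 : Real.log 2 ≤ Real.log (m + 1) := Real.log_le_log (by norm_num) (by linarith)
    linarith
  have hε' : (0 : ℝ) < ε := by exact_mod_cast hε
  have hε1' : (ε : ℝ) < 1 := by exact_mod_cast hε1
  obtain ⟨x, hx⟩ : ∃ x : ℝ, x = 1 / ε := ⟨_, rfl⟩
  have hx1 : 1 ≤ x := by rw [hx, le_div_iff₀ hε']; linarith
  have hE : (⌈1 / ε⌉₊ : ℝ) ≤ 2 * x := by
    have h2 : (⌈1 / ε⌉₊ : ℚ) < 1 / ε + 1 := Nat.ceil_lt_add_one (by positivity)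
    have h3 : (⌈1 / ε⌉₊ : ℝ) < x + 1 := by rw [hx]; exact_mod_cast h2
    linarith
  obtain ⟨E, hEe⟩ : ∃ E : ℕ, E = ⌈1 / ε⌉₊ := ⟨_, rfl⟩
  rw [← hEe] at hE
  -- From `m + k ≤ (m + 1) * exp k`, the constants being absorbed by `L ≥ 1 / 2`; this needs `log (m
  -- + 1)` rather than `log m`.
  have hs : ((m + k).size : ℝ) ≤ 4 * (k + 1) * L := by
    have h2 := size_le_log (n := m + k) (by have := N.one_le_edges; omega)
    have h3 : Real.log ((m + k : ℕ) : ℝ) ≤ Real.log (m + 1) + k := by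
      have h4 : ((m + k : ℕ) : ℝ) ≤ (m + 1) * Real.exp k := by
        have := Real.add_one_le_exp (k : ℝ)
        push_cast
        nlinarith
      refine (Real.log_le_log (by push_cast; linarith) h4).trans (le_of_eq ?_)
      rw [Real.log_mul (by linarith) (Real.exp_pos _).ne', Real.log_exp]
    rw [← hL] at h3
    nlinarith
  have hmk : (m + k : ℝ) ≤ (k + 1) * m := by nlinarith
  obtain ⟨F, hF⟩ : ∃ F : ℝ, F = x ^ 2 * (m * L) := ⟨_, rfl⟩
  have hL0 : 0 ≤ L := by linarith
  have hx2 : x ≤ x ^ 2 := by nlinarith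
  have hmL : L ≤ m * L := le_mul_of_one_le_left hL0 hm
  have hmL0 : 0 ≤ m * L := hL0.trans hmL
  have hF0 : m * L ≤ F := by rw [hF]; exact le_mul_of_one_le_left hmL0 (by nlinarith)
  have hxF : x ≤ 2 * F := by
    have h2 : x ^ 2 * (1 / 2) ≤ x ^ 2 * (m * L) := mul_le_mul_of_nonneg_left (by linarith) (by positivity)
    linarith
  -- The factor 32 collects 2 from the number of iterations, 4 from the binary length and 4 from `E
  -- * E ≤ (2 * x) ^ 2`.
  have hT : (iterations m k E : ℝ) ≤ 32 * (k + 1) ^ 2 * F := by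
    have h2 : ((m + k : ℝ)) * (m + k).size ≤ ((k + 1) * m) * (4 * (k + 1) * L) :=
      mul_le_mul hmk hs (Nat.cast_nonneg _) (by positivity)
    have h3 : (E : ℝ) * E ≤ (2 * x) * (2 * x) :=
      mul_le_mul hE hE (Nat.cast_nonneg _) (by linarith)
    have h4 := mul_le_mul h2 h3 (by positivity) (by positivity)
    have e1 : (iterations m k E : ℝ) = 2 * ((m + k) * (m + k).size * (E * E)) := by
      unfold iterations; push_cast; ring
    rw [e1, hF]
    linarith
  have hFM : F ≤ F * M := le_mul_of_one_le_right (by linarith) hM1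
  have hmain : (iterationCost n m k + 2 : ℝ) * iterations m k E ≤
      (1549 + 16 * k) * M * (32 * (k + 1) ^ 2 * F) :=
    mul_le_mul (by rw [hM]; exact h1) hT (Nat.cast_nonneg _) (by positivity)
  have hmF : (m : ℝ) ≤ 2 * F := by nlinarith
  have hrest : (17 * (m + k) + 4 * (m + k).size + 2 * E + 24 : ℝ) ≤ (50 * (k + 1) + 60) * F := by
    have h2 : (k + 1 : ℝ) * m ≤ (k + 1) * (2 * F) := mul_le_mul_of_nonneg_left hmF (by linarith)
    have h3 : (k + 1 : ℝ) * L ≤ (k + 1) * F := mul_le_mul_of_nonneg_left (by linarith) (by linarith)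
    linarith
  have hrest' : (50 * (k + 1) + 60) * F ≤ (50 * (k + 1) + 60) * (F * M) :=
    mul_le_mul_of_nonneg_left hFM (by positivity)
  have e2 : 1 / (ε : ℝ) ^ 2 * (m * Real.log (m + 1)) * (m + n * Real.log n) = F * M := by
    rw [hF, hM, hL, hx]; ring
  rw [e2, ← hEe]
  unfold approxCost
  push_cast
  linarith

namespace Problem

variable {n m k : ℕ} {P : Problem n m k}

theorem bits_cap_le (e : Fin m) : bits (P.cap e) ≤ P.size := by
  have := Finset.single_le_sum (f := fun e => bits (P.cap e)) (fun _ _ => Nat.zero_le _)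
    (Finset.mem_univ e)
  unfold size
  omega

theorem bits_budget_le (j : Fin k) : bits (P.budget j) ≤ P.size := by
  have := Finset.single_le_sum (f := fun j => bits (P.budget j) + ∑ e, bits (P.cost j e))
    (fun _ _ => Nat.zero_le _) (Finset.mem_univ j)
  unfold size
  omega

theorem bits_cost_le (j : Fin k) (e : Fin m) : bits (P.cost j e) ≤ P.size := by
  have h1 := Finset.single_le_sum (f := fun j => bits (P.budget j) + ∑ e, bits (P.cost j e))
    (fun _ _ => Nat.zero_le _) (Finset.mem_univ j)
  have h2 := Finset.single_le_sum (f := fun e => bits (P.cost j e)) (fun _ _ => Nat.zero_le _)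
    (Finset.mem_univ e)
  unfold size
  omega

theorem le_two_pow_of_bits {a S : ℕ} (h : bits a ≤ S) : a ≤ 2 ^ S := by
  simpa using ((BitBound.of_bits (a : ℚ)).mono h).1

theorem start_within {ε : ℚ} {w ℓ : ℕ} (hw : n + m ≤ w) (hℓ : P.size + bits ε ≤ ℓ) :
    (P.start ε).Within w ℓ := by
  have h2 : bits 0 ≤ ℓ := by
    rw [bits_zero]
    have := P.two_le
    unfold size at hℓ
    omega
  refine ⟨fun a i => (P.indexInput_le a i).trans hw, fun a i => ?_⟩
  rcases a with _ | _ | _ | _ | a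
  · simp only [start]
    split_ifs
    · omega
    · exact h2
  · simp only [start, cells]
    split_ifs with h
    · exact (bits_cap_le _).trans (by omega)
    · exact h2
  · simp only [start, cells]
    split_ifs with h
    · exact (bits_budget_le _).trans (by omega)
    · exact h2
  · exact h2
  · simp only [start]
    split_ifs with ha
    · simp only [cells]
      split_ifs with h
      · exact (bits_cost_le _ _).trans (by omega)
      · exact h2
    · exact h2

end Problem

theorem hasStronglyPolynomialFPTAS (k : ℕ) : HasStronglyPolynomialFPTAS k := by
  -- These polynomials bound the number of iterations, the bits of a row length and the bits of a
  -- guarded length, with `(m + k).size` replaced by the cruder `m + k` and the network size by the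
  -- variable.
  let tP : Polynomial ℕ := 2 * (.X + (k : Polynomial ℕ)) * (.X + (k : Polynomial ℕ)) * (.X * .X)
  let bP : Polynomial ℕ := ((k : Polynomial ℕ) + 1) * ((tP + 1) * (10 * .X + 1))
  let BP : Polynomial ℕ := .X * (bP + 1) + bP + 1
  refine ⟨approxProgram k, 32 * (k + 1) ^ 2 * (1549 + 16 * k) + 50 * (k + 1) + 60,
    tP + 4 * .X + (k : Polynomial ℕ) + 2, 2 * (BP * (BP + 1) + 1) + 3, fun n m P ε hε hε1 => ?_⟩
  simp only [tP, bP, BP, Polynomial.eval_add, Polynomial.eval_mul, Polynomial.eval_ofNat,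
    Polynomial.eval_X, Polynomial.eval_one, Polynomial.eval_natCast]
  obtain ⟨E, hE⟩ : ∃ E, E = ⌈1 / ε⌉₊ := ⟨_, rfl⟩
  obtain ⟨S, hS⟩ : ∃ S, S = P.size + bits ε + E := ⟨_, rfl⟩
  have hPm : n + m ≤ P.size := by unfold Problem.size; omega
  have hiter : ∀ x, m ≤ x → E ≤ x → iterations m k E ≤ 2 * (x + k) * (x + k) * (x * x) := by
    intro x hmx hEx
    have h1 : (m + k).size ≤ x + k := (Nat.size_le.2 Nat.lt_two_pow_self).trans (by omega)
    exact Nat.mul_le_mul (Nat.mul_le_mul (Nat.mul_le_mul_left 2 (by omega)) h1)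
      (Nat.mul_le_mul hEx hEx)
  rw [← hE, ← hS]
  set T := 2 * (S + k) * (S + k) * (S * S)
  set b := (k + 1) * ((T + 1) * (10 * S + 1))
  set B := S * (b + 1) + b + 1
  have hiw := hiter (n + m + E) (by omega) (by omega)
  have key := wp_approxProgram (P := P) (σ := P.start ε) (S := S) (T := T) (b := b) (B := B)
    (w := 2 * (n + m + E + k) * (n + m + E + k) * ((n + m + E) * (n + m + E)) + 4 * (n + m + E) + k + 2)
    (ℓ := 2 * (B * (B + 1) + 1) + 3) (c := approxCost n m k ⌈1 / ε⌉₊)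
    (Q := fun τ _ => P.IsApprox ε fun e => (τ.output m e : ℝ)) hε hε1
    (Network.holds_of_idx rfl) (by simp [Problem.start])
    (fun j e => by simp [Problem.start, cells])
    (fun e => cells_apply (fun e => (P.cap e : ℚ)) e)
    (fun j => cells_apply (fun j => (P.budget j : ℚ)) j) (by omega)
    ((BitBound.of_bits ε).mono (by omega))
    (fun e => Problem.le_two_pow_of_bits ((Problem.bits_cap_le e).trans (by omega)))
    (fun j => Problem.le_two_pow_of_bits ((Problem.bits_budget_le j).trans (by omega)))
    (fun j e => Problem.le_two_pow_of_bits ((Problem.bits_cost_le j e).trans (by omega)))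
    (by omega) (by omega) (by rw [← hE]; omega) (by rw [← hE]; exact hiter S (by omega) (by omega))
    le_rfl
    (by have := Nat.mul_le_mul_right (b + 1) (show m ≤ S by omega); omega) le_rfl le_rfl
    (fun τ c' h => h)
  have hSB : S ≤ B := by
    have : S ≤ S * (b + 1) := Nat.le_mul_of_pos_right _ (by omega)
    omega
  have hBB : B ≤ B * (B + 1) := Nat.le_mul_of_pos_right _ (by omega)
  obtain ⟨τ, U, h1, h2, -, h3⟩ := key.exec (Problem.start_within (by omega) (by omega))
  exact ⟨τ, U, h1, le_trans (by exact_mod_cast h2) (approxCost_le P.toNetwork hε hε1), h3⟩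

end BCMF

theorem mainTheorem8 :
    BCMF.FlowsDecompose ∧ BCMF.HasMinimizingOracle ∧
      ∀ k : ℕ, BCMF.HasStronglyPolynomialFPTAS k :=
  ⟨BCMF.flowsDecompose, BCMF.hasMinimizingOracle, BCMF.hasStronglyPolynomialFPTAS⟩
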